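/- Consider the following optimization problem (Minimum Energy-Cost Aggregation Tree with Relay Nodes). An instance consists of a finite connected graph $G=(V,E)$, a sink $r\in V$, a set of sources $U\subseteq V\setminus\{r\}$, report sizes $s(v)$ with $s(v)\in\mathbb{Z}^+$ for $v\in U$ and $s(v)=0$ for $v\notin U$, an aggregation ratio $q\in\mathbb{Z}^+$, and energies $Tx,Rx>0$ for sending and receiving one packet. A routing tree is a directed tree $T=(V_T,E_T)$ with all arcs pointing towards the root $r$, with $U\cup\{r\}\subseteq V_T\subseteq V$ and with $\{u,v\}\in E$ for every arc $(u,v)\in E_T$. In $T$, each node $v\neq r$ sends $\lceil L_T(v)/q\rceil$ packets to its parent, where $L_T(v)$ is the sum of the sizes $s(u)$ over $v$ and all its descendants $u$; $COST(T)$ is the total energy spent by all nodes of $T$ on sending and receiving packets. The goal is to minimize $COST(T)$ over all routing trees. For a connected graph with edge lengths and a root $r$, an $(\alpha,\beta)$-LAST is a spanning tree in which the distance of every node to $r$ is at most $\alpha$ times its distance to $r$ in the graph, and whose total weight is at most $\beta$ times that of a minimum spanning tree. Consider the following algorithm with input $(G,U,r)$. 1. Form the complete graph $G'$ with node set $U\cup\{r\}$,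 the edge $\{u,v\}$ having as length the hop distance from $u$ to $v$ in $G$. 2. Compute a $(3,2)$-LAST $T_L$ of $G'$ with root $r$. 3. Let $G''$ be the subgraph of $G$ formed by $r$ and the union, over the edges $\{u,v\}$ of $T_L$, of one shortest path $P_{u,v}$ of $G$ between $u$ and $v$. 4. Return a shortest path tree (with respect to hop distance) of $G''$ that is rooted at $r$ and spans $U$. Theorem. This is a 7-approximation algorithm. That is: whichever $(3,2)$-LAST, shortest paths and shortest path tree are chosen, the returned tree $T$ is a routing tree and $COST(T)\le 7\,COST(T')$ for every routing tree $T'$ (in particular for an optimal one); and the algorithm has an implementation that returns such an output on every instance, in a number of steps bounded by a polynomial in $|V|$. -/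

import Mathlib

universe u

namespace Aggregation

/-! ### Problem instances, routing trees and their energy cost -/

/-- An instance of the minimum energy-cost aggregation tree problem with relay nodes: a connected
graph, a sink, a set of sources (not containing the sink), report sizes that are positive on
sources and zero elsewhere, an aggregation ratio and the energies for sending and receiving one
packet. -/
structure Network (V : Type u) where
  graph : SimpleGraph V
  connected : graph.Connected
  sink : V
  sources : Finset V
  sink_notMem : sink ∉ sources
  size : V → ℕ
  size_pos : ∀ v ∈ sources, 0 < size v
  size_eq_zero : ∀ v, v ∉ sources → size v = 0
  ratio : ℕ
  ratio_pos : 0 < ratio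
  Tx : ℝ
  Tx_pos : 0 < Tx
  Rx : ℝ
  Rx_pos : 0 < Rx

/-- A directed tree on a set of nodes of `V`, with all arcs `(v, parent v)` pointing towards the
root `r`. By convention `parent r = r`; this is not an arc. Values of `parent` outside `nodes` are
irrelevant. -/
structure RootedTree (V : Type u) (r : V) where
  nodes : Finset V
  parent : V → V
  root_mem : r ∈ nodes
  parent_root : parent r = r
  parent_mem : ∀ v ∈ nodes, parent v ∈ nodes
  reaches_root : ∀ v ∈ nodes, ∃ k : ℕ, parent^[k] v = r

namespace RootedTree

variable {V : Type u} {r : V}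

/-- `T` is a routing tree in the graph `G` for the sources `U`: its arcs are edges of `G` and it
contains the sources (and the root `r`). Other nodes are optional. -/
def IsRoutingTree (T : RootedTree V r) (G : SimpleGraph V) (U : Finset V) : Prop :=
  U ⊆ T.nodes ∧ ∀ v ∈ T.nodes, v ≠ r → G.Adj v (T.parent v)

/-- The hop distance of a node `v` to the root in the tree. -/
noncomputable def depth (T : RootedTree V r) (v : V) : ℕ :=
  sInf {k : ℕ | T.parent^[k] v = r}

/-- `T` is a shortest path tree in `G` rooted at `r` that spans `U`. -/
def IsShortestPathTree (T : RootedTree V r) (G : SimpleGraph V) (U : Finset V) : Prop :=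
  T.IsRoutingTree G U ∧ ∀ v ∈ T.nodes, T.depth v = G.dist v r

open Classical in
/-- Total size of the reports of `v` and of its descendants in the tree. -/
noncomputable def load (T : RootedTree V r) (s : V → ℕ) (v : V) : ℕ :=
  ∑ u ∈ T.nodes with ∃ k : ℕ, T.parent^[k] u = v, s u

open Classical in
/-- Number of packets that `v` sends to its parent, if reports of total size at most `q` fit in
one packet and reports are aggregated hop by hop. The root sends nothing. -/
noncomputable def sent (T : RootedTree V r) (s : V → ℕ) (q : ℕ) (v : V) : ℕ :=
  if v = r then 0 else ⌈(T.load s v : ℝ) / (q : ℝ)⌉₊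

open Classical in
/-- Number of packets that `v` receives from its children. -/
noncomputable def received (T : RootedTree V r) (s : V → ℕ) (q : ℕ) (v : V) : ℕ :=
  ∑ c ∈ T.nodes with c ≠ r ∧ T.parent c = v, T.sent s q c

end RootedTree

/-- The energy cost of a tree: total transmission and reception energy of its nodes. -/
noncomputable def Network.cost {V : Type u} (N : Network V) (T : RootedTree V N.sink) : ℝ :=
  ∑ v ∈ T.nodes, (N.Tx * T.sent N.size N.ratio v + N.Rx * T.received N.size N.ratio v)

/-! ### Light approximate shortest-path trees -/

/-- The length of a walk with respect to edge lengths `w`. -/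
def walkLength {W : Type u} {H : SimpleGraph W} (w : Sym2 W → ℝ) {a b : W} (p : H.Walk a b) : ℝ :=
  (p.edges.map w).sum

open Classical in
/-- The total length of the edges of a graph. -/
noncomputable def totalWeight {W : Type u} [Fintype W] (w : Sym2 W → ℝ) (T : SimpleGraph W) : ℝ :=
  ∑ e ∈ T.edgeFinset, w e

/-- `T` is an `(α, β)`-LAST of the graph `H` with edge lengths `w` and root `r`: a spanning tree in
which the (unique) path from any node `v` to `r` is at most `α` times as long as a shortest walk
from `v` to `r` in `H`, and whose weight is at most `β` times the minimum weight of a spanning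
tree of `H`. -/
structure IsLAST {W : Type u} [Fintype W] (H : SimpleGraph W) (w : Sym2 W → ℝ) (r : W)
    (α β : ℝ) (T : SimpleGraph W) : Prop where
  le : T ≤ H
  isTree : T.IsTree
  dist_le : ∀ (v : W) (p : T.Walk v r) (p' : H.Walk v r), p.IsPath →
    walkLength w p ≤ α * walkLength w p'
  weight_le : ∀ M : SimpleGraph W, M ≤ H → M.IsTree → totalWeight w T ≤ β * totalWeight w M

/-! ### The algorithm -/

section Algorithm

variable {V : Type u} [DecidableEq V]

/-- The node set `U ∪ {r}` of the auxiliary complete graph. -/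
abbrev Terminal (U : Finset V) (r : V) : Type u := {v : V // v ∈ insert r U}

/-- Edge lengths of the auxiliary complete graph on `U ∪ {r}`: hop distances in `G`. -/
noncomputable def hopLength (G : SimpleGraph V) (U : Finset V) (r : V) :
    Sym2 (Terminal U r) → ℝ :=
  Sym2.lift ⟨fun x y => (G.dist x.1 y.1 : ℝ), fun x y => by simp only [SimpleGraph.dist_comm]⟩

/-- `P` selects one shortest path of `G` between any two nodes; the path selected between `x` and
`y` does not depend on the order of `x` and `y`. -/
def IsShortestPathChoice (G : SimpleGraph V) (P : ∀ x y : V, G.Walk x y) : Prop :=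
  (∀ x y, (P x y).length = G.dist x y) ∧ ∀ x y, P y x = (P x y).reverse

/-- The union of the selected shortest paths `P x y` over the edges `{x, y}` of `TL` (as a graph on
all of `V`; nodes on none of these paths are isolated). -/
def pathUnion {G : SimpleGraph V} {U : Finset V} {r : V} (P : ∀ x y : V, G.Walk x y)
    (TL : SimpleGraph (Terminal U r)) : SimpleGraph V :=
  SimpleGraph.fromEdgeSet {e | ∃ x y : Terminal U r, TL.Adj x y ∧ e ∈ (P x.1 y.1).edges}

/-- `T` is a possible output of the algorithm on `(G, U, r)`: take a `(3, 2)`-LAST of the complete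
graph on `U ∪ {r}` with hop distances as edge lengths, form the union of shortest paths of `G`
replacing its edges, and return a shortest path tree rooted at `r` and spanning `U` in it. -/
def IsOutput (G : SimpleGraph V) (U : Finset V) (r : V) (T : RootedTree V r) : Prop :=
  ∃ TL : SimpleGraph (Terminal U r),
    IsLAST ⊤ (hopLength G U r) ⟨r, Finset.mem_insert_self r U⟩ 3 2 TL ∧
    ∃ P : ∀ x y : V, G.Walk x y, IsShortestPathChoice G P ∧
      T.IsShortestPathTree (pathUnion P TL) U

end Algorithm

/-! ### A machine model with a step count

Programs act on a memory of natural numbers, organised in arrays with two indices. The only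
arithmetic is addition and truncated subtraction, so that in `t` steps the numbers get at most
`O(t)` binary digits longer, and running times agree with those of Turing machines up to a
polynomial. -/

/-- Memory: the array named `a` holds `m a i j` in its cell `(i, j)`. -/
abbrev Mem : Type := ℕ → ℕ → ℕ → ℕ

/-- Write the value `x` to cell `(i, j)` of array `a`. -/
def Mem.write (m : Mem) (a i j x : ℕ) : Mem :=
  fun a' i' j' => if a' = a ∧ i' = i ∧ j' = j then x else m a' i' j'

/-- Expressions: constants, memory reads with computed indices, addition, truncated subtraction. -/
inductive Expr : Type
  | lit (c : ℕ)
  | read (a : ℕ) (i j : Expr)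
  | add (e f : Expr)
  | sub (e f : Expr)

/-- The value of an expression. -/
def Expr.value : Expr → Mem → ℕ
  | .lit c, _ => c
  | .read a i j, m => m a (i.value m) (j.value m)
  | .add e f, m => e.value m + f.value m
  | .sub e f, m => e.value m - f.value m

/-- The number of operations needed to compute the value of an expression. -/
def Expr.time : Expr → ℕ
  | .lit _ => 1
  | .read _ i j => i.time + j.time + 1
  | .add e f => e.time + f.time + 1
  | .sub e f => e.time + f.time + 1

/-- Programs. `assign a i j e` writes `e` to cell `(i, j)` of array `a`; `cond b c d` runs `c` if
`b ≠ 0`, and `d` otherwise; `loop x e c` computes the value `n` of `e` and then runs `c` for `n`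
times, the number `0, …, n - 1` of the round being written to cell `(0, 0)` of array `x`. -/
inductive Program : Type
  | skip
  | assign (a : ℕ) (i j e : Expr)
  | seq (c d : Program)
  | cond (b : Expr) (c d : Program)
  | loop (x : ℕ) (e : Expr) (c : Program)

/-- `iter f k m` is the memory after the rounds `f 0, …, f (k - 1)`, started from `m`. -/
def iter (f : ℕ → Mem → Mem) : ℕ → Mem → Mem
  | 0, m => m
  | k + 1, m => f k (iter f k m)

/-- The memory after running a program. -/
def Program.exec : Program → Mem → Mem
  | .skip, m => m
  | .assign a i j e, m => m.write a (i.value m) (j.value m) (e.value m)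
  | .seq c d, m => d.exec (c.exec m)
  | .cond b c d, m => if b.value m ≠ 0 then c.exec m else d.exec m
  | .loop x e c, m => iter (fun k m' => c.exec (m'.write x 0 0 k)) (e.value m) m

/-- The number of steps of a run of a program. -/
def Program.time : Program → Mem → ℕ
  | .skip, _ => 1
  | .assign _ i j e, _ => i.time + j.time + e.time + 1
  | .seq c d, m => c.time m + d.time (c.exec m) + 1
  | .cond b c d, m => b.time + (if b.value m ≠ 0 then c.time m else d.time m) + 1
  | .loop x e c, m => e.time + 1 + ∑ k ∈ Finset.range (e.value m),
      (c.time ((iter (fun l m' => c.exec (m'.write x 0 0 l)) k m).write x 0 0 k) + 1)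

open Classical in
/-- The input `(G, U, r)` in memory, where `ν` numbers the nodes by `0, …, n - 1`: array 0 holds
the number `n`, array 1 the adjacency matrix of `G`, array 2 the indicator of `U`, array 3 the
number of `r`. All other cells are 0. -/
noncomputable def encodeInput {V : Type u} {n : ℕ} (ν : V ≃ Fin n) (G : SimpleGraph V)
    (U : Finset V) (r : V) : Mem := fun a i j =>
  if a = 0 ∧ i = 0 ∧ j = 0 then n
  else if a = 1 ∧ ∃ x y : V, G.Adj x y ∧ (ν x : ℕ) = i ∧ (ν y : ℕ) = j then 1
  else if a = 2 ∧ j = 0 ∧ ∃ x ∈ U, (ν x : ℕ) = i then 1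
  else if a = 3 ∧ i = 0 ∧ j = 0 then ν r
  else 0

/-- The memory holds the tree `T`: array 4 is the indicator of its nodes, and array 5 holds the
numbers of their parents. -/
def EncodesTree {V : Type u} {n : ℕ} (ν : V ≃ Fin n) {r : V} (m : Mem) (T : RootedTree V r) :
    Prop :=
  (∀ v, v ∈ T.nodes → m 4 (ν v) 0 = 1 ∧ m 5 (ν v) 0 = ν (T.parent v)) ∧
    ∀ v, v ∉ T.nodes → m 4 (ν v) 0 = 0

end Aggregation

/-!
For the approximation guarantee, let `S T` be the number of nodes of a routing tree `T` that send
packets, and `D T` the sum of report sizes times depths, divided by the aggregation ratio `q`.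
Summing the loads over all nodes counts every report as often as its depth says, and rounding up
adds less than one packet per sender. So the number of packets sent in `T` is at least `S T`, at
least `D T` and at most `S T + D T`, and the cost is proportional to it (`Network.cost_eq`). Let `T'` be any routing
tree and `T` an output of the algorithm. The sources in `T` are at most three times as deep as they
are far from the sink in `G`, so `D T ≤ 3 * D T'`. The senders of `T'` form with the sink a
connected subgraph with `S T'` edges; walking around it gives a spanning tree of the metric closure
on the terminals, of length at most `2 * S T'` (`exists_spanning_tree_le`). The LAST is at most
twice as long as this, and `T` has at most as many edges as the LAST is long. Hence
`S T ≤ 4 * S T'`, and together the ratio is `3 + 4 = 7` (`cost_le_of_isOutput`).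

For the implementation, a `(3, 2)`-LAST is computed as follows. Kruskal's algorithm gives a minimum
spanning tree `F` of the terminals (`IsExtendable.sup_edge`, `exec_kruskal`). In the order of their
distances to the root, each terminal that is more than three times as far from the root in the
current graph as it is in `G` is joined to the root by a shortcut. Two nodes with shortcuts then are at least as far
apart in `F` as their shortcuts are long together (`IsShortcutGraph.sup_edge`), so a tour around
`F`, which is at most twice as long as `F`, is at least twice as long as all shortcuts, and these
are together at most as long as `F` (`sum_le_totalWeight`). A shortest path tree of the graph with
the shortcuts is the LAST (`exists_isLAST`).

The programs need a single nontrivial subroutine, all-pairs shortest paths by the method of Floyd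
and Warshall (`exec_shortestPaths`). It also decides reachability, as missing edges get the length
`n * n`, and its predecessors give the shortest paths in `G`, the parents in the LAST and the output
tree. All loops run over the numbers of the nodes, so that a polynomial bound for the running time
can be read off from the program (`Program.time_le_timeBound`).
-/

namespace Aggregation

/-! ### Total weights of graphs and closed tours -/

section Tours

variable {α : Type u}

lemma totalWeight_eq_sum_indicator [Fintype α] (w : Sym2 α → ℝ) (H : SimpleGraph α) :
    totalWeight w H = ∑ e, H.edgeSet.indicator w e := by
  classical
  simp only [totalWeight, Set.indicator_apply, ← Finset.sum_filter]
  refine Finset.sum_congr ?_ fun _ _ => rfl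
  ext e
  rw [SimpleGraph.mem_edgeFinset, Finset.mem_filter]
  exact (and_iff_right (Finset.mem_univ e)).symm

lemma totalWeight_mono [Fintype α] {w : Sym2 α → ℝ} (hw : ∀ e, 0 ≤ w e) {H K : SimpleGraph α}
    (h : H ≤ K) : totalWeight w H ≤ totalWeight w K := by
  rw [totalWeight_eq_sum_indicator, totalWeight_eq_sum_indicator]
  exact Finset.sum_le_sum fun e _ =>
    Set.indicator_le_indicator_of_subset (SimpleGraph.edgeSet_mono h) hw e

lemma totalWeight_sup_edge_le [Fintype α] {w : Sym2 α → ℝ} (hw : ∀ e, 0 ≤ w e)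
    (H : SimpleGraph α) (a b : α) :
    totalWeight w (H ⊔ SimpleGraph.edge a b) ≤ totalWeight w H + w s(a, b) := by
  classical
  rw [totalWeight_eq_sum_indicator, totalWeight_eq_sum_indicator]
  have hsub : (H ⊔ SimpleGraph.edge a b).edgeSet ⊆ H.edgeSet ∪ {s(a, b)} := by
    intro e he
    rw [SimpleGraph.edgeSet_sup] at he
    refine he.imp id fun he => ?_
    induction e with
    | _ x y =>
      rw [SimpleGraph.mem_edgeSet, SimpleGraph.edge_adj] at he
      rcases he.1 with ⟨rfl, rfl⟩ | ⟨rfl, rfl⟩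
      · rfl
      · exact Sym2.eq_swap
  have hsingle : w s(a, b) = ∑ e, ({s(a, b)} : Set (Sym2 α)).indicator w e := by
    rw [Finset.sum_eq_single s(a, b)]
    · simp
    · intro e _ he
      exact Set.indicator_of_notMem (by simpa using he) w
    · simp
  rw [hsingle, ← Finset.sum_add_distrib]
  refine Finset.sum_le_sum fun e _ => ?_
  refine (Set.indicator_le_indicator_of_subset hsub hw e).trans ?_
  rw [← Set.indicator_union_add_inter_apply]
  exact le_add_of_nonneg_right (Set.indicator_nonneg (fun e _ => hw e) e)

/-- The length, with respect to `d`, of the tour that starts in `a` and visits the entries of a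
list in order. -/
def chainCost (d : α → α → ℝ) : α → List α → ℝ
  | _, [] => 0
  | a, b :: l => d a b + chainCost d b l

/-- Skipping stops does not make a tour longer. -/
lemma chainCost_sublist {d : α → α → ℝ} (h0 : ∀ a b, 0 ≤ d a b)
    (htri : ∀ a b c, d a c ≤ d a b + d b c) {l l' : List α} (h : l.Sublist l') (a : α) :
    chainCost d a l ≤ chainCost d a l' := by
  induction h generalizing a with
  | slnil => exact le_rfl
  | @cons l l' b _ ih =>
    refine (ih a).trans ?_
    cases l' with
    | nil => exact add_nonneg (h0 a b) le_rfl
    | cons c l' =>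
      simp only [chainCost]
      linarith [htri a b c]
  | cons_cons b _ ih =>
    simp only [chainCost]
    linarith [ih b]

/-- A detour from the stop `p` to `v` and back. -/
lemma exists_detour (d : α → α → ℝ) (p v : α) (t l : List α) (a : α) (hp : p = a ∨ p ∈ l) :
    ∃ l', (∀ x ∈ l, x ∈ l') ∧ v ∈ l' ∧
      chainCost d a (l' ++ t) = chainCost d a (l ++ t) + (d p v + d v p) := by
  induction l generalizing a with
  | nil =>
    obtain rfl : p = a := by simpa using hp
    refine ⟨[v, p], by simp, by simp, ?_⟩
    simp only [List.cons_append, List.nil_append, chainCost]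
    ring
  | cons b l ih =>
    by_cases hpa : p = a
    · subst hpa
      refine ⟨v :: p :: b :: l, fun x hx => ?_, by simp, ?_⟩
      · exact List.mem_cons_of_mem _ (List.mem_cons_of_mem _ hx)
      · simp only [List.cons_append, chainCost]
        ring
    · obtain ⟨l', h1, h2, h3⟩ := ih b (by simpa [hpa] using hp)
      refine ⟨b :: l', ?_, List.mem_cons_of_mem _ h2, ?_⟩
      · intro x hx
        rcases List.mem_cons.1 hx with rfl | hx
        · exact List.mem_cons_self
        · exact List.mem_cons_of_mem _ (h1 x hx)
      · simp only [List.cons_append, chainCost, h3]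
        ring

/-- Walking around a spanning tree: some closed tour from `r` visits every node that `Γ` connects
with `r` and is at most twice as long as all edges of `Γ` together. The tour is grown node by node;
the set `R` of visited nodes pays only for the edges inside `R`. -/
lemma exists_tour [Fintype α] (Γ : SimpleGraph α) {w : Sym2 α → ℝ} (hw : ∀ e, 0 ≤ w e)
    {d : α → α → ℝ} (hd : ∀ a b, Γ.Adj a b → d a b ≤ w s(a, b)) (r : α) (hr : d r r = 0) :
    ∃ l : List α, (∀ x, Γ.Reachable r x → x = r ∨ x ∈ l) ∧
      chainCost d r (l ++ [r]) ≤ 2 * totalWeight w Γ := by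
  classical
  let Q : Finset α → Prop := fun R => r ∈ R ∧ ∃ l : List α, (∀ x ∈ R, x = r ∨ x ∈ l) ∧
    chainCost d r (l ++ [r]) ≤ 2 * ∑ e ∈ Γ.edgeFinset with (∀ x ∈ e, x ∈ R), w e
  have hQ : Q {r} := by
    refine ⟨Finset.mem_singleton_self r, [], by simp, ?_⟩
    simp only [List.nil_append, chainCost, hr, add_zero]
    exact mul_nonneg zero_le_two (Finset.sum_nonneg fun e _ => hw e)
  obtain ⟨R, hR, hmax⟩ := Finset.exists_max_image (Finset.univ.filter Q) Finset.card
    ⟨{r}, by simpa using hQ⟩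
  obtain ⟨hrR, l, hl, hcost⟩ := (Finset.mem_filter.1 hR).2
  have hclosed : ∀ p ∈ R, ∀ v, Γ.Adj p v → v ∈ R := by
    intro p hp v hpv
    by_contra hv
    obtain ⟨l', h1, h2, h3⟩ := exists_detour d p v [r] l r (hl p hp)
    have hQ' : Q (insert v R) := by
      refine ⟨Finset.mem_insert_of_mem hrR, l', ?_, ?_⟩
      · intro x hx
        rcases Finset.mem_insert.1 hx with rfl | hx
        · exact Or.inr h2
        · exact (hl x hx).imp id (h1 x)
      · rw [h3]
        have hsum : ∑ e ∈ Γ.edgeFinset with (∀ x ∈ e, x ∈ R), w e + w s(p, v) ≤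
            ∑ e ∈ Γ.edgeFinset with (∀ x ∈ e, x ∈ insert v R), w e := by
          have hnot : s(p, v) ∉ Γ.edgeFinset.filter (fun e => ∀ x ∈ e, x ∈ R) := by
            simp only [Finset.mem_filter, Sym2.mem_iff, not_and]
            exact fun _ h => hv (h v (Or.inr rfl))
          rw [add_comm, ← Finset.sum_insert hnot]
          refine Finset.sum_le_sum_of_subset_of_nonneg ?_ fun e _ _ => hw e
          intro e he
          rcases Finset.mem_insert.1 he with rfl | he
          · simp only [Finset.mem_filter, SimpleGraph.mem_edgeFinset, SimpleGraph.mem_edgeSet,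
              Sym2.mem_iff]
            refine ⟨hpv, ?_⟩
            rintro x (rfl | rfl)
            · exact Finset.mem_insert_of_mem hp
            · exact Finset.mem_insert_self _ _
          · rw [Finset.mem_filter] at he ⊢
            exact ⟨he.1, fun x hx => Finset.mem_insert_of_mem (he.2 x hx)⟩
        have e1 := hd p v hpv
        have e2 := hd v p hpv.symm
        rw [Sym2.eq_swap] at e2
        linarith
    have := hmax _ (Finset.mem_filter.2 ⟨Finset.mem_univ _, hQ'⟩)
    rw [Finset.card_insert_of_notMem hv] at this
    omega
  refine ⟨l, ?_, ?_⟩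
  · rintro x ⟨p⟩
    refine hl x ?_
    by_contra hx
    obtain ⟨e, _, h1, h2⟩ := p.exists_boundary_dart (R : Set α) hrR hx
    exact h2 (hclosed _ h1 _ e.adj)
  · refine hcost.trans (mul_le_mul_of_nonneg_left ?_ zero_le_two)
    unfold totalWeight
    refine Finset.sum_le_sum_of_subset_of_nonneg ?_ fun e _ _ => hw e
    intro e he
    rw [SimpleGraph.mem_edgeFinset]
    exact SimpleGraph.mem_edgeFinset.1 (Finset.mem_filter.1 he).1

/-- The graph formed by the legs of a tour. -/
lemma exists_chain_graph [Fintype α] {w : Sym2 α → ℝ} (hw : ∀ e, 0 ≤ w e) (a : α) (l : List α) :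
    ∃ M : SimpleGraph α, (∀ x ∈ l, M.Reachable a x) ∧
      totalWeight w M ≤ chainCost (fun x y => w s(x, y)) a l := by
  induction l generalizing a with
  | nil => exact ⟨⊥, by simp, by simp [totalWeight_eq_sum_indicator, chainCost]⟩
  | cons b l ih =>
    obtain ⟨M, h1, h2⟩ := ih b
    have hab : (M ⊔ SimpleGraph.edge a b).Reachable a b := by
      by_cases hab : a = b
      · rw [hab]
      · exact SimpleGraph.Adj.reachable
          (Or.inr ((SimpleGraph.edge_adj ..).2 ⟨Or.inl ⟨rfl, rfl⟩, hab⟩))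
    refine ⟨M ⊔ SimpleGraph.edge a b, ?_, ?_⟩
    · intro x hx
      rcases List.mem_cons.1 hx with rfl | hx
      · exact hab
      · exact hab.trans ((h1 x hx).mono le_sup_left)
    · refine (totalWeight_sup_edge_le hw M a b).trans ?_
      simp only [chainCost]
      linarith

/-- The nodes of a list that belong to a subtype, as a list of the subtype. -/
lemma exists_sublist_subtype (s : α → Prop) (l : List α) :
    ∃ l' : List {x // s x}, (l'.map Subtype.val).Sublist l ∧
      ∀ x (hx : s x), x ∈ l → ⟨x, hx⟩ ∈ l' := by
  induction l with
  | nil => exact ⟨[], by simp, by simp⟩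
  | cons a l ih =>
    obtain ⟨l', h1, h2⟩ := ih
    by_cases ha : s a
    · refine ⟨⟨a, ha⟩ :: l', by simpa using h1, ?_⟩
      intro x hx hxl
      rcases List.mem_cons.1 hxl with rfl | hxl
      · exact List.mem_cons_self
      · exact List.mem_cons_of_mem _ (h2 x hx hxl)
    · refine ⟨l', h1.trans (List.sublist_cons_self _ _), ?_⟩
      intro x hx hxl
      rcases List.mem_cons.1 hxl with rfl | hxl
      · exact absurd hx ha
      · exact h2 x hx hxl

lemma chainCost_map {β : Type*} (f : β → α) (d : α → α → ℝ) (a : β) (l : List β) :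
    chainCost d (f a) (l.map f) = chainCost (fun x y => d (f x) (f y)) a l := by
  induction l generalizing a with
  | nil => rfl
  | cons b l ih => simp only [List.map_cons, chainCost, ih]

end Tours

section Terminals

variable {V : Type u} [DecidableEq V] {G : SimpleGraph V} {U : Finset V} {r : V}

lemma hopLength_mk (x y : Terminal U r) : hopLength G U r s(x, y) = (G.dist x.1 y.1 : ℝ) := rfl

lemma hopLength_nonneg (e : Sym2 (Terminal U r)) : 0 ≤ hopLength G U r e := by
  induction e with
  | _ x y => exact Nat.cast_nonneg _

/-- If a subgraph `Γ` of `G` connects all terminals, then some spanning tree of the metric closure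
on the terminals is at most twice as long as `Γ` has edges. -/
lemma exists_spanning_tree_le [Fintype V] (hG : G.Connected) {Γ : SimpleGraph V} (hΓ : Γ ≤ G)
    (hreach : ∀ u ∈ U, Γ.Reachable r u) :
    ∃ M : SimpleGraph (Terminal U r), M.IsTree ∧
      totalWeight (hopLength G U r) M ≤ 2 * totalWeight (fun _ => 1) Γ := by
  have h0 : ∀ a b : V, (0 : ℝ) ≤ (G.dist a b : ℝ) := fun a b => Nat.cast_nonneg _
  have htri : ∀ a b c : V, (G.dist a c : ℝ) ≤ (G.dist a b : ℝ) + (G.dist b c : ℝ) := by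
    intro a b c
    exact_mod_cast hG.dist_triangle
  obtain ⟨l, hl, hcost⟩ := exists_tour Γ (w := fun _ => 1) (fun _ => zero_le_one)
    (d := fun a b => (G.dist a b : ℝ))
    (fun a b hab => by simp [SimpleGraph.dist_eq_one_iff_adj.2 (hΓ hab)]) r (by simp)
  obtain ⟨l', hl', hmem⟩ := exists_sublist_subtype (fun v => v ∈ insert r U) l
  let ρ : Terminal U r := ⟨r, Finset.mem_insert_self r U⟩
  obtain ⟨M, hM, hMw⟩ := exists_chain_graph (hopLength_nonneg (G := G) (U := U) (r := r)) ρ l'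
  have hconn : M.Connected := by
    rw [SimpleGraph.connected_iff_exists_forall_reachable]
    refine ⟨ρ, fun x => ?_⟩
    have hx : x.1 = r ∨ x.1 ∈ l := by
      rcases Finset.mem_insert.1 x.2 with h | h
      · exact Or.inl h
      · exact hl _ (hreach _ h)
    rcases hx with h | h
    · have : x = ρ := Subtype.ext h
      rw [this]
    · exact hM x (hmem _ x.2 h)
  obtain ⟨T, hTM, hT⟩ := hconn.exists_isTree_le
  refine ⟨T, hT, (totalWeight_mono hopLength_nonneg hTM).trans (hMw.trans (le_trans ?_ hcost))⟩
  have : chainCost (fun x y => hopLength G U r s(x, y)) ρ l' =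
      chainCost (fun a b => (G.dist a b : ℝ)) r (l'.map Subtype.val) :=
    (chainCost_map Subtype.val (fun a b => (G.dist a b : ℝ)) ρ l').symm
  rw [this]
  exact chainCost_sublist h0 htri (hl'.trans (List.sublist_append_left _ _)) r

end Terminals

/-! ### Energy cost of rooted trees -/

lemma totalWeight_one_le_card {V : Type u} [Fintype V] {H : SimpleGraph V} {E : Finset (Sym2 V)}
    (h : H.edgeSet ⊆ E) : totalWeight (fun _ => 1) H ≤ E.card := by
  classical
  rw [totalWeight, Finset.sum_const, nsmul_eq_mul, mul_one, Nat.cast_le]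
  refine Finset.card_le_card fun e he => ?_
  rw [SimpleGraph.mem_edgeFinset] at he
  exact Finset.mem_coe.1 (h he)

namespace RootedTree

variable {V : Type u} {r : V} (T : RootedTree V r)

lemma iterate_parent_mem {v : V} (hv : v ∈ T.nodes) (k : ℕ) : T.parent^[k] v ∈ T.nodes := by
  induction k with
  | zero => exact hv
  | succ k ih =>
    rw [Function.iterate_succ_apply']
    exact T.parent_mem _ ih

lemma iterate_depth {v : V} (hv : v ∈ T.nodes) : T.parent^[T.depth v] v = r :=
  Nat.sInf_mem (s := {k : ℕ | T.parent^[k] v = r}) (T.reaches_root v hv)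

lemma depth_le {v : V} {k : ℕ} (h : T.parent^[k] v = r) : T.depth v ≤ k :=
  Nat.sInf_le h

lemma depth_root : T.depth r = 0 := Nat.le_zero.1 (T.depth_le (k := 0) rfl)

lemma depth_eq_zero {v : V} (hv : v ∈ T.nodes) (h : T.depth v = 0) : v = r := by
  have := T.iterate_depth hv
  rwa [h] at this

lemma depth_eq_succ {v : V} (hv : v ∈ T.nodes) (hr : v ≠ r) :
    T.depth v = T.depth (T.parent v) + 1 := by
  apply le_antisymm
  · apply T.depth_le
    rw [Function.iterate_succ_apply]
    exact T.iterate_depth (T.parent_mem v hv)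
  · obtain ⟨k, hk⟩ := Nat.exists_eq_succ_of_ne_zero fun h => hr (T.depth_eq_zero hv h)
    rw [hk]
    refine Nat.succ_le_succ (T.depth_le ?_)
    have := T.iterate_depth hv
    rwa [hk, Function.iterate_succ_apply] at this

lemma depth_iterate {v : V} (hv : v ∈ T.nodes) {k : ℕ} (hk : k ≤ T.depth v) :
    T.depth (T.parent^[k] v) = T.depth v - k := by
  induction k with
  | zero => rfl
  | succ k ih =>
    have h1 := ih (by omega)
    have hne : T.parent^[k] v ≠ r := by
      intro h
      rw [h, depth_root] at h1
      omega
    have h2 := T.depth_eq_succ (T.iterate_parent_mem hv k) hne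
    rw [Function.iterate_succ_apply']
    omega

lemma exists_walk {G : SimpleGraph V} (h : ∀ v ∈ T.nodes, v ≠ r → G.Adj v (T.parent v)) {v : V}
    (hv : v ∈ T.nodes) : ∃ p : G.Walk v r, p.length = T.depth v := by
  obtain ⟨k, hk⟩ : ∃ k, T.depth v = k := ⟨_, rfl⟩
  rw [hk]
  induction k generalizing v with
  | zero =>
    obtain rfl := T.depth_eq_zero hv hk
    exact ⟨.nil, rfl⟩
  | succ k ih =>
    have hr : v ≠ r := by
      rintro rfl
      rw [depth_root] at hk
      omega
    obtain ⟨p, hp⟩ := ih (T.parent_mem v hv) (by have := T.depth_eq_succ hv hr; omega)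
    exact ⟨.cons (h v hv hr) p, by simp [hp]⟩

open Classical in
/-- A node `u` contributes to the load of as many nodes other than the root as its depth says. -/
lemma card_ancestors {u : V} (hu : u ∈ T.nodes) :
    (T.nodes.filter fun v => v ≠ r ∧ ∃ k : ℕ, T.parent^[k] u = v).card = T.depth u := by
  have : T.nodes.filter (fun v => v ≠ r ∧ ∃ k : ℕ, T.parent^[k] u = v) =
      (Finset.range (T.depth u)).image fun k => T.parent^[k] u := by
    ext v
    simp only [Finset.mem_filter, Finset.mem_image, Finset.mem_range]
    constructor
    · rintro ⟨_, hr, k, rfl⟩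
      refine ⟨k, ?_, rfl⟩
      by_contra hk
      obtain ⟨j, rfl⟩ := Nat.exists_eq_add_of_le (not_lt.1 hk)
      apply hr
      rw [add_comm, Function.iterate_add_apply, T.iterate_depth hu]
      exact Function.iterate_fixed T.parent_root j
    · rintro ⟨k, hk, rfl⟩
      refine ⟨T.iterate_parent_mem hu k, fun h => ?_, k, rfl⟩
      have := T.depth_le h
      omega
  rw [this, Finset.card_image_of_injOn, Finset.card_range]
  intro i hi j hj hij
  have h1 := T.depth_iterate hu (Finset.mem_range.1 hi).le
  have h2 := T.depth_iterate hu (Finset.mem_range.1 hj).le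
  have h3 := Finset.mem_range.1 hi
  have h4 := Finset.mem_range.1 hj
  simp only at hij
  rw [hij] at h1
  omega

/-- Every report is counted once at each node on its way to the root. -/
lemma sum_load (s : V → ℕ) [DecidableEq V] :
    ∑ v ∈ T.nodes with v ≠ r, T.load s v = ∑ u ∈ T.nodes, s u * T.depth u := by
  classical
  unfold load
  simp only [Finset.sum_filter (s := T.nodes) (p := fun u => ∃ k : ℕ, T.parent^[k] u = _)]
  rw [Finset.sum_comm]
  refine Finset.sum_congr rfl fun u hu => ?_
  rw [← Finset.sum_filter, Finset.sum_const, Finset.filter_filter, smul_eq_mul, mul_comm,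
    ← T.card_ancestors hu]
  congr

lemma le_load {s : V → ℕ} {u v : V} (hu : u ∈ T.nodes) (k : ℕ) (h : T.parent^[k] u = v) :
    s u ≤ T.load s v := by
  classical
  exact Finset.single_le_sum (f := s) (fun _ _ => Nat.zero_le _)
    (Finset.mem_filter.2 ⟨hu, k, h⟩)

lemma load_le_load_parent (s : V → ℕ) (v : V) : T.load s v ≤ T.load s (T.parent v) := by
  classical
  refine Finset.sum_le_sum_of_subset ?_
  intro u hu
  rw [Finset.mem_filter] at hu ⊢
  obtain ⟨hu, k, rfl⟩ := hu
  exact ⟨hu, k + 1, Function.iterate_succ_apply' _ _ _⟩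

/-- The nodes that send at least one packet: a routing tree may have nodes without sources below. -/
noncomputable def senders [DecidableEq V] (s : V → ℕ) : Finset V :=
  T.nodes.filter fun v => v ≠ r ∧ T.load s v ≠ 0

variable [DecidableEq V]

lemma sum_sent (s : V → ℕ) (q : ℕ) :
    ∑ v ∈ T.nodes, T.sent s q v = ∑ v ∈ T.senders s, ⌈(T.load s v : ℝ) / (q : ℝ)⌉₊ := by
  have : T.senders s ⊆ T.nodes := Finset.filter_subset _ _
  rw [← Finset.sum_subset this]
  · refine Finset.sum_congr rfl fun v hv => ?_
    rw [sent, if_neg (Finset.mem_filter.1 hv).2.1]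
  · intro v hv hns
    unfold sent
    split_ifs with hr
    · rfl
    · have : T.load s v = 0 := by
        by_contra h
        exact hns (Finset.mem_filter.2 ⟨hv, hr, h⟩)
      simp [this]

lemma sum_received (s : V → ℕ) (q : ℕ) :
    ∑ v ∈ T.nodes, T.received s q v = ∑ v ∈ T.nodes, T.sent s q v := by
  classical
  unfold received
  have h1 : ∀ v, (T.nodes.filter fun c => c ≠ r ∧ T.parent c = v) =
      (T.nodes.filter fun c => c ≠ r).filter fun c => T.parent c = v := fun v => by
    rw [Finset.filter_filter]
  have h2 := Finset.sum_fiberwise_of_maps_to (s := T.nodes.filter fun c => c ≠ r) (t := T.nodes)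
    (g := T.parent) (fun c hc => T.parent_mem c (Finset.mem_filter.1 hc).1) (T.sent s q)
  have h3 : ∑ c ∈ T.nodes with c ≠ r, T.sent s q c = ∑ v ∈ T.nodes, T.sent s q v := by
    refine Finset.sum_subset (Finset.filter_subset _ _) ?_
    intro v hv hns
    have : v = r := by
      by_contra h
      exact hns (Finset.mem_filter.2 ⟨hv, h⟩)
    rw [sent, if_pos this]
  rw [← h3, ← h2]
  refine Finset.sum_congr rfl fun v _ => ?_
  refine Finset.sum_congr ?_ fun _ _ => rfl
  ext c
  simp [and_assoc]

lemma sum_load_senders (s : V → ℕ) :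
    ∑ v ∈ T.senders s, T.load s v = ∑ u ∈ T.nodes, s u * T.depth u := by
  rw [← T.sum_load s]
  refine Finset.sum_subset ?_ ?_
  · intro v hv
    have := Finset.mem_filter.1 hv
    exact Finset.mem_filter.2 ⟨this.1, this.2.1⟩
  · intro v hv hns
    by_contra h
    have := Finset.mem_filter.1 hv
    exact hns (Finset.mem_filter.2 ⟨this.1, this.2, h⟩)

lemma card_senders_le_sum_sent (s : V → ℕ) {q : ℕ} (hq : 0 < q) :
    (T.senders s).card ≤ ∑ v ∈ T.nodes, T.sent s q v := by
  rw [T.sum_sent, Finset.card_eq_sum_ones]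
  refine Finset.sum_le_sum fun v hv => ?_
  have h : 0 < T.load s v := Nat.pos_of_ne_zero (Finset.mem_filter.1 hv).2.2
  exact Nat.one_le_iff_ne_zero.2 (Nat.ceil_pos.2 (by positivity)).ne'

/-- Packets hold at most `q`, so the reports need at least this many transmissions. -/
lemma sum_size_depth_le_sum_sent (s : V → ℕ) (q : ℕ) :
    (∑ u ∈ T.nodes, (s u * T.depth u : ℕ) : ℝ) / q ≤ ∑ v ∈ T.nodes, (T.sent s q v : ℝ) := by
  rw [← Nat.cast_sum, ← Nat.cast_sum, T.sum_sent, ← T.sum_load_senders, Nat.cast_sum, Nat.cast_sum,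
    Finset.sum_div]
  exact Finset.sum_le_sum fun v _ => Nat.le_ceil _

/-- Rounding up costs less than one packet per sender. -/
lemma sum_sent_le (s : V → ℕ) (q : ℕ) :
    ∑ v ∈ T.nodes, (T.sent s q v : ℝ) ≤
      (∑ u ∈ T.nodes, (s u * T.depth u : ℕ) : ℝ) / q + (T.senders s).card := by
  rw [← Nat.cast_sum, ← Nat.cast_sum, T.sum_sent, ← T.sum_load_senders, Nat.cast_sum, Nat.cast_sum,
    Finset.sum_div, Finset.card_eq_sum_ones, Nat.cast_sum, ← Finset.sum_add_distrib]
  refine Finset.sum_le_sum fun v _ => ?_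
  rw [Nat.cast_one]
  exact (Nat.ceil_lt_add_one (by positivity)).le

/-- The arcs of a routing tree are different edges of the graph. -/
lemma card_senders_le [Fintype V] (s : V → ℕ) {G : SimpleGraph V}
    (h : ∀ v ∈ T.nodes, v ≠ r → G.Adj v (T.parent v)) :
    ((T.senders s).card : ℝ) ≤ totalWeight (fun _ => 1) G := by
  classical
  have : ((T.senders s).card : ℝ) ≤ G.edgeFinset.card := by
    refine Nat.cast_le.2 (Finset.card_le_card_of_injOn (fun v => s(v, T.parent v)) ?_ ?_)
    · intro v hv
      have := Finset.mem_filter.1 hv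
      exact SimpleGraph.mem_edgeFinset.2 (h v this.1 this.2.1)
    · intro v hv w hw hvw
      have hv := Finset.mem_filter.1 hv
      have hw := Finset.mem_filter.1 hw
      rcases Sym2.eq_iff.1 hvw with ⟨h1, _⟩ | ⟨h1, h2⟩
      · exact h1
      · -- two opposite arcs would contradict that the depth decreases along arcs
        have e1 := T.depth_eq_succ hv.1 hv.2.1
        have e2 := T.depth_eq_succ hw.1 hw.2.1
        rw [← h1] at e2
        rw [h2] at e1
        omega
  refine this.trans (le_of_eq ?_)
  rw [totalWeight, Finset.sum_const, nsmul_eq_mul, mul_one]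

/-- The arcs leaving the senders connect all sources with the root. -/
lemma exists_sender_graph [Fintype V] {s : V → ℕ} {G : SimpleGraph V} {U : Finset V}
    (hT : T.IsRoutingTree G U) (hs : ∀ u ∈ U, 0 < s u) :
    ∃ Γ ≤ G, (∀ u ∈ U, Γ.Reachable r u) ∧
      totalWeight (fun _ => 1) Γ ≤ (T.senders s).card := by
  classical
  let E : Finset (Sym2 V) := (T.senders s).image fun v => s(v, T.parent v)
  have hadj : ∀ v ∈ T.senders s, G.Adj v (T.parent v) := fun v hv =>
    hT.2 v (Finset.mem_filter.1 hv).1 (Finset.mem_filter.1 hv).2.1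
  refine ⟨SimpleGraph.fromEdgeSet E, ?_, ?_, ?_⟩
  · intro a b hab
    obtain ⟨v, hv, h⟩ := Finset.mem_image.1 (Finset.mem_coe.1 hab.1)
    rw [← SimpleGraph.mem_edgeSet, ← h]
    exact hadj v hv
  · have key : ∀ k v, v ∈ T.nodes → T.load s v ≠ 0 → T.depth v = k →
        (SimpleGraph.fromEdgeSet (E : Set (Sym2 V))).Reachable v r := by
      intro k
      induction k with
      | zero =>
        intro v hv _ hk
        rw [T.depth_eq_zero hv hk]
      | succ k ih =>
        intro v hv hl hk
        have hr : v ≠ r := by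
          rintro rfl
          rw [depth_root] at hk
          omega
        have hmem : v ∈ T.senders s := Finset.mem_filter.2 ⟨hv, hr, hl⟩
        have h1 : (SimpleGraph.fromEdgeSet (E : Set (Sym2 V))).Adj v (T.parent v) :=
          (SimpleGraph.fromEdgeSet_adj _).2
            ⟨Finset.mem_coe.2 (Finset.mem_image.2 ⟨v, hmem, rfl⟩), (hadj v hmem).ne⟩
        refine h1.reachable.trans (ih _ (T.parent_mem v hv) ?_ ?_)
        · have := T.load_le_load_parent s v
          omega
        · have := T.depth_eq_succ hv hr
          omega
    intro u hu
    refine (key _ u (hT.1 hu) ?_ rfl).symm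
    exact ((hs u hu).trans_le (T.le_load (hT.1 hu) 0 rfl)).ne'
  · refine (totalWeight_one_le_card (E := E) ?_).trans (Nat.cast_le.2 Finset.card_image_le)
    rw [SimpleGraph.edgeSet_fromEdgeSet]
    exact Set.sdiff_subset

end RootedTree

/-- Every packet is sent once and received once. -/
lemma Network.cost_eq {V : Type u} (N : Network V) (T : RootedTree V N.sink) :
    N.cost T = (N.Tx + N.Rx) * ∑ v ∈ T.nodes, (T.sent N.size N.ratio v : ℝ) := by
  classical
  have h := T.sum_received N.size N.ratio
  rw [cost, Finset.sum_add_distrib, ← Finset.mul_sum, ← Finset.mul_sum, ← Nat.cast_sum,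
    ← Nat.cast_sum, h, add_mul]

/-! ### The approximation guarantee -/

section Output

variable {V : Type u} [DecidableEq V] {G : SimpleGraph V} {U : Finset V} {r : V}

lemma pathUnion_le (P : ∀ x y : V, G.Walk x y) (TL : SimpleGraph (Terminal U r)) :
    pathUnion P TL ≤ G := by
  intro a b hab
  obtain ⟨⟨x, y, _, he⟩, _⟩ := hab
  exact (P x.1 y.1).adj_of_mem_edges he

lemma pathUnion_walk {P : ∀ x y : V, G.Walk x y} (hP : IsShortestPathChoice G P)
    {TL : SimpleGraph (Terminal U r)} {x y : Terminal U r} (p : TL.Walk x y) :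
    ∃ p' : (pathUnion P TL).Walk x.1 y.1, (p'.length : ℝ) = walkLength (hopLength G U r) p := by
  induction p with
  | nil => exact ⟨.nil, by simp [walkLength]⟩
  | @cons a b c hab p ih =>
    obtain ⟨p', hp'⟩ := ih
    have hmem : ∀ e ∈ (P a.1 b.1).edges, e ∈ (pathUnion P TL).edgeSet := by
      intro e he
      rw [pathUnion, SimpleGraph.edgeSet_fromEdgeSet]
      exact ⟨⟨a, b, hab, he⟩, G.not_isDiag_of_mem_edgeSet ((P a.1 b.1).edges_subset_edgeSet he)⟩
    refine ⟨((P a.1 b.1).transfer _ hmem).append p', ?_⟩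
    rw [SimpleGraph.Walk.length_append, SimpleGraph.Walk.length_transfer, hP.1, Nat.cast_add, hp']
    simp [walkLength, hopLength_mk]

/-- The paths replacing the edges have the lengths of the edges. -/
lemma totalWeight_pathUnion_le [Fintype V] {P : ∀ x y : V, G.Walk x y}
    (hP : IsShortestPathChoice G P) (TL : SimpleGraph (Terminal U r)) :
    totalWeight (fun _ => 1) (pathUnion P TL) ≤ totalWeight (hopLength G U r) TL := by
  classical
  let f : Sym2 (Terminal U r) → Finset (Sym2 V) := fun e =>
    (P (Quot.out e).1.1 (Quot.out e).2.1).edges.toFinset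
  have hf : ∀ e, ((f e).card : ℝ) ≤ hopLength G U r e := by
    intro e
    have h1 : (f e).card ≤ G.dist (Quot.out e).1.1 (Quot.out e).2.1 := by
      rw [← hP.1, ← SimpleGraph.Walk.length_edges]
      exact List.toFinset_card_le _
    calc ((f e).card : ℝ) ≤ (G.dist (Quot.out e).1.1 (Quot.out e).2.1 : ℝ) := by exact_mod_cast h1
      _ = hopLength G U r s((Quot.out e).1, (Quot.out e).2) := rfl
      _ = hopLength G U r e := by
        congr 1
        exact Quot.out_eq e
  have hsub : (pathUnion P TL).edgeSet ⊆ (TL.edgeFinset.biUnion f : Finset (Sym2 V)) := by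
    intro e he
    rw [pathUnion, SimpleGraph.edgeSet_fromEdgeSet] at he
    obtain ⟨⟨x, y, hxy, he⟩, _⟩ := he
    refine Finset.mem_coe.2 <| Finset.mem_biUnion.2 ⟨s(x, y), SimpleGraph.mem_edgeFinset.2 hxy, ?_⟩
    have hout : s((Quot.out s(x, y)).1, (Quot.out s(x, y)).2) = s(x, y) := Quot.out_eq _
    rw [List.mem_toFinset]
    rcases Sym2.eq_iff.1 hout with ⟨h1, h2⟩ | ⟨h1, h2⟩
    · rw [h1, h2]
      exact he
    · rw [h1, h2, hP.2, SimpleGraph.Walk.edges_reverse, List.mem_reverse]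
      exact he
  refine (totalWeight_one_le_card hsub).trans ((Nat.cast_le.2 Finset.card_biUnion_le).trans ?_)
  rw [Nat.cast_sum, totalWeight]
  refine (Finset.sum_le_sum fun e _ => hf e).trans (le_of_eq ?_)
  refine Finset.sum_congr ?_ fun _ _ => rfl
  ext e
  rw [SimpleGraph.mem_edgeFinset]

/-- Every output of the algorithm is a routing tree in which sources are at most three times as
deep as they are far from the sink, and which has at most twice as many senders as a minimum
spanning tree of the metric closure is long. -/
lemma IsOutput.bounds [Fintype V] {T : RootedTree V r} (hT : IsOutput G U r T) :
    T.IsRoutingTree G U ∧ (∀ u ∈ U, T.depth u ≤ 3 * G.dist u r) ∧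
      ∀ (s : V → ℕ) (M : SimpleGraph (Terminal U r)), M.IsTree →
        ((T.senders s).card : ℝ) ≤ 2 * totalWeight (hopLength G U r) M := by
  obtain ⟨TL, hTL, P, hP, hSPT⟩ := hT
  refine ⟨⟨hSPT.1.1, fun v hv hr => pathUnion_le P TL (hSPT.1.2 v hv hr)⟩, ?_, ?_⟩
  · intro u hu
    by_cases hur : u = r
    · rw [hur, T.depth_root]
      exact Nat.zero_le _
    let x : Terminal U r := ⟨u, Finset.mem_insert_of_mem hu⟩
    let ρ : Terminal U r := ⟨r, Finset.mem_insert_self r U⟩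
    obtain ⟨p, hp⟩ := (hTL.isTree.connected x ρ).exists_isPath
    have hne : x ≠ ρ := fun h => hur (congrArg Subtype.val h)
    have h1 := hTL.dist_le x p (SimpleGraph.Adj.toWalk (G := ⊤) hne) hp
    obtain ⟨p', hp'⟩ := pathUnion_walk hP p
    have h2 := SimpleGraph.dist_le p'
    rw [← hSPT.2 u (hSPT.1.1 hu)] at h2
    have h3 : walkLength (hopLength G U r) (SimpleGraph.Adj.toWalk (G := ⊤) hne) = G.dist u r := by
      simp [walkLength, hopLength_mk, x, ρ]
    rw [h3, ← hp'] at h1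
    have h4 : p'.length ≤ 3 * G.dist u r := by exact_mod_cast h1
    exact h2.trans h4
  · intro s M hM
    exact (T.card_senders_le s hSPT.1.2).trans
      ((totalWeight_pathUnion_le hP TL).trans (hTL.weight_le M le_top hM))

end Output

/-- Both the total size of the reports weighted by distances and the length of a minimum spanning
tree are lower bounds for the cost of a routing tree; they contribute `3` and `4` to the ratio. -/
theorem cost_le_of_isOutput {V : Type u} [Fintype V] [DecidableEq V] (N : Network V)
    {T : RootedTree V N.sink} (hT : IsOutput N.graph N.sources N.sink T)
    {T' : RootedTree V N.sink} (hT' : T'.IsRoutingTree N.graph N.sources) :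
    N.cost T ≤ 7 * N.cost T' := by
  obtain ⟨hroute, hdepth, hsend⟩ := hT.bounds
  obtain ⟨Γ, hΓ, hreach, hw⟩ := T'.exists_sender_graph hT' N.size_pos
  obtain ⟨M, hM, hMw⟩ := exists_spanning_tree_le N.connected hΓ hreach
  have h1 := hsend N.size M hM
  have h2 : ((T'.senders N.size).card : ℝ) ≤
      ∑ v ∈ T'.nodes, (T'.sent N.size N.ratio v : ℝ) := by
    rw [← Nat.cast_sum]
    exact_mod_cast T'.card_senders_le_sum_sent N.size N.ratio_pos
  have h3 := T'.sum_size_depth_le_sum_sent N.size N.ratio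
  have h4 := T.sum_sent_le N.size N.ratio
  have h5 : ∑ u ∈ T.nodes, N.size u * T.depth u ≤
      3 * ∑ u ∈ T'.nodes, N.size u * T'.depth u := by
    have e : ∀ T'' : RootedTree V N.sink, N.sources ⊆ T''.nodes →
        ∑ u ∈ T''.nodes, N.size u * T''.depth u = ∑ u ∈ N.sources, N.size u * T''.depth u := by
      intro T'' h
      refine (Finset.sum_subset h fun u _ hu => ?_).symm
      rw [N.size_eq_zero u hu, zero_mul]
    rw [e T hroute.1, e T' hT'.1, Finset.mul_sum]
    refine Finset.sum_le_sum fun u hu => ?_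
    obtain ⟨p, hp⟩ := T'.exists_walk hT'.2 (hT'.1 hu)
    have := SimpleGraph.dist_le p
    have := hdepth u hu
    calc N.size u * T.depth u ≤ N.size u * (3 * T'.depth u) :=
          Nat.mul_le_mul_left _ (by omega)
      _ = 3 * (N.size u * T'.depth u) := by ring
  have h6 : (∑ u ∈ T.nodes, (N.size u * T.depth u : ℕ) : ℝ) / N.ratio ≤
      3 * ((∑ u ∈ T'.nodes, (N.size u * T'.depth u : ℕ) : ℝ) / N.ratio) := by
    rw [← mul_div_assoc]
    refine div_le_div_of_nonneg_right ?_ (Nat.cast_nonneg _)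
    exact_mod_cast h5
  rw [N.cost_eq, N.cost_eq, mul_left_comm]
  refine mul_le_mul_of_nonneg_left ?_ (add_pos N.Tx_pos N.Rx_pos).le
  linarith

/-! ### Reasoning about programs -/

lemma Mem.write_of_ne (m : Mem) {a b : ℕ} (i j x : ℕ) (h : b ≠ a) : m.write a i j x b = m b := by
  funext i' j'
  simp [Mem.write, h]

lemma Mem.write_self (m : Mem) (a i j x : ℕ) : m.write a i j x a i j = x := by
  simp [Mem.write]

lemma Mem.write_apply (m : Mem) (a i j x i' j' : ℕ) :
    m.write a i j x a i' j' = if i' = i ∧ j' = j then x else m a i' j' := by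
  simp [Mem.write]

/-- The number of nodes, which the input holds in array 0. -/
def numNodes : Expr := .read 0 (.lit 0) (.lit 0)

/-- The value of a scalar variable, kept in cell `(0, 0)` of an array. -/
def var (a : ℕ) : Expr := .read a (.lit 0) (.lit 0)

/-- An expression that is zero if and only if `e` and `f` have the same value. -/
def neq (e f : Expr) : Expr := .add (.sub e f) (.sub f e)

@[simp] lemma value_numNodes (m : Mem) : numNodes.value m = m 0 0 0 := rfl

@[simp] lemma value_var (a : ℕ) (m : Mem) : (var a).value m = m a 0 0 := rfl

lemma value_neq_eq_zero {e f : Expr} {m : Mem} : (neq e f).value m = 0 ↔ e.value m = f.value m := by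
  simp only [neq, Expr.value]
  omega

namespace Program

/-- The arrays that a program may write to. -/
def mods : Program → List ℕ
  | .skip => []
  | .assign a _ _ _ => [a]
  | .seq c d => c.mods ++ d.mods
  | .cond _ c d => c.mods ++ d.mods
  | .loop x _ c => x :: c.mods

lemma exec_of_notMem_mods {c : Program} {a : ℕ} (h : a ∉ c.mods) (m : Mem) : c.exec m a = m a := by
  induction c generalizing m with
  | skip => rfl
  | assign b i j e => exact Mem.write_of_ne _ _ _ _ (by simpa [mods] using h)
  | seq c d ihc ihd =>
    simp only [mods, List.mem_append, not_or] at h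
    rw [exec, ihd h.2, ihc h.1]
  | cond b c d ihc ihd =>
    simp only [mods, List.mem_append, not_or] at h
    rw [exec]
    split_ifs
    · exact ihc h.1 m
    · exact ihd h.2 m
  | loop x e c ih =>
    simp only [mods, List.mem_cons, not_or] at h
    rw [exec]
    generalize e.value m = k
    induction k with
    | zero => rfl
    | succ k ihk => rw [iter, ih h.2, Mem.write_of_ne _ _ _ _ h.1, ihk]

/-- Loop invariants; arrays that the loop does not write to keep their contents. -/
lemma exec_loop_induct {x : ℕ} {e : Expr} {c : Program} {m : Mem} (Q : ℕ → Mem → Prop)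
    (h0 : Q 0 m)
    (step : ∀ k < e.value m, ∀ m' : Mem, (∀ a ∉ (loop x e c).mods, m' a = m a) → Q k m' →
      Q (k + 1) (c.exec (m'.write x 0 0 k))) :
    Q (e.value m) ((loop x e c).exec m) := by
  rw [exec]
  set f : ℕ → Mem → Mem := fun k m' => c.exec (m'.write x 0 0 k)
  have hframe : ∀ k, ∀ a ∉ (loop x e c).mods, iter f k m a = m a := by
    intro k a ha
    simp only [mods, List.mem_cons, not_or] at ha
    induction k with
    | zero => rfl
    | succ k ih =>
      simp only [iter, f]
      rw [exec_of_notMem_mods ha.2, Mem.write_of_ne _ _ _ _ ha.1]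
      exact ih
  have : ∀ k ≤ e.value m, Q k (iter f k m) := by
    intro k hk
    induction k with
    | zero => exact h0
    | succ k ih => exact step k hk _ (hframe k) (ih (by omega))
  exact this _ le_rfl

/-- A loop that visits the numbers of all nodes. -/
abbrev forNodes (x : ℕ) (c : Program) : Program := .loop x numNodes c

lemma exec_forNodes_induct {x : ℕ} {c : Program} {m : Mem} {n : ℕ} (hn : m 0 0 0 = n)
    (Q : ℕ → Mem → Prop) (h0 : Q 0 m)
    (step : ∀ k < n, ∀ m' : Mem, (∀ a ∉ (forNodes x c).mods, m' a = m a) → Q k m' →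
      Q (k + 1) (c.exec (m'.write x 0 0 k))) :
    Q n ((forNodes x c).exec m) := by
  subst hn
  exact exec_loop_induct (e := numNodes) Q h0 step

/-- Filling the array `a` with two nested loops, one cell in each round. When the round for the
cell `(x, z)` starts, the cells before it have their final values, which satisfy `R`, and the other
cells still have their initial values. -/
lemma exec_fill {i j a : ℕ} {c : Program} {m : Mem} {n : ℕ} (hn : m 0 0 0 = n)
    (h0 : 0 ∉ (forNodes i (forNodes j c)).mods) (hij : i ≠ j) (hia : a ≠ i) (hja : a ≠ j)
    (hi : i ∉ c.mods) (R : ℕ → ℕ → ℕ → Prop)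
    (hc : ∀ x < n, ∀ z < n, ∀ m' : Mem, (∀ b ∉ (forNodes i (forNodes j c)).mods, m' b = m b) →
      m' i 0 0 = x → m' j 0 0 = z →
      (∀ x' < n, ∀ z' < n, ((x' < x ∨ x' = x ∧ z' < z) → R x' z' (m' a x' z')) ∧
        (¬(x' < x ∨ x' = x ∧ z' < z) → m' a x' z' = m a x' z')) →
      R x z (c.exec m' a x z) ∧ ∀ x' z', ¬(x' = x ∧ z' = z) → c.exec m' a x' z' = m' a x' z') :
    ∀ x < n, ∀ z < n, R x z ((forNodes i (forNodes j c)).exec m a x z) := by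
  have key := exec_forNodes_induct (x := i) (c := forNodes j c) hn
    (fun k m' => ∀ x' < n, ∀ z' < n, (x' < k → R x' z' (m' a x' z')) ∧
      (¬x' < k → m' a x' z' = m a x' z')) (by simp) ?_
  · intro x hx z hz
    exact (key x hx z hz).1 hx
  intro x hx m' hframe hm'
  have hn' : m'.write i 0 0 x 0 0 0 = n := by
    rw [Mem.write_of_ne, hframe 0 h0, hn]
    rintro rfl
    exact h0 (List.mem_cons_self)
  have key2 := exec_forNodes_induct (x := j) (c := c) hn'
    (fun k m'' => ∀ x' < n, ∀ z' < n,
      ((x' < x ∨ x' = x ∧ z' < k) → R x' z' (m'' a x' z')) ∧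
      (¬(x' < x ∨ x' = x ∧ z' < k) → m'' a x' z' = m a x' z')) ?_ ?_
  · intro x' hx' z' hz'
    refine ⟨fun h => (key2 x' hx' z' hz').1 ?_, fun h => (key2 x' hx' z' hz').2 ?_⟩ <;> omega
  · intro x' hx' z' hz'
    rw [Mem.write_of_ne _ _ _ _ hia]
    refine ⟨fun h => (hm' x' hx' z' hz').1 ?_, fun h => (hm' x' hx' z' hz').2 ?_⟩ <;> omega
  · intro z hz m'' hframe2 hm''
    have f1 : ∀ b ∉ (forNodes i (forNodes j c)).mods, m''.write j 0 0 z b = m b := by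
      intro b hb
      have hb' := hb
      simp only [mods, List.mem_cons, not_or] at hb'
      rw [Mem.write_of_ne _ _ _ _ hb'.2.1, hframe2 b, Mem.write_of_ne _ _ _ _ hb'.1, hframe b hb]
      simp only [mods, List.mem_cons, not_or]
      exact hb'.2
    have f2 : m''.write j 0 0 z i 0 0 = x := by
      rw [Mem.write_of_ne _ _ _ _ hij, hframe2 i, Mem.write_self]
      simp only [mods, List.mem_cons, not_or]
      exact ⟨hij, hi⟩
    obtain ⟨h1, h2⟩ := hc x hx z hz (m''.write j 0 0 z) f1 f2 (Mem.write_self ..) (by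
      intro x' hx' z' hz'
      rw [Mem.write_of_ne _ _ _ _ hja]
      exact hm'' x' hx' z' hz')
    intro x' hx' z' hz'
    by_cases h : x' = x ∧ z' = z
    · obtain ⟨rfl, rfl⟩ := h
      exact ⟨fun _ => h1, fun h => absurd (Or.inr ⟨rfl, Nat.lt_succ_self _⟩) h⟩
    · rw [h2 x' z' h, Mem.write_of_ne _ _ _ _ hja]
      refine ⟨fun h' => (hm'' x' hx' z' hz').1 ?_, fun h' => (hm'' x' hx' z' hz').2 ?_⟩ <;> omega

/-! ### Running times -/

/-- All loops of the program visit the nodes. -/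
def LoopsOverNodes : Program → Prop
  | .skip => True
  | .assign _ _ _ _ => True
  | .seq c d => c.LoopsOverNodes ∧ d.LoopsOverNodes
  | .cond _ c d => c.LoopsOverNodes ∧ d.LoopsOverNodes
  | .loop _ e c => e = numNodes ∧ c.LoopsOverNodes

/-- A bound for the running time in terms of the number of nodes. It is meant for programs whose
loops visit the nodes: the expression that bounds a loop is taken to be that number. -/
noncomputable def timeBound : Program → Polynomial ℕ
  | .skip => 1
  | .assign _ i j e => Polynomial.C (i.time + j.time + e.time + 1)
  | .seq c d => c.timeBound + d.timeBound + 1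
  | .cond b c d => Polynomial.C b.time + (c.timeBound + d.timeBound) + 1
  | .loop _ e c => Polynomial.C e.time + 1 + Polynomial.X * (c.timeBound + 1)

/-- Programs that only loop over the nodes, and do not overwrite their number, run in polynomial
time. -/
lemma time_le_timeBound {c : Program} (hc : c.LoopsOverNodes) (h0 : 0 ∉ c.mods) (m : Mem) :
    c.time m ≤ c.timeBound.eval (m 0 0 0) := by
  induction c generalizing m with
  | skip => simp [time, timeBound]
  | assign a i j e => simp [time, timeBound]
  | seq c d ihc ihd =>
    simp only [mods, List.mem_append, not_or] at h0
    have h1 := ihc hc.1 h0.1 m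
    have h2 := ihd hc.2 h0.2 (c.exec m)
    rw [exec_of_notMem_mods h0.1] at h2
    simp only [time, timeBound, Polynomial.eval_add, Polynomial.eval_one]
    omega
  | cond b c d ihc ihd =>
    simp only [mods, List.mem_append, not_or] at h0
    have h1 := ihc hc.1 h0.1 m
    have h2 := ihd hc.2 h0.2 m
    simp only [time, timeBound, Polynomial.eval_add, Polynomial.eval_one, Polynomial.eval_C]
    split_ifs <;> omega
  | loop x e c ih =>
    obtain ⟨rfl, hc⟩ := hc
    have h0' := h0
    simp only [mods, List.mem_cons, not_or] at h0
    simp only [time, timeBound, Polynomial.eval_add, Polynomial.eval_one, Polynomial.eval_C,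
      Polynomial.eval_mul, Polynomial.eval_X]
    refine Nat.add_le_add_left ?_ _
    rw [value_numNodes]
    refine (Finset.sum_le_card_nsmul _ _ (c.timeBound.eval (m 0 0 0) + 1) ?_).trans ?_
    · intro k _
      refine Nat.succ_le_succ ((ih hc h0.2 _).trans (le_of_eq ?_))
      rw [Mem.write_of_ne _ _ _ _ h0.1]
      congr 1
      rename_i hk
      clear ih hc hk
      induction k with
      | zero => rfl
      | succ k ihk => rw [iter, exec_of_notMem_mods h0.2, Mem.write_of_ne _ _ _ _ h0.1, ihk]
    · simp

end Program

/-! ### Shortest paths in weighted complete graphs -/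

/-- `D` holds the lengths of shortest walks in the complete directed graph with positive lengths
`W`, and `p t v` is the node before `v` on a shortest walk from `t` to `v`. -/
structure ShortestPaths {α : Type*} (W D : α → α → ℕ) (p : α → α → α) : Prop where
  self : ∀ x, D x x = 0
  le : ∀ x y z, D x z ≤ D x y + W y z
  parent_self : ∀ x, p x x = x
  parent : ∀ x z, x ≠ z → D x (p x z) + W (p x z) z = D x z

/-- Initial distances: the lengths in array `b + 1`, but zero from a node to itself. -/
def initDistances (b : ℕ) : Program :=
  .forNodes (b + 4) <| .forNodes (b + 5) <|
    .cond (neq (var (b + 4)) (var (b + 5)))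
      (.assign (b + 2) (var (b + 4)) (var (b + 5)) (.read (b + 1) (var (b + 4)) (var (b + 5))))
      (.assign (b + 2) (var (b + 4)) (var (b + 5)) (.lit 0))

/-- One phase of the method of Floyd and Warshall. As subtraction is truncated, `d - (d - e)` is
the minimum of `d` and `e`. -/
def relaxThrough (b : ℕ) : Program :=
  .forNodes (b + 5) <| .forNodes (b + 6) <|
    .assign (b + 2) (var (b + 5)) (var (b + 6))
      (.sub (.read (b + 2) (var (b + 5)) (var (b + 6)))
        (.sub (.read (b + 2) (var (b + 5)) (var (b + 6)))
          (.add (.read (b + 2) (var (b + 5)) (var (b + 4)))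
            (.read (b + 2) (var (b + 4)) (var (b + 6))))))

/-- Searches the node before `v` on a shortest walk from `t` to `v`, for all `t` and `v`, and keeps
the last candidate that it finds. As lengths are positive, there is none for `v = t`, and `t`
becomes its own predecessor. -/
def findParents (b : ℕ) : Program :=
  .forNodes (b + 4) <| .forNodes (b + 5) <|
    .seq (.assign (b + 3) (var (b + 4)) (var (b + 5)) (var (b + 4))) <|
      .forNodes (b + 6) <|
        .cond (neq (.add (.read (b + 2) (var (b + 4)) (var (b + 6)))
            (.read (b + 1) (var (b + 6)) (var (b + 5))))
          (.read (b + 2) (var (b + 4)) (var (b + 5))))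
        .skip
        (.assign (b + 3) (var (b + 4)) (var (b + 5)) (var (b + 6)))

/-- The program that computes shortest paths for the lengths in array `b + 1`: distances in array
`b + 2` by the method of Floyd and Warshall, and predecessors in array `b + 3` by search. Arrays
`b + 4` to `b + 6` hold the loop variables. -/
def shortestPaths (b : ℕ) : Program :=
  .seq (initDistances b) <| .seq (.forNodes (b + 4) (relaxThrough b)) (findParents b)

lemma exec_initDistances {b n : ℕ} {m : Mem} (hn : m 0 0 0 = n) :
    ∀ x < n, ∀ z < n,
      (initDistances b).exec m (b + 2) x z = if x = z then 0 else m (b + 1) x z := by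
  refine Program.exec_fill hn (by simp [Program.mods]) (by simp) (by simp) (by simp)
    (by simp [Program.mods]) (fun x z y => y = if x = z then 0 else m (b + 1) x z) ?_
  intro x hx z hz m' hframe hi hj _
  have h1 : m' (b + 1) = m (b + 1) := hframe _ (by simp [Program.mods])
  simp only [Program.exec, Expr.value, value_var, hi, hj, ne_eq, value_neq_eq_zero, ite_not, h1]
  split_ifs with h <;> simp +contextual [Mem.write_apply]

lemma exec_relaxThrough {b n k : ℕ} {m : Mem} (hn : m 0 0 0 = n) (hk : k < n)
    (hmk : m (b + 4) 0 0 = k) (hself : m (b + 2) k k = 0) :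
    ∀ x < n, ∀ z < n, (relaxThrough b).exec m (b + 2) x z =
      min (m (b + 2) x z) (m (b + 2) x k + m (b + 2) k z) := by
  refine Program.exec_fill hn (by simp [Program.mods]) (by simp) (by simp) (by simp)
    (by simp [Program.mods])
    (fun x z y => y = min (m (b + 2) x z) (m (b + 2) x k + m (b + 2) k z)) ?_
  intro x hx z hz m' hframe hi hj hm'
  have h1 : m' (b + 4) = m (b + 4) := hframe _ (by simp [Program.mods])
  -- the phase does not change the row and the column of `k`
  have hxk : m' (b + 2) x k = m (b + 2) x k := by
    by_cases h : x < x ∨ x = x ∧ k < z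
    · have := (hm' x hx k hk).1 h
      simpa [hself] using this
    · exact (hm' x hx k hk).2 h
  have hkz : m' (b + 2) k z = m (b + 2) k z := by
    by_cases h : k < x ∨ k = x ∧ z < z
    · have := (hm' k hk z hz).1 h
      simpa [hself] using this
    · exact (hm' k hk z hz).2 h
  have hxz : m' (b + 2) x z = m (b + 2) x z := (hm' x hx z hz).2 (by omega)
  simp only [Program.exec, Expr.value, value_var, hi, hj, h1, hmk, hxk, hkz, hxz]
  refine ⟨?_, fun x' z' h => ?_⟩
  · rw [Mem.write_self]
    omega
  · rw [Mem.write_apply, if_neg h]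

lemma exec_findParents {b n : ℕ} {m : Mem} (hn : m 0 0 0 = n) :
    ∀ t < n, ∀ v < n,
      ((∀ y < n, m (b + 2) t y + m (b + 1) y v ≠ m (b + 2) t v) →
        (findParents b).exec m (b + 3) t v = t) ∧
      ((∃ y < n, m (b + 2) t y + m (b + 1) y v = m (b + 2) t v) →
        (findParents b).exec m (b + 3) t v < n ∧
        m (b + 2) t ((findParents b).exec m (b + 3) t v) +
          m (b + 1) ((findParents b).exec m (b + 3) t v) v = m (b + 2) t v) := by
  refine Program.exec_fill hn (by simp [Program.mods]) (by simp) (by simp) (by simp)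
    (by simp [Program.mods])
    (fun t v y => ((∀ y < n, m (b + 2) t y + m (b + 1) y v ≠ m (b + 2) t v) → y = t) ∧
      ((∃ y < n, m (b + 2) t y + m (b + 1) y v = m (b + 2) t v) →
        y < n ∧ m (b + 2) t y + m (b + 1) y v = m (b + 2) t v)) ?_
  intro t ht v hv m' hframe hi hj _
  have h0 : m' 0 = m 0 := hframe _ (by simp [Program.mods])
  have h1 : m' (b + 1) = m (b + 1) := hframe _ (by simp [Program.mods])
  have h2 : m' (b + 2) = m (b + 2) := hframe _ (by simp [Program.mods])
  rw [Program.exec]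
  set m1 := (Program.assign (b + 3) (var (b + 4)) (var (b + 5)) (var (b + 4))).exec m' with hm1
  have hm1' : m1 = m'.write (b + 3) t v t := by
    simp only [hm1, Program.exec, value_var, hi, hj]
  have hn1 : m1 0 0 0 = n := by
    rw [hm1', Mem.write_of_ne _ _ _ _ (by simp), h0, hn]
  have key := Program.exec_forNodes_induct (x := b + 6)
    (c := .cond (neq (.add (.read (b + 2) (var (b + 4)) (var (b + 6)))
            (.read (b + 1) (var (b + 6)) (var (b + 5))))
          (.read (b + 2) (var (b + 4)) (var (b + 5))))
        .skip
        (.assign (b + 3) (var (b + 4)) (var (b + 5)) (var (b + 6)))) hn1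
    (fun k m2 => ((∀ y < k, m (b + 2) t y + m (b + 1) y v ≠ m (b + 2) t v) →
        m2 (b + 3) t v = t) ∧
      ((∃ y < k, m (b + 2) t y + m (b + 1) y v = m (b + 2) t v) →
        m2 (b + 3) t v < n ∧
          m (b + 2) t (m2 (b + 3) t v) + m (b + 1) (m2 (b + 3) t v) v = m (b + 2) t v) ∧
      ∀ x' z', ¬(x' = t ∧ z' = v) → m2 (b + 3) x' z' = m' (b + 3) x' z') ?_ ?_
  · exact ⟨⟨key.1, key.2.1⟩, key.2.2⟩
  · refine ⟨fun _ => ?_, fun h => ?_, fun x' z' h => ?_⟩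
    · rw [hm1', Mem.write_self]
    · obtain ⟨y, hy, _⟩ := h
      exact absurd hy (Nat.not_lt_zero y)
    · rw [hm1', Mem.write_apply, if_neg h]
  · rintro k hk m2 hframe2 ⟨q1, q2, q3⟩
    have e1 : m2 (b + 1) = m (b + 1) := by
      rw [hframe2 _ (by simp [Program.mods]), hm1', Mem.write_of_ne _ _ _ _ (by simp), h1]
    have e2 : m2 (b + 2) = m (b + 2) := by
      rw [hframe2 _ (by simp [Program.mods]), hm1', Mem.write_of_ne _ _ _ _ (by simp), h2]
    have e4 : m2 (b + 4) 0 0 = t := by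
      rw [hframe2 _ (by simp [Program.mods]), hm1', Mem.write_of_ne _ _ _ _ (by simp), hi]
    have e5 : m2 (b + 5) 0 0 = v := by
      rw [hframe2 _ (by simp [Program.mods]), hm1', Mem.write_of_ne _ _ _ _ (by simp), hj]
    have w : ∀ a, a ≠ b + 6 → m2.write (b + 6) 0 0 k a = m2 a := fun a ha =>
      Mem.write_of_ne _ _ _ _ ha
    simp only [Program.exec, Expr.value, value_var, ne_eq, value_neq_eq_zero, ite_not,
      w (b + 1) (by simp), w (b + 2) (by simp), w (b + 4) (by simp), w (b + 5) (by simp),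
      Mem.write_self, e1, e2, e4, e5]
    split_ifs with h
    · refine ⟨fun h' => absurd h (h' k (Nat.lt_succ_self k)), fun _ => ?_, fun x' z' h' => ?_⟩
      · rw [Mem.write_self]
        exact ⟨hk, h⟩
      · rw [Mem.write_apply, if_neg h', w _ (by simp)]
        exact q3 x' z' h'
    · rw [w _ (by simp)]
      refine ⟨fun h' => q1 fun y hy => h' y (by omega), ?_, q3⟩
      rintro ⟨y, hy, hy'⟩
      refine q2 ⟨y, ?_, hy'⟩
      rcases Nat.lt_succ_iff_lt_or_eq.1 hy with hy | rfl
      · exact hy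
      · exact absurd hy' h

/-- The invariant of the method of Floyd and Warshall: the triangle inequality through the nodes
treated so far, and a last step of a shortest walk to every node. Both survive a phase, as the
phase replaces all distances at once by the minimum of two terms. -/
lemma exec_floydWarshall {b n : ℕ} {m : Mem} (hn : m 0 0 0 = n)
    (hm : ∀ x < n, ∀ z < n, m (b + 2) x z = if x = z then 0 else m (b + 1) x z) :
    let m' := (Program.forNodes (b + 4) (relaxThrough b)).exec m
    (∀ x < n, m' (b + 2) x x = 0) ∧
      (∀ x < n, ∀ y < n, ∀ z < n, m' (b + 2) x z ≤ m' (b + 2) x y + m (b + 1) y z) ∧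
      ∀ x < n, ∀ z < n, x ≠ z → ∃ y < n, m' (b + 2) x y + m (b + 1) y z = m' (b + 2) x z := by
  intro m'
  have key := Program.exec_forNodes_induct (x := b + 4) (c := relaxThrough b) hn
    (fun k m' => (∀ x < n, m' (b + 2) x x = 0) ∧
      (∀ x < n, ∀ z < n, x ≠ z → m' (b + 2) x z ≤ m (b + 1) x z) ∧
      (∀ j < k, ∀ x < n, ∀ z < n, m' (b + 2) x z ≤ m' (b + 2) x j + m' (b + 2) j z) ∧
      ∀ x < n, ∀ z < n, x ≠ z → ∃ y < n, m' (b + 2) x y + m (b + 1) y z ≤ m' (b + 2) x z) ?_ ?_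
  · obtain ⟨h1, h2, h3, h4⟩ := key
    have hle : ∀ x < n, ∀ y < n, ∀ z < n, m' (b + 2) x z ≤ m' (b + 2) x y + m (b + 1) y z := by
      intro x hx y hy z hz
      by_cases hyz : y = z
      · subst hyz
        exact Nat.le_add_right _ _
      · exact (h3 y hy x hx z hz).trans (Nat.add_le_add_left (h2 y hy z hz hyz) _)
    refine ⟨h1, hle, fun x hx z hz hxz => ?_⟩
    obtain ⟨y, hy, h⟩ := h4 x hx z hz hxz
    exact ⟨y, hy, le_antisymm h (hle x hx y hy z hz)⟩
  · refine ⟨fun x hx => ?_, fun x hx z hz hxz => ?_, fun j hj => absurd hj (Nat.not_lt_zero j),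
      fun x hx z hz hxz => ⟨x, hx, ?_⟩⟩
    · rw [hm x hx x hx, if_pos rfl]
    · rw [hm x hx z hz, if_neg hxz]
    · rw [hm x hx x hx, hm x hx z hz, if_pos rfl, if_neg hxz, zero_add]
  · rintro k hk m1 hframe ⟨h1, h2, h3, h4⟩
    have e2 : m1.write (b + 4) 0 0 k (b + 2) = m1 (b + 2) := Mem.write_of_ne _ _ _ _ (by simp)
    have e0 : m1.write (b + 4) 0 0 k 0 0 0 = n := by
      rw [Mem.write_of_ne _ _ _ _ (by simp), hframe 0 (by simp [Program.mods, relaxThrough]), hn]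
    have step := exec_relaxThrough (b := b) e0 hk (Mem.write_self ..) (by rw [e2, h1 k hk])
    rw [e2] at step
    generalize (relaxThrough b).exec (m1.write (b + 4) 0 0 k) (b + 2) = D' at step ⊢
    generalize m1 (b + 2) = D at *
    generalize m (b + 1) = W at *
    refine ⟨fun x hx => ?_, fun x hx z hz hxz => ?_, fun j hj x hx z hz => ?_,
      fun x hx z hz hxz => ?_⟩
    · rw [step x hx x hx, h1 x hx, Nat.zero_min]
    · rw [step x hx z hz]
      exact (min_le_left _ _).trans (h2 x hx z hz hxz)
    · have hj' : j < n := by omega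
      rw [step x hx z hz, step x hx j hj', step j hj' z hz]
      rcases Nat.lt_succ_iff_lt_or_eq.1 hj with hj | rfl
      · have a1 := h3 j hj x hx z hz
        have a2 := h3 j hj x hx k hk
        have a3 := h3 j hj k hk z hz
        omega
      · have a1 := h1 j hj'
        omega
    · have huse : ∀ x' < n, x' ≠ z → (D x x' + D x' z ≤ D' x z) →
          (∀ y < n, D' x y ≤ D x x' + D x' y) →
          ∃ y < n, D' x y + W y z ≤ D' x z := by
        intro x' hx' hne h5 h6
        obtain ⟨y, hy, hyz⟩ := h4 x' hx' z hz hne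
        exact ⟨y, hy, by have := h6 y hy; omega⟩
      have hD : D' x z = min (D x z) (D x k + D k z) := step x hx z hz
      by_cases hle : D x z ≤ D x k + D k z
      · refine huse x hx hxz ?_ fun y hy => ?_
        · rw [h1 x hx, hD, min_eq_left hle, zero_add]
        · rw [h1 x hx, zero_add, step x hx y hy]
          exact min_le_left _ _
      · have hkz : k ≠ z := by
          rintro rfl
          exact hle (Nat.le_add_right _ _)
        refine huse k hk hkz ?_ fun y hy => ?_
        · rw [hD]
          exact le_min (by omega) le_rfl
        · rw [step x hx y hy]
          exact min_le_right _ _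

/-- Correctness of `shortestPaths`, in terms of the nodes that `ν` numbers. -/
lemma exec_shortestPaths {V : Type u} {n : ℕ} (ν : V ≃ Fin n) {b : ℕ} {m : Mem} (hn : m 0 0 0 = n)
    (hpos : ∀ x y : V, 0 < m (b + 1) (ν x) (ν y)) :
    ∃ p : V → V → V,
      (∀ x y, (shortestPaths b).exec m (b + 3) (ν x) (ν y) = ν (p x y)) ∧
      ShortestPaths (fun x y => m (b + 1) (ν x) (ν y))
        (fun x y => (shortestPaths b).exec m (b + 2) (ν x) (ν y)) p := by
  classical
  obtain ⟨h1, h2, h3⟩ := exec_floydWarshall (b := b) (m := (initDistances b).exec m) (n := n)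
    (by rw [Program.exec_of_notMem_mods (by simp [Program.mods, initDistances]), hn])
    (fun x hx z hz => by
      rw [exec_initDistances hn x hx z hz,
        Program.exec_of_notMem_mods (a := b + 1) (by simp [Program.mods, initDistances])])
  rw [Program.exec_of_notMem_mods (a := b + 1) (by simp [Program.mods, initDistances])] at h2 h3
  set m2 := (Program.forNodes (b + 4) (relaxThrough b)).exec ((initDistances b).exec m) with hm2
  have hn2 : m2 0 0 0 = n := by
    rw [hm2, Program.exec_of_notMem_mods (by simp [Program.mods, relaxThrough]),
      Program.exec_of_notMem_mods (by simp [Program.mods, initDistances]), hn]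
  have hw : m2 (b + 1) = m (b + 1) := by
    rw [hm2, Program.exec_of_notMem_mods (by simp [Program.mods, relaxThrough]),
      Program.exec_of_notMem_mods (by simp [Program.mods, initDistances])]
  have hexec : (shortestPaths b).exec m = (findParents b).exec m2 := rfl
  have hd : (findParents b).exec m2 (b + 2) = m2 (b + 2) :=
    Program.exec_of_notMem_mods (by simp [Program.mods, findParents]) _
  have h4 := exec_findParents (b := b) hn2
  rw [hw] at h4
  rw [hexec, hd]
  set q := (findParents b).exec m2 (b + 3)
  have hself : ∀ x : V, q (ν x) (ν x) = ν x := by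
    intro x
    refine (h4 _ (ν x).2 _ (ν x).2).1 fun y hy => ?_
    rw [h1 _ (ν x).2]
    have := hpos (ν.symm ⟨y, hy⟩) x
    rw [ν.apply_symm_apply] at this
    simp only at this
    omega
  have hstep : ∀ x z : V, x ≠ z → q (ν x) (ν z) < n ∧ m2 (b + 2) (ν x) (q (ν x) (ν z)) +
      m (b + 1) (q (ν x) (ν z)) (ν z) = m2 (b + 2) (ν x) (ν z) := by
    intro x z hxz
    refine (h4 _ (ν x).2 _ (ν z).2).2 (h3 _ (ν x).2 _ (ν z).2 fun h => hxz ?_)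
    exact ν.injective (Fin.ext h)
  have hlt : ∀ x z : V, q (ν x) (ν z) < n := by
    intro x z
    by_cases hxz : x = z
    · rw [hxz, hself]
      exact (ν z).2
    · exact (hstep x z hxz).1
  refine ⟨fun x z => ν.symm ⟨q (ν x) (ν z), hlt x z⟩, fun x y => by simp, ?_, ?_, ?_, ?_⟩
  · exact fun x => h1 _ (ν x).2
  · exact fun x y z => h2 _ (ν x).2 _ (ν y).2 _ (ν z).2
  · intro x
    simp [hself]
  · intro x z hxz
    simpa using (hstep x z hxz).2

/-! ### Distances computed from weight matrices of graphs -/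

section WeightMatrix

variable {α V : Type*}

/-- The matrix `W` on `V` holds the edge lengths `w` of the graph `Γ`, whose nodes are embedded
into `V` by `f`; all other pairs of nodes, if the second one is in the range of `f`, have at least
the length `I`. -/
structure EncodesGraph (f : α → V) (Γ : SimpleGraph α) (w : Sym2 α → ℝ) (I : ℕ)
    (W : V → V → ℕ) : Prop where
  injective : Function.Injective f
  pos : ∀ x y, 0 < W x y
  adj : ∀ a b, Γ.Adj a b → (W (f a) (f b) : ℝ) = w s(a, b)
  exists_adj : ∀ x b, W x (f b) < I → ∃ a, f a = x ∧ Γ.Adj a b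

lemma walkLength_cons {H : SimpleGraph α} (w : Sym2 α → ℝ) {a b c : α} (h : H.Adj a b)
    (p : H.Walk b c) : walkLength w (.cons h p) = w s(a, b) + walkLength w p := by
  simp [walkLength]

lemma walkLength_nil {H : SimpleGraph α} (w : Sym2 α → ℝ) (a : α) :
    walkLength w (.nil : H.Walk a a) = 0 := by
  simp [walkLength]

lemma walkLength_append {H : SimpleGraph α} (w : Sym2 α → ℝ) {a b c : α} (p : H.Walk a b)
    (q : H.Walk b c) : walkLength w (p.append q) = walkLength w p + walkLength w q := by
  simp [walkLength]

lemma walkLength_reverse {H : SimpleGraph α} (w : Sym2 α → ℝ) {a b : α} (p : H.Walk a b) :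
    walkLength w p.reverse = walkLength w p := by
  simp [walkLength, List.sum_reverse]

lemma walkLength_one {H : SimpleGraph α} {a b : α} (p : H.Walk a b) :
    walkLength (fun _ => 1) p = p.length := by
  simp [walkLength]

lemma walkLength_nonneg {H : SimpleGraph α} {w : Sym2 α → ℝ} (hw : ∀ e, 0 ≤ w e) {a b : α}
    (p : H.Walk a b) : 0 ≤ walkLength w p := by
  refine List.sum_nonneg ?_
  intro x hx
  obtain ⟨e, _, rfl⟩ := List.mem_map.1 hx
  exact hw e

namespace ShortestPaths

variable {W D : V → V → ℕ} {p : V → V → V} {f : α → V} {Γ : SimpleGraph α} {w : Sym2 α → ℝ} {I : ℕ}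

lemma le_add_walkLength (h : ShortestPaths W D p) (hE : EncodesGraph f Γ w I W) (x : V) {a b : α}
    (q : Γ.Walk a b) : (D x (f b) : ℝ) ≤ D x (f a) + walkLength w q := by
  induction q with
  | nil => rw [walkLength_nil, add_zero]
  | @cons a b c hab q ih =>
    rw [walkLength_cons, ← hE.adj a b hab]
    have : (D x (f b) : ℝ) ≤ D x (f a) + W (f a) (f b) := by exact_mod_cast h.le x (f a) (f b)
    linarith

lemma le_walkLength (h : ShortestPaths W D p) (hE : EncodesGraph f Γ w I W) {a b : α}
    (q : Γ.Walk a b) : (D (f a) (f b) : ℝ) ≤ walkLength w q := by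
  have := h.le_add_walkLength hE (f a) q
  rwa [h.self, Nat.cast_zero, zero_add] at this

lemma parent_lt (h : ShortestPaths W D p) (hpos : ∀ x y, 0 < W x y) {x y : V} (hxy : x ≠ y) :
    D x (p x y) < D x y := by
  have h1 := h.parent x y hxy
  have h2 := hpos (p x y) y
  omega

lemma exists_parent (h : ShortestPaths W D p) (hE : EncodesGraph f Γ w I W) {x : V} {b : α}
    (hb : x ≠ f b) (hI : D x (f b) < I) :
    ∃ c, f c = p x (f b) ∧ Γ.Adj c b ∧ (D x (f c) : ℝ) + w s(c, b) = D x (f b) := by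
  have h1 := h.parent x (f b) hb
  obtain ⟨c, hc, hcb⟩ := hE.exists_adj (p x (f b)) b (by omega)
  refine ⟨c, hc, hcb, ?_⟩
  rw [← hE.adj c b hcb, hc]
  exact_mod_cast h1

lemma exists_walk (h : ShortestPaths W D p) (hE : EncodesGraph f Γ w I W) {a b : α}
    (hI : D (f a) (f b) < I) : ∃ q : Γ.Walk a b, walkLength w q = D (f a) (f b) := by
  obtain ⟨k, hk⟩ : ∃ k, D (f a) (f b) = k := ⟨_, rfl⟩
  induction k using Nat.strong_induction_on generalizing b with
  | _ k ih =>
    by_cases hab : a = b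
    · subst hab
      exact ⟨.nil, by rw [walkLength_nil, h.self, Nat.cast_zero]⟩
    · have hne : f a ≠ f b := fun h' => hab (hE.injective h')
      obtain ⟨c, hc, hcb, hD⟩ := h.exists_parent hE hne hI
      have hlt := h.parent_lt hE.pos hne
      rw [← hc] at hlt
      obtain ⟨q, hq⟩ := ih (D (f a) (f c)) (by omega) (b := c) (by omega) rfl
      refine ⟨q.append (.cons hcb .nil), ?_⟩
      rw [walkLength_append, walkLength_cons, walkLength_nil, hq, add_zero]
      exact hD

end ShortestPaths

lemma ShortestPaths.eq_dist_of_lt {W D : V → V → ℕ} {p : V → V → V} {Γ : SimpleGraph V} {I : ℕ}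
    (h : ShortestPaths W D p) (hE : EncodesGraph id Γ (fun _ => 1) I W) {x y : V}
    (hI : D x y < I) : Γ.Reachable x y ∧ D x y = Γ.dist x y := by
  obtain ⟨q, hq⟩ := h.exists_walk (a := x) (b := y) hE hI
  rw [walkLength_one] at hq
  have hq' : q.length = D x y := by exact_mod_cast hq
  obtain ⟨q', hq''⟩ := q.reachable.exists_walk_length_eq_dist
  have h1 := h.le_walkLength hE q'
  rw [walkLength_one, hq''] at h1
  have h2 : D x y ≤ Γ.dist x y := by exact_mod_cast h1
  exact ⟨q.reachable, le_antisymm h2 (hq' ▸ SimpleGraph.dist_le q)⟩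

lemma dist_lt_card [Fintype V] {Γ : SimpleGraph V} {x y : V} (h : Γ.Reachable x y) :
    Γ.dist x y < Fintype.card V := by
  obtain ⟨q, hq⟩ := h.exists_isPath
  exact (SimpleGraph.dist_le q).trans_lt hq.length_lt

lemma ShortestPaths.lt_of_reachable [Fintype V] {W D : V → V → ℕ} {p : V → V → V}
    {Γ : SimpleGraph V} {I : ℕ} (h : ShortestPaths W D p)
    (hE : EncodesGraph id Γ (fun _ => 1) I W) (hI : Fintype.card V ≤ I) {x y : V}
    (hxy : Γ.Reachable x y) : D x y < I := by
  obtain ⟨q, hq⟩ := hxy.exists_isPath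
  have h1 := h.le_walkLength hE q
  rw [walkLength_one] at h1
  have h2 : D x y ≤ q.length := by exact_mod_cast h1
  exact h2.trans_lt (hq.length_lt.trans_le hI)

/-- Distances with respect to edge lengths less than the number of nodes are less than the square
of that number. -/
lemma ShortestPaths.lt_sq_of_reachable [Fintype V] {W D : V → V → ℕ} {p : V → V → V} {f : α → V}
    {Γ : SimpleGraph α} {w : Sym2 α → ℝ} {I : ℕ} (h : ShortestPaths W D p)
    (hE : EncodesGraph f Γ w I W) (hw : ∀ e, w e ≤ Fintype.card V) {a b : α}
    (hab : Γ.Reachable a b) : D (f a) (f b) < Fintype.card V * Fintype.card V := by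
  classical
  have : Fintype α := Fintype.ofInjective f hE.injective
  obtain ⟨q, hq⟩ := hab.exists_isPath
  have h1 := h.le_walkLength hE q
  have h2 : walkLength w q ≤ q.length * Fintype.card V := by
    clear h1 hq
    induction q with
    | nil => simp [walkLength_nil]
    | @cons a b c hab q ih =>
      rw [walkLength_cons, SimpleGraph.Walk.length_cons, Nat.cast_succ]
      have := hw s(a, b)
      have := ih q.reachable
      linarith
  have h3 : D (f a) (f b) ≤ q.length * Fintype.card V := by exact_mod_cast h1.trans h2
  have h4 : q.length < Fintype.card V :=
    hq.length_lt.trans_le (Fintype.card_le_of_injective f hE.injective)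
  exact h3.trans_lt (Nat.mul_lt_mul_of_pos_right h4 (by omega))

end WeightMatrix

/-! ### Minimum spanning trees -/

section SpanningTrees

variable {α : Type u} [Fintype α] {w : Sym2 α → ℝ}

lemma totalWeight_deleteEdges (N : SimpleGraph α) {a b : α} (hab : N.Adj a b) :
    totalWeight w (N.deleteEdges {s(a, b)}) + w s(a, b) = totalWeight w N := by
  classical
  have hsingle : w s(a, b) = ∑ e, ({s(a, b)} : Set (Sym2 α)).indicator w e := by
    rw [Finset.sum_eq_single s(a, b)]
    · simp
    · intro e _ he
      exact Set.indicator_of_notMem (by simpa using he) w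
    · simp
  rw [totalWeight_eq_sum_indicator, totalWeight_eq_sum_indicator, hsingle,
    ← Finset.sum_add_distrib, SimpleGraph.edgeSet_deleteEdges]
  refine Finset.sum_congr rfl fun e _ => ?_
  by_cases he : e = s(a, b)
  · subst he
    simp [hab]
  · simp [Set.indicator_apply, he]

/-- Every connected graph can be replaced, at no cost, by a connected graph that contains `F`. -/
def IsExtendable (w : Sym2 α → ℝ) (F : SimpleGraph α) : Prop :=
  ∀ M : SimpleGraph α, M.Connected → ∃ M' : SimpleGraph α, M'.Connected ∧ F ≤ M' ∧
    totalWeight w M' ≤ totalWeight w M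

lemma isExtendable_bot : IsExtendable w ⊥ := fun M hM => ⟨M, hM, bot_le, le_rfl⟩

lemma IsExtendable.weight_le (hw : ∀ e, 0 ≤ w e) {F : SimpleGraph α} (hF : IsExtendable w F)
    {M : SimpleGraph α} (hM : M.Connected) : totalWeight w F ≤ totalWeight w M := by
  obtain ⟨M', _, h1, h2⟩ := hF M hM
  exact (totalWeight_mono hw h1).trans h2

/-- The exchange argument behind Kruskal's algorithm. -/
lemma IsExtendable.sup_edge (hw : ∀ e, 0 ≤ w e) {F : SimpleGraph α} (hF : IsExtendable w F)
    {x y : α} (hxy : ¬F.Reachable x y)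
    (hmin : ∀ a b, w s(a, b) < w s(x, y) → F.Reachable a b) :
    IsExtendable w (F ⊔ SimpleGraph.edge x y) := by
  classical
  have hne : x ≠ y := by
    rintro rfl
    exact hxy (SimpleGraph.Reachable.refl x)
  intro M hM
  obtain ⟨M', hM', hFM, hwM⟩ := hF M hM
  by_cases hadj : M'.Adj x y
  · exact ⟨M', hM', sup_le hFM ((SimpleGraph.edge_le_iff _).2 (Or.inr hadj)), hwM⟩
  obtain ⟨p, hp⟩ := (hM' x y).exists_isPath
  -- the path from `x` to `y` in `M'` leaves the component of `x` in `F` by an edge `s(a, b)`, which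
  -- is exchanged for the new edge
  obtain ⟨e, hep, h1, h2⟩ := p.exists_boundary_dart {z | F.Reachable x z}
    (SimpleGraph.Reachable.refl x) hxy
  have hnF : ¬F.Reachable e.fst e.snd := fun h => h2 (SimpleGraph.Reachable.trans h1 h)
  set a := e.fst
  set b := e.snd
  have hab : M'.Adj a b := e.adj
  have habp : s(a, b) ∈ p.edges := List.mem_map.2 ⟨e, hep, rfl⟩
  have hle : w s(x, y) ≤ w s(a, b) := by
    by_contra h
    exact hnF (hmin a b (not_le.1 h))
  set N := M' ⊔ SimpleGraph.edge x y with hN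
  have hNM : M' ≤ N := le_sup_left
  have hNxy : N.Adj y x := Or.inr ((SimpleGraph.edge_adj ..).2 ⟨Or.inr ⟨rfl, rfl⟩, hne.symm⟩)
  have hcycle : (SimpleGraph.Walk.cons hNxy (p.mapLe hNM)).IsCycle := by
    rw [SimpleGraph.Walk.cons_isCycle_iff]
    refine ⟨hp.mapLe hNM, fun h => hadj ?_⟩
    rw [SimpleGraph.Walk.edges_mapLe_eq_edges] at h
    exact (p.adj_of_mem_edges h).symm
  have hbridge : ¬N.IsBridge s(a, b) := by
    intro h
    refine (SimpleGraph.isBridge_iff_forall_cycle_notMem (hNM hab)).1 h _ hcycle ?_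
    rw [SimpleGraph.Walk.edges_cons, SimpleGraph.Walk.edges_mapLe_eq_edges]
    exact List.mem_cons_of_mem _ habp
  have hneq : s(a, b) ≠ s(x, y) := fun h => hadj (by rw [← SimpleGraph.mem_edgeSet, ← h]; exact hab)
  refine ⟨N.deleteEdges {s(a, b)},
    (hM'.mono hNM).connected_delete_edge_of_not_isBridge hbridge, ?_, ?_⟩
  · intro c d hcd
    rw [SimpleGraph.deleteEdges_adj]
    rcases hcd with hcd | hcd
    · refine ⟨hNM (hFM hcd), fun h => hnF ?_⟩
      rw [Set.mem_singleton_iff] at h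
      have : F.Adj a b := by rwa [← SimpleGraph.mem_edgeSet, ← h]
      exact this.reachable
    · refine ⟨Or.inr hcd, fun h => hneq ?_⟩
      rw [Set.mem_singleton_iff] at h
      rw [SimpleGraph.edge_adj] at hcd
      rcases hcd.1 with ⟨rfl, rfl⟩ | ⟨rfl, rfl⟩
      · exact h.symm
      · rw [← h, Sym2.eq_swap]
  · have h1 := totalWeight_deleteEdges (w := w) N (hNM hab)
    have h2 := totalWeight_sup_edge_le hw M' x y
    linarith

/-! ### The length of the shortcuts -/

/-- If the nodes of `S` and the root are pairwise at least as far apart in `F` as their values of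
`D` together, then a tour around `F` passes all of them, and the sum of these values is at most the
length of `F`. -/
lemma sum_le_totalWeight (hw : ∀ e, 0 ≤ w e) {F : SimpleGraph α} (hF : F.Connected) {r : α}
    {D : α → ℝ} (hr : D r = 0) {S : Finset α}
    (hS : ∀ u, (u = r ∨ u ∈ S) → ∀ v, (v = r ∨ v ∈ S) → u ≠ v → ∀ q : F.Walk u v,
      D u + D v ≤ walkLength w q) :
    ∑ v ∈ S, D v ≤ totalWeight w F := by
  classical
  let d : α → α → ℝ := fun a b => ⨅ q : F.Walk a b, walkLength w q
  have hne : ∀ a b, Nonempty (F.Walk a b) := fun a b => hF a b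
  have hbdd : ∀ a b, BddBelow (Set.range fun q : F.Walk a b => walkLength w q) := by
    intro a b
    refine ⟨0, ?_⟩
    rintro _ ⟨q, rfl⟩
    exact walkLength_nonneg hw q
  have hle : ∀ {a b} (q : F.Walk a b), d a b ≤ walkLength w q := fun q => ciInf_le (hbdd _ _) q
  have h0 : ∀ a b, 0 ≤ d a b := fun a b => le_ciInf fun q => walkLength_nonneg hw q
  have htri : ∀ a b c, d a c ≤ d a b + d b c := fun a b c => le_ciInf_add_ciInf fun p q => by
    rw [← walkLength_append]
    exact hle _
  have hdS : ∀ u, (u = r ∨ u ∈ S) → ∀ v, (v = r ∨ v ∈ S) → u ≠ v → D u + D v ≤ d u v :=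
    fun u hu v hv huv => le_ciInf fun q => hS u hu v hv huv q
  obtain ⟨l, hl, hcost⟩ := exists_tour F hw (d := d)
    (fun a b hab => (hle (.cons hab .nil)).trans
      (by rw [walkLength_cons, walkLength_nil, add_zero]))
    r (le_antisymm ((hle .nil).trans (by rw [walkLength_nil])) (h0 r r))
  -- every stop counts in the two legs of the tour that it ends and starts
  have hchain : ∀ (l' : List α) (a : α), (a = r ∨ a ∈ S) → (∀ x ∈ l', x ∈ S) →
      (a :: l').Nodup → r ∉ l' → D a + 2 * (l'.map D).sum ≤ chainCost d a (l' ++ [r]) := by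
    intro l'
    induction l' with
    | nil =>
      intro a ha _ _ _
      simp only [List.map_nil, List.sum_nil, mul_zero, add_zero, List.nil_append, chainCost]
      by_cases har : a = r
      · rw [har, hr]
        exact h0 r r
      · have := hdS a ha r (Or.inl rfl) har
        rwa [hr, add_zero] at this
    | cons b l' ih =>
      intro a ha hmem hnd hrl
      have h1 := ih b (Or.inr (hmem b (by simp))) (fun x hx => hmem x (by simp [hx]))
        (List.nodup_cons.1 hnd).2 (fun h => hrl (by simp [h]))
      have h2 := hdS a ha b (Or.inr (hmem b (by simp))) fun h =>
        (List.nodup_cons.1 hnd).1 (by simp [h])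
      simp only [List.map_cons, List.sum_cons, List.cons_append, chainCost]
      linarith
  let l' := (l.filter fun x => x ∈ S ∧ x ≠ r).dedup
  have hsub : l'.Sublist l := (List.dedup_sublist _).trans List.filter_sublist
  have hmem : ∀ x, x ∈ l' ↔ x ∈ S ∧ x ≠ r := by
    intro x
    simp only [l', List.mem_dedup, List.mem_filter, decide_eq_true_eq]
    refine ⟨fun h => h.2, fun h => ⟨?_, h⟩⟩
    exact (hl x (hF r x)).resolve_left h.2
  have hnd : l'.Nodup := List.nodup_dedup _
  have h1 := hchain l' r (Or.inl rfl) (fun x hx => ((hmem x).1 hx).1)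
    (List.nodup_cons.2 ⟨fun h => ((hmem r).1 h).2 rfl, hnd⟩) (fun h => ((hmem r).1 h).2 rfl)
  have h2 := chainCost_sublist h0 htri (hsub.append_right [r]) r
  have h3 : (l'.map D).sum = ∑ v ∈ S, D v := by
    rw [← List.sum_toFinset D hnd]
    refine Finset.sum_subset (fun x hx => ((hmem x).1 (List.mem_toFinset.1 hx)).1) ?_
    intro x hx hxl
    have : x = r := by
      by_contra h
      exact hxl (List.mem_toFinset.2 ((hmem x).2 ⟨hx, h⟩))
    rw [this, hr]
  rw [h3, hr] at h1
  linarith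

end SpanningTrees

/-! ### Trees given by parents -/

section ParentTrees

variable {α : Type u} {w : Sym2 α → ℝ} {ρ : α} {q : α → α} {δ : α → ℕ}

/-- The graph in which every node except the root is joined to its parent. -/
def parentGraph (ρ : α) (q : α → α) : SimpleGraph α :=
  SimpleGraph.fromEdgeSet {e | ∃ a, a ≠ ρ ∧ e = s(q a, a)}

lemma parentGraph_adj {a b : α} : (parentGraph ρ q).Adj a b ↔
    ((b ≠ ρ ∧ a = q b) ∨ (a ≠ ρ ∧ b = q a)) ∧ a ≠ b := by
  rw [parentGraph, SimpleGraph.fromEdgeSet_adj]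
  refine and_congr_left fun _ => ?_
  constructor
  · rintro ⟨c, hc, h⟩
    rcases Sym2.eq_iff.1 h with ⟨rfl, rfl⟩ | ⟨rfl, rfl⟩
    · exact Or.inl ⟨hc, rfl⟩
    · exact Or.inr ⟨hc, rfl⟩
  · rintro (⟨h, rfl⟩ | ⟨h, rfl⟩)
    · exact ⟨b, h, rfl⟩
    · exact ⟨a, h, Sym2.eq_swap⟩

/-- If `δ` decreases from nodes to their parents by the lengths of the edges, then the way along the
parents is a path to the root of length `δ`. -/
lemma exists_parentGraph_path (hlt : ∀ a, a ≠ ρ → δ (q a) < δ a)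
    (hδ : ∀ a, a ≠ ρ → (δ (q a) : ℝ) + w s(q a, a) = δ a) (hρ : δ ρ = 0) (a : α) :
    ∃ p : (parentGraph ρ q).Walk a ρ, p.IsPath ∧ walkLength w p = δ a ∧
      ∀ x ∈ p.support, δ x ≤ δ a := by
  obtain ⟨k, hk⟩ : ∃ k, δ a = k := ⟨_, rfl⟩
  induction k using Nat.strong_induction_on generalizing a with
  | _ k ih =>
    by_cases ha : a = ρ
    · subst ha
      exact ⟨.nil, .nil, by rw [walkLength_nil, hρ, Nat.cast_zero], by simp⟩
    · obtain ⟨p, hp, hw, hs⟩ := ih _ (hk ▸ hlt a ha) (q a) rfl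
      have hne : a ≠ q a := fun h => (hlt a ha).ne (congrArg δ h.symm)
      have hadj : (parentGraph ρ q).Adj a (q a) := parentGraph_adj.2 ⟨Or.inr ⟨ha, rfl⟩, hne⟩
      refine ⟨.cons hadj p, ?_, ?_, ?_⟩
      · rw [SimpleGraph.Walk.cons_isPath_iff]
        exact ⟨hp, fun h => absurd (hs a h) (not_le.2 (hlt a ha))⟩
      · rw [walkLength_cons, hw, Sym2.eq_swap, add_comm, hδ a ha]
      · intro x hx
        rw [SimpleGraph.Walk.support_cons, List.mem_cons] at hx
        rcases hx with rfl | hx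
        · exact le_rfl
        · exact (hs x hx).trans (hlt a ha).le

lemma parentGraph_isTree [Fintype α] (hlt : ∀ a, a ≠ ρ → δ (q a) < δ a)
    (hδ : ∀ a, a ≠ ρ → (δ (q a) : ℝ) + w s(q a, a) = δ a) (hρ : δ ρ = 0) :
    (parentGraph ρ q).IsTree := by
  classical
  have hconn : (parentGraph ρ q).Connected := by
    rw [SimpleGraph.connected_iff_exists_forall_reachable]
    exact ⟨ρ, fun a => (exists_parentGraph_path hlt hδ hρ a).choose.reachable.symm⟩
  rw [SimpleGraph.isTree_iff_connected_and_card]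
  refine ⟨hconn, le_antisymm ?_ hconn.card_vert_le_card_edgeSet_add_one⟩
  have hsub : (parentGraph ρ q).edgeSet ⊆
      ((Finset.univ.erase ρ).image fun a => s(q a, a) : Finset (Sym2 α)) := by
    rw [parentGraph, SimpleGraph.edgeSet_fromEdgeSet]
    rintro e ⟨⟨a, ha, rfl⟩, _⟩
    exact Finset.mem_coe.2 (Finset.mem_image_of_mem _ (Finset.mem_erase.2 ⟨ha, Finset.mem_univ a⟩))
  have h1 := Nat.card_mono (Finset.finite_toSet _) hsub
  have h2 : ((Finset.univ.erase ρ).image fun a => s(q a, a)).card ≤ Fintype.card α - 1 := by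
    refine Finset.card_image_le.trans ?_
    rw [Finset.card_erase_of_mem (Finset.mem_univ ρ), Finset.card_univ]
  have h3 : 0 < Fintype.card α := Fintype.card_pos_iff.2 ⟨ρ⟩
  rw [Nat.card_eq_fintype_card (α := α)]
  simp only [Nat.card_eq_fintype_card, Finset.coe_sort_coe, Fintype.card_coe] at h1
  rw [Nat.card_eq_fintype_card]
  omega

lemma walkLength_parentGraph [Fintype α] (hlt : ∀ a, a ≠ ρ → δ (q a) < δ a)
    (hδ : ∀ a, a ≠ ρ → (δ (q a) : ℝ) + w s(q a, a) = δ a) (hρ : δ ρ = 0) {a : α}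
    (p : (parentGraph ρ q).Walk a ρ) (hp : p.IsPath) : walkLength w p = δ a := by
  obtain ⟨p', hp', h, _⟩ := exists_parentGraph_path (w := w) hlt hδ hρ a
  have := ((parentGraph_isTree hlt hδ hρ).isAcyclic.subsingleton_path a ρ).elim ⟨p, hp⟩ ⟨p', hp'⟩
  rw [show p = p' from congrArg Subtype.val this, h]

end ParentTrees

/-! ### Shortest paths that follow predecessors -/

section PathChoice

variable {V : Type u} {G : SimpleGraph V}

/-- Following the predecessors `p t` leads along a shortest path to `t`. -/
lemma exists_walk_iterate {p : V → V → V}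
    (hp : ∀ t x, x ≠ t → G.Adj x (p t x) ∧ G.dist (p t x) t + 1 = G.dist x t) (hG : G.Connected)
    (x t : V) : ∃ c : G.Walk x t, c.length = G.dist x t ∧
      ∀ e, e ∈ c.edges ↔ ∃ j < G.dist x t, e = s((p t)^[j] x, (p t)^[j + 1] x) := by
  obtain ⟨k, hk⟩ : ∃ k, G.dist x t = k := ⟨_, rfl⟩
  rw [hk]
  induction k generalizing x with
  | zero =>
    obtain rfl := hG.dist_eq_zero_iff.1 hk
    exact ⟨.nil, rfl, by simp⟩
  | succ k ih =>
    have hne : x ≠ t := by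
      rintro rfl
      simp at hk
    obtain ⟨h1, h2⟩ := hp t x hne
    obtain ⟨c, hc, he⟩ := ih (p t x) (by omega)
    refine ⟨.cons h1 c, by rw [SimpleGraph.Walk.length_cons, hc], fun e => ?_⟩
    rw [SimpleGraph.Walk.edges_cons, List.mem_cons, he]
    constructor
    · rintro (rfl | ⟨j, hj, rfl⟩)
      · exact ⟨0, by omega, rfl⟩
      · exact ⟨j + 1, by omega, rfl⟩
    · rintro ⟨j, hj, rfl⟩
      cases j with
      | zero => exact Or.inl rfl
      | succ j => exact Or.inr ⟨j, by omega, rfl⟩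

/-- Paths that depend on the direction are made symmetric by using, for every pair of nodes, the
path from the later to the earlier node in a linear order. -/
lemma exists_symmetric_choice {ι : Type*} [LinearOrder ι] {κ : V → ι} (hκ : Function.Injective κ)
    (c : ∀ x y : V, G.Walk x y) (hc : ∀ x y, (c x y).length = G.dist x y) :
    ∃ P : ∀ x y : V, G.Walk x y, IsShortestPathChoice G P ∧ ∀ x y, κ y ≤ κ x → P x y = c x y := by
  refine ⟨fun x y => if κ y ≤ κ x then c x y else (c y x).reverse, ⟨?_, ?_⟩, fun x y h => if_pos h⟩
  · intro x y
    simp only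
    split_ifs
    · exact hc x y
    · rw [SimpleGraph.Walk.length_reverse, hc, SimpleGraph.dist_comm]
  · intro x y
    by_cases hxy : x = y
    · subst hxy
      have : (c x x).length = 0 := by rw [hc, SimpleGraph.dist_self]
      simp only [le_refl, if_true]
      rw [(SimpleGraph.Walk.length_eq_zero_iff.1 this).eq_nil]
      rfl
    · rcases lt_or_gt_of_ne (fun h => hxy (hκ h)) with h | h
      · simp only [h.le, h.not_ge, if_true, if_false, SimpleGraph.Walk.reverse_reverse]
      · simp only [h.le, h.not_ge, if_true, if_false]

end PathChoice

/-! ### The implementation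

The programs use the following arrays.

* Array 0: the number of nodes. Array 1: the adjacency matrix of `G`. Array 2: the indicator of `U`.
  Array 3: the number of the root. They hold the input and are never overwritten.
* Arrays 4 and 5: the output tree.
* Array 6: the square of the number of nodes, as length of missing edges.
* Arrays 10, 11, 12: edge lengths, distances and predecessors in `G`.
* Arrays 20, 21, 22: the same for the graph on the terminals that becomes the spanning tree.
* Arrays 30, 31, 32: the same for the union of the shortest paths.
* Arrays 40, 41, 42: loop variables. Array 43: the current node of a walk. The loop variables of
  `shortestPaths` are in the three arrays after 12, 22 and 32.
-/

/-- The square of the number `n` of nodes, as a sum of `n` terms `n` for lack of a multiplication.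
It serves as length of missing edges: paths with edges of `G`, or with edges between terminals, are
shorter. -/
def computeInfinity : Program :=
  .forNodes 40 (.assign 6 (.lit 0) (.lit 0) (.add (var 6) numNodes))

/-- Edge lengths in array 10: the edges of the input graph have length `1`. -/
def loadGraph : Program :=
  .forNodes 40 <| .forNodes 41 <|
    .cond (.read 1 (var 40) (var 41))
      (.assign 10 (var 40) (var 41) (.lit 1))
      (.assign 10 (var 40) (var 41) (var 6))

/-- The edge lengths of a graph without edges. -/
def clearGraph (a : ℕ) : Program :=
  .forNodes 40 <| .forNodes 41 <| .assign a (var 40) (var 41) (var 6)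

/-- Writes the length `e` of an edge to both of its cells. -/
def setEdge (a : ℕ) (i j e : Expr) : Program := .seq (.assign a i j e) (.assign a j i e)

/-- An expression that is nonzero if and only if `e` is the number of a source or of the root. -/
def isTerminal (e : Expr) : Expr := .add (.read 2 e (.lit 0)) (.sub (.lit 1) (neq e (var 3)))

/-- One round of Kruskal's algorithm: the pair of nodes in variables 41 and 42 becomes an edge if it
has the length in variable 40 and is not yet connected. -/
def considerEdge : Program :=
  .cond (isTerminal (var 41))
    (.cond (isTerminal (var 42))
      (.cond (neq (.read 11 (var 41) (var 42)) (var 40)) .skip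
        (.seq (shortestPaths 19)
          (.cond (.sub (var 6) (.read 21 (var 41) (var 42))) .skip
            (setEdge 20 (var 41) (var 42) (var 40)))))
      .skip)
    .skip

/-- Kruskal's algorithm on the terminals, with edge lengths in array 20. As distances in `G` are
less than the number of nodes, the pairs need not be sorted: the outer loop runs through the
possible lengths. -/
def kruskal : Program := .forNodes 40 <| .forNodes 41 <| .forNodes 42 considerEdge

/-- If the node in variable 41 has the distance in variable 40 from the root, and if it is more
than three times as far away in the current graph, then it is joined to the root. -/
def considerShortcut : Program :=
  .cond (isTerminal (var 41))
    (.cond (neq (.read 11 (var 3) (var 41)) (var 40)) .skip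
      (.seq (shortestPaths 19)
        (.cond (.sub (.read 21 (var 3) (var 41)) (.add (var 40) (.add (var 40) (var 40))))
          (setEdge 20 (var 3) (var 41) (var 40)) .skip)))
    .skip

/-- Adds shortcuts for all terminals, in the order of their distances from the root. -/
def addShortcuts : Program := .forNodes 40 <| .forNodes 41 considerShortcut

/-- The walk in variable 43, which is heading for the parent of the terminal in variable 40, makes a
step along an edge that is added to the graph in array 30. -/
def markStep : Program :=
  .cond (neq (var 43) (.read 22 (var 3) (var 40)))
    (.seq (setEdge 30 (var 43) (.read 12 (.read 22 (var 3) (var 40)) (var 43)) (.lit 1))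
      (.assign 43 (.lit 0) (.lit 0) (.read 12 (.read 22 (var 3) (var 40)) (var 43))))
    .skip

/-- Adds the shortest paths between terminals and their parents to the graph in array 30. -/
def markPaths : Program :=
  .forNodes 40 <|
    .cond (isTerminal (var 40))
      (.seq (.assign 43 (.lit 0) (.lit 0) (var 40)) (.forNodes 41 markStep))
      .skip

/-- Writes the output tree: the nodes that the root reaches, and their predecessors. With truncated
subtraction, `1 - (1 - x)` is the indicator of `x ≠ 0`. -/
def writeTree : Program :=
  .forNodes 40 <|
    .seq (.assign 4 (var 40) (.lit 0)
        (.sub (.lit 1) (.sub (.lit 1) (.sub (var 6) (.read 31 (var 3) (var 40))))))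
      (.assign 5 (var 40) (.lit 0) (.read 32 (var 3) (var 40)))

/-- An implementation of the algorithm. -/
def treeProgram : Program :=
  .seq computeInfinity <| .seq loadGraph <| .seq (shortestPaths 9) <| .seq (clearGraph 20) <|
  .seq kruskal <| .seq addShortcuts <| .seq (shortestPaths 19) <| .seq (clearGraph 30) <|
  .seq markPaths <| .seq (shortestPaths 29) writeTree

lemma mods_shortestPaths (b a : ℕ) (h : a < b + 2 ∨ b + 6 < a) : a ∉ (shortestPaths b).mods := by
  simp [shortestPaths, initDistances, relaxThrough, findParents, Program.mods]
  omega

lemma exec_shortestPaths_of_ne {b : ℕ} (a : ℕ) (h : a < b + 2 ∨ b + 6 < a) (m : Mem) :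
    (shortestPaths b).exec m a = m a :=
  Program.exec_of_notMem_mods (mods_shortestPaths b a h) m

lemma loopsOverNodes_treeProgram : treeProgram.LoopsOverNodes := by
  simp [treeProgram, computeInfinity, loadGraph, shortestPaths, initDistances, relaxThrough,
    findParents, clearGraph, kruskal, considerEdge, setEdge, addShortcuts, considerShortcut,
    markPaths, markStep, writeTree, Program.LoopsOverNodes]

lemma zero_notMem_mods_treeProgram : 0 ∉ treeProgram.mods := by
  simp [treeProgram, computeInfinity, loadGraph, shortestPaths, initDistances, relaxThrough,
    findParents, clearGraph, kruskal, considerEdge, setEdge, addShortcuts, considerShortcut,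
    markPaths, markStep, writeTree, Program.mods]

/-! ### Graphs in memory -/

section Memory

variable {V : Type u} {n : ℕ}

open Classical in
/-- Edges of `Γ` have the lengths `ω`, other pairs of nodes have the length `I`. -/
noncomputable def weightMatrix (Γ : SimpleGraph V) (ω : V → V → ℕ) (I : ℕ) (x y : V) : ℕ :=
  if Γ.Adj x y then ω x y else I

lemma encodesGraph_weightMatrix {Γ : SimpleGraph V} {I : ℕ} (hI : 0 < I) :
    EncodesGraph id Γ (fun _ => 1) I (weightMatrix Γ (fun _ _ => 1) I) where
  injective := Function.injective_id
  pos x y := by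
    unfold weightMatrix
    split_ifs
    · exact one_pos
    · exact hI
  adj a b hab := by
    simp [weightMatrix, hab]
  exists_adj x b h := by
    refine ⟨x, rfl, ?_⟩
    by_contra hab
    simp only [weightMatrix, id, if_neg hab] at h
    exact lt_irrefl _ h

/-- The memory after adding an edge to a graph. -/
lemma write_weightMatrix (ν : V ≃ Fin n) {m : Mem} {a : ℕ} {Γ : SimpleGraph V} {ω : V → V → ℕ}
    (hω : ∀ x y, ω x y = ω y x) {I : ℕ}
    (hm : ∀ x y, m a (ν x) (ν y) = weightMatrix Γ ω I x y) {x y : V} (hxy : x ≠ y) (u v : V) :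
    ((m.write a (ν x) (ν y) (ω x y)).write a (ν y) (ν x) (ω x y)) a (ν u) (ν v) =
      weightMatrix (Γ ⊔ SimpleGraph.edge x y) ω I u v := by
  have h : ∀ c d e f : V, ((ν c : ℕ) = ν d ∧ (ν e : ℕ) = ν f) ↔ (c = d ∧ e = f) := by
    intro c d e f
    rw [Fin.val_inj, Fin.val_inj, ν.apply_eq_iff_eq, ν.apply_eq_iff_eq]
  have hedge : (SimpleGraph.edge x y).Adj u v ↔ u = x ∧ v = y ∨ u = y ∧ v = x := by
    rw [SimpleGraph.edge_adj, and_iff_left_of_imp]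
    rintro (⟨rfl, rfl⟩ | ⟨rfl, rfl⟩)
    · exact hxy
    · exact hxy.symm
  rw [Mem.write_apply, Mem.write_apply, hm, weightMatrix, weightMatrix]
  by_cases h1 : u = y ∧ v = x
  · rw [if_pos ((h ..).2 h1), if_pos (SimpleGraph.sup_adj .. |>.2 (Or.inr (hedge.2 (Or.inr h1)))),
      h1.1, h1.2, hω]
  · by_cases h2 : u = x ∧ v = y
    · rw [if_neg ((h ..).not.2 h1), if_pos ((h ..).2 h2),
        if_pos (SimpleGraph.sup_adj .. |>.2 (Or.inr (hedge.2 (Or.inl h2)))), h2.1, h2.2]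
    · rw [if_neg ((h ..).not.2 h1), if_neg ((h ..).not.2 h2)]
      have : (Γ ⊔ SimpleGraph.edge x y).Adj u v ↔ Γ.Adj u v := by
        rw [SimpleGraph.sup_adj, hedge]
        tauto
      by_cases h3 : Γ.Adj u v
      · rw [if_pos h3, if_pos (this.2 h3)]
      · rw [if_neg h3, if_neg (this.not.2 h3)]

lemma exec_clearGraph (ν : V ≃ Fin n) {a : ℕ} (ha : a ≠ 0) (ha6 : a ≠ 6) (h40 : a ≠ 40)
    (h41 : a ≠ 41) {m : Mem} (hn : m 0 0 0 = n) (ω : V → V → ℕ) (x y : V) :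
    (clearGraph a).exec m a (ν x) (ν y) = weightMatrix ⊥ ω (m 6 0 0) x y := by
  have := Program.exec_fill (i := 40) (j := 41) (a := a)
    (c := .assign a (var 40) (var 41) (var 6)) hn (by simp [Program.mods, ha.symm]) (by simp) h40
    h41 (by simp [Program.mods, h40.symm]) (fun _ _ y => y = m 6 0 0) ?_ (ν x) (ν x).2 (ν y) (ν y).2
  · rw [weightMatrix, if_neg (by simp)]
    exact this
  · intro x hx z hz m' hframe hi hj _
    have h6 : m' 6 = m 6 := hframe _ (by simp [Program.mods, ha6.symm])
    simp only [Program.exec, value_var, hi, hj, h6]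
    refine ⟨Mem.write_self .., fun x' z' h => ?_⟩
    rw [Mem.write_apply, if_neg h]

/-- The memory holds the input, the length of missing edges and the shortest paths of `G`. This
stays true from the end of the preparation to the end of the run. -/
structure Ready (ν : V ≃ Fin n) (G : SimpleGraph V) (U : Finset V) (r : V) (p : V → V → V)
    (m : Mem) : Prop where
  num : m 0 0 0 = n
  source : ∀ x, m 2 (ν x) 0 ≠ 0 ↔ x ∈ U
  root : m 3 0 0 = ν r
  infinity : m 6 0 0 = n * n
  dist : ∀ x y, m 11 (ν x) (ν y) = G.dist x y
  parent : ∀ x y, m 12 (ν x) (ν y) = ν (p x y)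

namespace Ready

variable {ν : V ≃ Fin n} {G : SimpleGraph V} {U : Finset V} {r : V} {p : V → V → V} {m : Mem}

lemma congr (h : Ready ν G U r p m) {m' : Mem} (h0 : m' 0 = m 0) (h2 : m' 2 = m 2)
    (h3 : m' 3 = m 3) (h6 : m' 6 = m 6) (h11 : m' 11 = m 11) (h12 : m' 12 = m 12) :
    Ready ν G U r p m' :=
  ⟨h0 ▸ h.num, h2 ▸ h.source, h3 ▸ h.root, h6 ▸ h.infinity, h11 ▸ h.dist, h12 ▸ h.parent⟩

lemma congr_of_mods (h : Ready ν G U r p m) {m' : Mem} {l : List ℕ} (hm' : ∀ a ∉ l, m' a = m a)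
    (hl : ∀ a ∈ [0, 2, 3, 6, 11, 12], a ∉ l) : Ready ν G U r p m' :=
  h.congr (hm' _ (hl _ (by simp))) (hm' _ (hl _ (by simp))) (hm' _ (hl _ (by simp)))
    (hm' _ (hl _ (by simp))) (hm' _ (hl _ (by simp))) (hm' _ (hl _ (by simp)))

end Ready

end Memory

section Terminals

variable {V : Type u} [DecidableEq V] {n : ℕ} {G : SimpleGraph V} {U : Finset V} {r : V}

/-- The root as a terminal. -/
abbrev rootTerminal (U : Finset V) (r : V) : Terminal U r := ⟨r, Finset.mem_insert_self r U⟩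

/-- A graph on the terminals as a graph on all nodes. -/
def embed (H : SimpleGraph (Terminal U r)) : SimpleGraph V := H.map Subtype.val

lemma embed_adj {H : SimpleGraph (Terminal U r)} {x y : V} :
    (embed H).Adj x y ↔ ∃ a b : Terminal U r, H.Adj a b ∧ a.1 = x ∧ b.1 = y :=
  SimpleGraph.map_adj (Function.Embedding.subtype _) H x y

lemma embed_sup_edge (H : SimpleGraph (Terminal U r)) (a b : Terminal U r) :
    embed (H ⊔ SimpleGraph.edge a b) = embed H ⊔ SimpleGraph.edge a.1 b.1 := by
  ext x y
  simp only [embed_adj, SimpleGraph.sup_adj, SimpleGraph.edge_adj]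
  constructor
  · rintro ⟨c, d, h | ⟨h, hne⟩, rfl, rfl⟩
    · exact Or.inl ⟨c, d, h, rfl, rfl⟩
    · refine Or.inr ⟨?_, fun h' => hne (Subtype.ext h')⟩
      rcases h with ⟨rfl, rfl⟩ | ⟨rfl, rfl⟩
      · exact Or.inl ⟨rfl, rfl⟩
      · exact Or.inr ⟨rfl, rfl⟩
  · rintro (⟨c, d, h, rfl, rfl⟩ | ⟨⟨rfl, rfl⟩ | ⟨rfl, rfl⟩, hne⟩)
    · exact ⟨c, d, Or.inl h, rfl, rfl⟩
    · exact ⟨a, b, Or.inr ⟨Or.inl ⟨rfl, rfl⟩, fun h => hne (congrArg _ h)⟩, rfl, rfl⟩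
    · exact ⟨b, a, Or.inr ⟨Or.inr ⟨rfl, rfl⟩, fun h => hne (congrArg _ h)⟩, rfl, rfl⟩

lemma encodesGraph_embed (hG : G.Connected) {H : SimpleGraph (Terminal U r)} {I : ℕ} (hI : 0 < I) :
    EncodesGraph Subtype.val H (hopLength G U r) I (weightMatrix (embed H) G.dist I) where
  injective := Subtype.val_injective
  pos x y := by
    unfold weightMatrix
    split_ifs with h
    · exact hG.pos_dist_of_ne h.ne
    · exact hI
  adj a b hab := by
    have : (embed H).Adj a.1 b.1 := embed_adj.2 ⟨a, b, hab, rfl, rfl⟩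
    simp [weightMatrix, this, hopLength_mk]
  exists_adj x b h := by
    by_contra hab
    have : ¬(embed H).Adj x b.1 := by
      rintro h'
      obtain ⟨a, c, hac, rfl, hc⟩ := embed_adj.1 h'
      obtain rfl := Subtype.ext hc
      exact hab ⟨a, rfl, hac⟩
    simp only [weightMatrix, if_neg this] at h
    exact lt_irrefl _ h

namespace Ready

variable {ν : V ≃ Fin n} {p : V → V → V} {m : Mem}

lemma isTerminal_iff (h : Ready ν G U r p m) {e : Expr} {x : V} (he : e.value m = ν x) :
    (isTerminal e).value m ≠ 0 ↔ x ∈ insert r U := by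
  have h1 : (neq e (var 3)).value m = 0 ↔ x = r := by
    rw [value_neq_eq_zero, he, value_var, h.root, Fin.val_inj, ν.apply_eq_iff_eq]
  have h2 := h.source x
  rw [Finset.mem_insert, ← h1, ← h2]
  simp only [isTerminal, Expr.value, he]
  omega

/-- Shortest paths in a graph on the terminals that array 20 holds. -/
lemma exists_shortestPaths (h : Ready ν G U r p m) (hG : G.Connected)
    {H : SimpleGraph (Terminal U r)}
    (hH : ∀ x y, m 20 (ν x) (ν y) = weightMatrix (embed H) G.dist (n * n) x y) :
    ∃ q : V → V → V,
      (∀ x y, (shortestPaths 19).exec m 22 (ν x) (ν y) = ν (q x y)) ∧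
      ShortestPaths (weightMatrix (embed H) G.dist (n * n))
        (fun x y => (shortestPaths 19).exec m 21 (ν x) (ν y)) q := by
  have hn : 0 < n * n := by
    have := (ν r).pos
    positivity
  obtain ⟨q, h1, h2⟩ := exec_shortestPaths ν (b := 19) h.num (fun x y => by
    rw [hH]
    exact (encodesGraph_embed hG hn).pos x y)
  refine ⟨q, h1, ?_⟩
  have : (fun x y : V => m (19 + 1) (ν x) (ν y)) = weightMatrix (embed H) G.dist (n * n) := by
    funext x y
    exact hH x y
  rw [this] at h2
  exact h2

end Ready

end Terminals

/-! ### Correctness of the spanning tree phase -/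

lemma dist_lt_of_equiv {V : Type u} {n : ℕ} (ν : V ≃ Fin n) {Γ : SimpleGraph V} {x y : V}
    (h : Γ.Reachable x y) : Γ.dist x y < n := by
  have : Fintype V := Fintype.ofEquiv (Fin n) ν.symm
  have := dist_lt_card h
  rwa [Fintype.card_congr ν, Fintype.card_fin] at this

section Kruskal

variable {V : Type u} [DecidableEq V] {n : ℕ} {G : SimpleGraph V} {U : Finset V} {r : V}
  {ν : V ≃ Fin n} {p : V → V → V} {m : Mem}

/-- The length `n * n` of missing edges exceeds the distances between connected terminals. -/
lemma lt_mul_self_of_reachable (ν : V ≃ Fin n) (hG : G.Connected) {H : SimpleGraph (Terminal U r)}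
    {D : V → V → ℕ} {q : V → V → V}
    (hS : ShortestPaths (weightMatrix (embed H) G.dist (n * n)) D q) {a b : Terminal U r}
    (hab : H.Reachable a b) : D a.1 b.1 < n * n := by
  have : Fintype V := Fintype.ofEquiv (Fin n) ν.symm
  have hcard : Fintype.card V = n := by rw [Fintype.card_congr ν, Fintype.card_fin]
  have hn : 0 < n := (ν r).pos
  rw [← hcard] at hS hn ⊢
  refine hS.lt_sq_of_reachable (encodesGraph_embed hG (Nat.mul_pos hn hn)) ?_ hab
  intro e
  induction e with
  | _ x y =>
    rw [hopLength_mk]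
    exact_mod_cast (dist_lt_card (hG x.1 y.1)).le

/-- Before the pair `(x, y)` is considered, all pairs of smaller length are connected, which is what
the exchange argument needs. -/
lemma exec_considerEdge (hG : G.Connected) (hR : Ready ν G U r p m)
    {F : SimpleGraph (Terminal U r)}
    (hF : ∀ u v, m 20 (ν u) (ν v) = weightMatrix (embed F) G.dist (n * n) u v)
    (hext : IsExtendable (hopLength G U r) F) {x y : V} {ℓ : ℕ} (h40 : m 40 0 0 = ℓ)
    (h41 : m 41 0 0 = ν x) (h42 : m 42 0 0 = ν y)
    (hlt : ∀ a b : Terminal U r, G.dist a.1 b.1 < ℓ → F.Reachable a b) :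
    ∃ F' : SimpleGraph (Terminal U r), F ≤ F' ∧
      (∀ u v, considerEdge.exec m 20 (ν u) (ν v) = weightMatrix (embed F') G.dist (n * n) u v) ∧
      IsExtendable (hopLength G U r) F' ∧
      ∀ a b : Terminal U r, a.1 = x → b.1 = y → G.dist x y = ℓ → F'.Reachable a b := by
  by_cases hx : x ∈ insert r U
  swap
  · have hb : ¬(isTerminal (var 41)).value m ≠ 0 := by rwa [hR.isTerminal_iff (e := var 41) h41]
    refine ⟨F, le_rfl, ?_, hext, fun a _ ha => absurd (ha ▸ a.2) hx⟩
    rw [considerEdge, Program.exec, if_neg hb]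
    exact hF
  have hbx : (isTerminal (var 41)).value m ≠ 0 := (hR.isTerminal_iff (e := var 41) h41).2 hx
  by_cases hy : y ∈ insert r U
  swap
  · have hb : ¬(isTerminal (var 42)).value m ≠ 0 := by rwa [hR.isTerminal_iff (e := var 42) h42]
    refine ⟨F, le_rfl, ?_, hext, fun _ b _ hb' => absurd (hb' ▸ b.2) hy⟩
    rw [considerEdge, Program.exec, if_pos hbx, Program.exec, if_neg hb]
    exact hF
  have hby : (isTerminal (var 42)).value m ≠ 0 := (hR.isTerminal_iff (e := var 42) h42).2 hy
  have hneq : (neq (.read 11 (var 41) (var 42)) (var 40)).value m = 0 ↔ G.dist x y = ℓ := by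
    rw [value_neq_eq_zero]
    simp only [Expr.value, value_var, h40, h41, h42, hR.dist]
  by_cases hd : G.dist x y = ℓ
  swap
  · have hb : (neq (.read 11 (var 41) (var 42)) (var 40)).value m ≠ 0 := hneq.not.2 hd
    refine ⟨F, le_rfl, ?_, hext, fun _ _ _ _ hd' => absurd hd' hd⟩
    rw [considerEdge, Program.exec, if_pos hbx, Program.exec, if_pos hby, Program.exec, if_pos hb]
    exact hF
  have hbd : ¬(neq (.read 11 (var 41) (var 42)) (var 40)).value m ≠ 0 := not_not.2 (hneq.2 hd)
  obtain ⟨q, _, hS⟩ := hR.exists_shortestPaths hG hF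
  have hexec : considerEdge.exec m = (Program.cond (.sub (var 6) (.read 21 (var 41) (var 42))) .skip
      (setEdge 20 (var 41) (var 42) (var 40))).exec ((shortestPaths 19).exec m) := by
    rw [considerEdge, Program.exec, if_pos hbx, Program.exec, if_pos hby, Program.exec, if_neg hbd,
      Program.exec]
  rw [hexec]
  set m1 := (shortestPaths 19).exec m with hm1
  have e : ∀ a, (a < 21 ∨ 25 < a) → m1 a = m a := fun a ha => exec_shortestPaths_of_ne a ha m
  have hval : (Expr.sub (var 6) (.read 21 (var 41) (var 42))).value m1 ≠ 0 ↔
      m1 21 (ν x) (ν y) < n * n := by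
    simp only [Expr.value, value_var, e 6 (by omega), e 41 (by omega), e 42 (by omega), h41, h42,
      hR.infinity]
    omega
  let a : Terminal U r := ⟨x, hx⟩
  let b : Terminal U r := ⟨y, hy⟩
  have hn : 0 < n := (ν r).pos
  have hE := encodesGraph_embed (H := F) hG (Nat.mul_pos hn hn)
  have hab' : ∀ a' b' : Terminal U r, a'.1 = x → b'.1 = y → a' = a ∧ b' = b :=
    fun a' b' h1 h2 => ⟨Subtype.ext h1, Subtype.ext h2⟩
  rw [Program.exec]
  by_cases hlt' : m1 21 (ν x) (ν y) < n * n
  · rw [if_pos (hval.2 hlt')]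
    obtain ⟨w, _⟩ := hS.exists_walk (a := a) (b := b) hE hlt'
    refine ⟨F, le_rfl, ?_, hext, fun a' b' h1 h2 _ => ?_⟩
    · rw [Program.exec, e 20 (by omega)]
      exact hF
    · obtain ⟨rfl, rfl⟩ := hab' a' b' h1 h2
      exact w.reachable
  · rw [if_neg (hval.not.2 hlt')]
    have hnr : ¬F.Reachable a b := fun h => hlt' (lt_mul_self_of_reachable ν hG hS h)
    have hxy : x ≠ y := by
      rintro rfl
      exact hnr (SimpleGraph.Reachable.refl a)
    refine ⟨F ⊔ SimpleGraph.edge a b, le_sup_left, ?_, ?_, fun a' b' h1 h2 _ => ?_⟩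
    · intro u v
      rw [embed_sup_edge]
      have := write_weightMatrix ν (m := m1) (a := 20) (fun x y => SimpleGraph.dist_comm)
        (fun u v => by rw [e 20 (by omega)]; exact hF u v) hxy u v
      rw [hd] at this
      rw [← this, setEdge]
      have w : ∀ i j z c, c ≠ 20 → m1.write 20 i j z c = m1 c := fun i j z c hc =>
        Mem.write_of_ne _ _ _ _ hc
      simp only [Program.exec, value_var, w _ _ _ 40 (by omega), w _ _ _ 41 (by omega),
        w _ _ _ 42 (by omega), e 40 (by omega), e 41 (by omega), e 42 (by omega), h40, h41, h42]
    · refine hext.sup_edge hopLength_nonneg hnr fun c d hcd => hlt c d ?_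
      rw [hopLength_mk, hopLength_mk, Nat.cast_lt] at hcd
      exact hd ▸ hcd
    · obtain ⟨rfl, rfl⟩ := hab' a' b' h1 h2
      exact SimpleGraph.Adj.reachable (Or.inr ((SimpleGraph.edge_adj ..).2
        ⟨Or.inl ⟨rfl, rfl⟩, fun h => hxy (congrArg Subtype.val h)⟩))

/-- Kruskal's algorithm computes a connected graph that is at most as long as any other. -/
lemma exec_kruskal (hG : G.Connected) (hR : Ready ν G U r p m)
    (h20 : ∀ u v, m 20 (ν u) (ν v) =
      weightMatrix (embed (⊥ : SimpleGraph (Terminal U r))) G.dist (n * n) u v) :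
    ∃ F : SimpleGraph (Terminal U r), F.Connected ∧ IsExtendable (hopLength G U r) F ∧
      ∀ u v, kruskal.exec m 20 (ν u) (ν v) = weightMatrix (embed F) G.dist (n * n) u v := by
  let Q : (Terminal U r → Terminal U r → Prop) → Mem → Prop := fun done m' =>
    Ready ν G U r p m' ∧ ∃ F : SimpleGraph (Terminal U r),
      (∀ u v, m' 20 (ν u) (ν v) = weightMatrix (embed F) G.dist (n * n) u v) ∧
      IsExtendable (hopLength G U r) F ∧ ∀ a b, done a b → F.Reachable a b
  have hmods : ∀ l, l = (Program.forNodes 40 <| .forNodes 41 <| .forNodes 42 considerEdge).mods ∨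
      l = (Program.forNodes 41 <| .forNodes 42 considerEdge).mods ∨
      l = (Program.forNodes 42 considerEdge).mods ∨ l = considerEdge.mods →
      ∀ a ∈ [0, 2, 3, 6, 11, 12], a ∉ l := by
    rintro l (rfl | rfl | rfl | rfl) <;>
    simp [considerEdge, shortestPaths, initDistances, relaxThrough, findParents, setEdge,
      Program.mods]
  have hQ : ∀ {d d' : Terminal U r → Terminal U r → Prop} {m' : Mem}, (∀ a b, d' a b → d a b) →
      Q d m' → Q d' m' := fun hd ⟨h1, F, h2, h3, h4⟩ =>
    ⟨h1, F, h2, h3, fun a b h => h4 a b (hd a b h)⟩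
  have hQw : ∀ {d : Terminal U r → Terminal U r → Prop} {m' : Mem} {c k : ℕ},
      c ∉ [0, 2, 3, 6, 11, 12, 20] → Q d m' → Q d (m'.write c 0 0 k) := by
    intro d m' c k hc ⟨h1, F, h2, h3⟩
    have w : ∀ a ∈ [0, 2, 3, 6, 11, 12, 20], m'.write c 0 0 k a = m' a := fun a ha =>
      Mem.write_of_ne _ _ _ _ fun h => hc (h ▸ ha)
    refine ⟨h1.congr (w _ (by simp)) (w _ (by simp)) (w _ (by simp)) (w _ (by simp)) (w _ (by simp))
      (w _ (by simp)), F, ?_, h3⟩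
    rw [w _ (by simp)]
    exact h2
  have key := Program.exec_forNodes_induct (x := 40)
    (c := .forNodes 41 <| .forNodes 42 considerEdge) hR.num
    (fun ℓ m' => Q (fun a b => G.dist a.1 b.1 < ℓ) m') ?_ ?_
  · obtain ⟨_, F, hF, hext, hreach⟩ := key
    refine ⟨F, ?_, hext, hF⟩
    rw [SimpleGraph.connected_iff_exists_forall_reachable]
    exact ⟨rootTerminal U r, fun a => hreach _ _ (dist_lt_of_equiv ν (hG _ _))⟩
  · exact ⟨hR, ⊥, h20, isExtendable_bot, fun a b h => absurd h (Nat.not_lt_zero _)⟩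
  intro ℓ _ m' _ hm'
  have hm1 := hQw (c := 40) (k := ℓ) (by simp) hm'
  set m1 := m'.write 40 0 0 ℓ with hm1def
  have key2 := Program.exec_forNodes_induct (x := 41) (c := .forNodes 42 considerEdge) hm1.1.num
    (fun i m' => Q (fun a b => G.dist a.1 b.1 < ℓ ∨ G.dist a.1 b.1 = ℓ ∧ (ν a.1 : ℕ) < i) m') ?_ ?_
  · refine hQ (fun a b h => ?_) key2
    rcases Nat.lt_succ_iff_lt_or_eq.1 h with h | h
    · exact Or.inl h
    · exact Or.inr ⟨h, (ν a.1).2⟩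
  · exact hQ (fun a b h => h.resolve_right fun h => absurd h.2 (Nat.not_lt_zero _)) hm1
  intro i hi m2 hframe2 hm2
  have hm3 := hQw (c := 41) (k := i) (by simp) hm2
  have h40 : m2.write 41 0 0 i 40 0 0 = ℓ := by
    rw [Mem.write_of_ne _ _ _ _ (by omega), hframe2 40, hm1def, Mem.write_self]
    simp [considerEdge, shortestPaths, initDistances, relaxThrough, findParents, setEdge,
      Program.mods]
  have h41 : m2.write 41 0 0 i 41 0 0 = i := Mem.write_self ..
  set m3 := m2.write 41 0 0 i
  have key3 := Program.exec_forNodes_induct (x := 42) (c := considerEdge) hm3.1.num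
    (fun j m' => Q (fun a b => G.dist a.1 b.1 < ℓ ∨ G.dist a.1 b.1 = ℓ ∧
      ((ν a.1 : ℕ) < i ∨ (ν a.1 : ℕ) = i ∧ (ν b.1 : ℕ) < j)) m') ?_ ?_
  · refine hQ (fun a b h => h.imp_right fun h => ⟨h.1, ?_⟩) key3
    rcases Nat.lt_succ_iff_lt_or_eq.1 h.2 with h | h
    · exact Or.inl h
    · exact Or.inr ⟨h, (ν b.1).2⟩
  · exact hQ (fun a b h => h.imp_right fun h => ⟨h.1, h.2.resolve_right fun h =>
      absurd h.2 (Nat.not_lt_zero _)⟩) hm3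
  intro j hj m4 hframe4 hm4
  obtain ⟨hR5, F, hF, hext, hreach⟩ := hQw (c := 42) (k := j) (by simp) hm4
  have g40 : m4.write 42 0 0 j 40 0 0 = ℓ := by
    rw [Mem.write_of_ne _ _ _ _ (by omega), hframe4 40, h40]
    simp [considerEdge, shortestPaths, initDistances, relaxThrough, findParents, setEdge,
      Program.mods]
  have g41 : m4.write 42 0 0 j 41 0 0 = i := by
    rw [Mem.write_of_ne _ _ _ _ (by omega), hframe4 41, h41]
    simp [considerEdge, shortestPaths, initDistances, relaxThrough, findParents, setEdge,
      Program.mods]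
  obtain ⟨F', hFF', h1, h2, h3⟩ := exec_considerEdge hG hR5 hF hext (x := ν.symm ⟨i, hi⟩)
    (y := ν.symm ⟨j, hj⟩) g40 (by rw [g41, ν.apply_symm_apply])
    (by rw [Mem.write_self, ν.apply_symm_apply]) (fun a b h => hreach a b (Or.inl h))
  refine ⟨hR5.congr_of_mods (l := considerEdge.mods)
    (fun a ha => Program.exec_of_notMem_mods ha _) (hmods _ (by simp)), F', h1, h2, ?_⟩
  intro a b hab
  by_cases hij : (ν a.1 : ℕ) = i ∧ (ν b.1 : ℕ) = j
  · have ha : a.1 = ν.symm ⟨i, hi⟩ := by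
      rw [Equiv.eq_symm_apply]
      exact Fin.ext hij.1
    have hb : b.1 = ν.symm ⟨j, hj⟩ := by
      rw [Equiv.eq_symm_apply]
      exact Fin.ext hij.2
    rcases hab with hab | ⟨hab, _⟩
    · exact (hreach a b (Or.inl hab)).mono hFF'
    · exact h3 a b ha hb (by rw [← ha, ← hb]; exact hab)
  · refine (hreach a b (hab.imp_right fun h => ⟨h.1, ?_⟩)).mono hFF'
    omega

end Kruskal

/-! ### Correctness of the shortcut phase -/

section Shortcuts

variable {V : Type u} [DecidableEq V] {n : ℕ} {G : SimpleGraph V} {U : Finset V} {r : V}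
  {ν : V ≃ Fin n} {p : V → V → V} {m : Mem}

/-- `H` arises from `F` by joining the nodes of `S` to the root, where the members of `S` and the
root are far apart in `F`. -/
structure IsShortcutGraph (G : SimpleGraph V) (F H : SimpleGraph (Terminal U r))
    (S : Finset (Terminal U r)) : Prop where
  le : F ≤ H
  weight : totalWeight (hopLength G U r) H ≤
    totalWeight (hopLength G U r) F + ∑ v ∈ S, (G.dist r v.1 : ℝ)
  adj : ∀ u ∈ S, H.Adj (rootTerminal U r) u
  far : ∀ u, (u = rootTerminal U r ∨ u ∈ S) → ∀ v, (v = rootTerminal U r ∨ v ∈ S) → u ≠ v →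
    ∀ q : F.Walk u v, (G.dist r u.1 + G.dist r v.1 : ℝ) ≤ walkLength (hopLength G U r) q

/-- A shortcut to a node `v` that is not closer to the root than the earlier ones. An earlier
shortcut to `u` and a path from `u` to `v` in `F` together have more than three times the length of
the new shortcut, of which the path is left with at least the lengths of both shortcuts. -/
lemma IsShortcutGraph.sup_edge {F H : SimpleGraph (Terminal U r)} {S : Finset (Terminal U r)}
    (h : IsShortcutGraph G F H S) {v : Terminal U r} (hv : v ≠ rootTerminal U r)
    (hS : ∀ u ∈ S, G.dist r u.1 ≤ G.dist r v.1)
    (hfar : ∀ q : H.Walk (rootTerminal U r) v,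
      3 * (G.dist r v.1 : ℝ) < walkLength (hopLength G U r) q) :
    IsShortcutGraph G F (H ⊔ SimpleGraph.edge (rootTerminal U r) v) (insert v S) := by
  have hnon := hopLength_nonneg (G := G) (U := U) (r := r)
  have hvS : v ∉ S := by
    intro hvS
    have := hfar (.cons (h.adj v hvS) .nil)
    rw [walkLength_cons, walkLength_nil, hopLength_mk] at this
    linarith [show (0 : ℝ) ≤ G.dist r v.1 from Nat.cast_nonneg _]
  have hmono : ∀ {a b} (q : F.Walk a b), walkLength (hopLength G U r) (q.mapLe h.le) =
      walkLength (hopLength G U r) q := fun q => by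
    rw [walkLength, SimpleGraph.Walk.edges_mapLe_eq_edges, walkLength]
  have key : ∀ u, (u = rootTerminal U r ∨ u ∈ S) → ∀ q : F.Walk u v,
      (G.dist r u.1 + G.dist r v.1 : ℝ) ≤ walkLength (hopLength G U r) q := by
    rintro u (rfl | hu) q
    · have := hfar (q.mapLe h.le)
      rw [hmono] at this
      rw [SimpleGraph.dist_self, Nat.cast_zero]
      linarith [show (0 : ℝ) ≤ G.dist r v.1 from Nat.cast_nonneg _]
    · have h1 := hfar (.cons (h.adj u hu) (q.mapLe h.le))
      rw [walkLength_cons, hmono, hopLength_mk] at h1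
      have h2 : (G.dist r u.1 : ℝ) ≤ G.dist r v.1 := Nat.cast_le.2 (hS u hu)
      linarith
  refine ⟨h.le.trans le_sup_left, ?_, ?_, ?_⟩
  · rw [Finset.sum_insert hvS]
    have h1 := totalWeight_sup_edge_le hnon H (rootTerminal U r) v
    have h2 := h.weight
    rw [hopLength_mk] at h1
    linarith
  · intro u hu
    rcases Finset.mem_insert.1 hu with rfl | hu
    · exact Or.inr ((SimpleGraph.edge_adj ..).2 ⟨Or.inl ⟨rfl, rfl⟩, hv.symm⟩)
    · exact Or.inl (h.adj u hu)
  · have split : ∀ u, (u = rootTerminal U r ∨ u ∈ insert v S) →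
        u = v ∨ (u = rootTerminal U r ∨ u ∈ S) := by
      rintro u (hu | hu)
      · exact Or.inr (Or.inl hu)
      · rcases Finset.mem_insert.1 hu with hu | hu
        · exact Or.inl hu
        · exact Or.inr (Or.inr hu)
    intro u hu u' hu' hne q
    rcases split u hu with rfl | hu₁
    · rcases split u' hu' with rfl | hu₂
      · exact absurd rfl hne
      · rw [add_comm, ← walkLength_reverse]
        exact key u' hu₂ q.reverse
    · rcases split u' hu' with rfl | hu₂
      · exact key u hu₁ q
      · exact h.far u hu₁ u' hu₂ hne q

/-- The nodes that have a shortcut are at most as far from the root as the node considered, which is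
what `IsShortcutGraph.sup_edge` needs. -/
lemma exec_considerShortcut (hG : G.Connected) (hR : Ready ν G U r p m)
    {F H : SimpleGraph (Terminal U r)} {S : Finset (Terminal U r)} (hF : F.Connected)
    (hH : ∀ u v, m 20 (ν u) (ν v) = weightMatrix (embed H) G.dist (n * n) u v)
    (hS : IsShortcutGraph G F H S) {v : V} {ℓ : ℕ} (h40 : m 40 0 0 = ℓ) (h41 : m 41 0 0 = ν v)
    (hle : ∀ u ∈ S, G.dist r u.1 ≤ ℓ) :
    ∃ (H' : SimpleGraph (Terminal U r)) (S' : Finset (Terminal U r)), H ≤ H' ∧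
      (∀ u v, considerShortcut.exec m 20 (ν u) (ν v) =
        weightMatrix (embed H') G.dist (n * n) u v) ∧
      IsShortcutGraph G F H' S' ∧ (∀ u ∈ S', G.dist r u.1 ≤ ℓ) ∧
      ∀ a : Terminal U r, a.1 = v → G.dist r v = ℓ →
        ∃ q : H'.Walk (rootTerminal U r) a, walkLength (hopLength G U r) q ≤ 3 * ℓ := by
  by_cases hv : v ∈ insert r U
  swap
  · have hb : ¬(isTerminal (var 41)).value m ≠ 0 := by rwa [hR.isTerminal_iff (e := var 41) h41]
    refine ⟨H, S, le_rfl, ?_, hS, hle, fun a ha => absurd (ha ▸ a.2) hv⟩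
    rw [considerShortcut, Program.exec, if_neg hb]
    exact hH
  have hbv : (isTerminal (var 41)).value m ≠ 0 := (hR.isTerminal_iff (e := var 41) h41).2 hv
  have hneq : (neq (.read 11 (var 3) (var 41)) (var 40)).value m = 0 ↔ G.dist r v = ℓ := by
    rw [value_neq_eq_zero]
    simp only [Expr.value, value_var, h40, h41, hR.root, hR.dist]
  by_cases hd : G.dist r v = ℓ
  swap
  · have hb : (neq (.read 11 (var 3) (var 41)) (var 40)).value m ≠ 0 := hneq.not.2 hd
    refine ⟨H, S, le_rfl, ?_, hS, hle, fun _ _ hd' => absurd hd' hd⟩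
    rw [considerShortcut, Program.exec, if_pos hbv, Program.exec, if_pos hb]
    exact hH
  have hbd : ¬(neq (.read 11 (var 3) (var 41)) (var 40)).value m ≠ 0 := not_not.2 (hneq.2 hd)
  obtain ⟨q, _, hSP⟩ := hR.exists_shortestPaths hG hH
  have hexec : considerShortcut.exec m = (Program.cond
      (.sub (.read 21 (var 3) (var 41)) (.add (var 40) (.add (var 40) (var 40))))
      (setEdge 20 (var 3) (var 41) (var 40)) .skip).exec ((shortestPaths 19).exec m) := by
    rw [considerShortcut, Program.exec, if_pos hbv, Program.exec, if_neg hbd, Program.exec]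
  rw [hexec]
  set m1 := (shortestPaths 19).exec m with hm1
  have e : ∀ a, (a < 21 ∨ 25 < a) → m1 a = m a := fun a ha => exec_shortestPaths_of_ne a ha m
  have hval : (Expr.sub (.read 21 (var 3) (var 41))
      (.add (var 40) (.add (var 40) (var 40)))).value m1 ≠ 0 ↔ 3 * ℓ < m1 21 (ν r) (ν v) := by
    simp only [Expr.value, value_var, e 3 (by omega), e 40 (by omega), e 41 (by omega), h40, h41,
      hR.root]
    omega
  let b : Terminal U r := ⟨v, hv⟩
  have hn : 0 < n := (ν r).pos
  have hE := encodesGraph_embed (H := H) hG (Nat.mul_pos hn hn)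
  rw [Program.exec]
  by_cases hlt : 3 * ℓ < m1 21 (ν r) (ν v)
  · rw [if_pos (hval.2 hlt)]
    have hvr : v ≠ r := by
      rintro rfl
      have : m1 21 (ν v) (ν v) = 0 := hSP.self v
      omega
    have hbr : b ≠ rootTerminal U r := fun h => hvr (congrArg Subtype.val h)
    refine ⟨H ⊔ SimpleGraph.edge (rootTerminal U r) b, insert b S, le_sup_left, ?_,
      hS.sup_edge hbr (fun u hu => (hle u hu).trans hd.ge) fun q => ?_, ?_, ?_⟩
    · intro u u'
      rw [embed_sup_edge]
      have := write_weightMatrix ν (m := m1) (a := 20) (fun x y => SimpleGraph.dist_comm)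
        (fun u v => by rw [e 20 (by omega)]; exact hH u v) hvr.symm u u'
      rw [hd] at this
      rw [← this, setEdge]
      have w : ∀ i j z c, c ≠ 20 → m1.write 20 i j z c = m1 c := fun i j z c hc =>
        Mem.write_of_ne _ _ _ _ hc
      simp only [Program.exec, value_var, w _ _ _ 40 (by omega), w _ _ _ 41 (by omega),
        w _ _ _ 3 (by omega), e 40 (by omega), e 41 (by omega), e 3 (by omega), h40, h41, hR.root]
    · have h1 := hSP.le_walkLength hE q
      have h2 : (3 * ℓ : ℝ) < m1 21 (ν r) (ν v) := by exact_mod_cast hlt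
      rw [← hd] at h2
      exact h2.trans_le h1
    · intro u hu
      rcases Finset.mem_insert.1 hu with rfl | hu
      · exact hd.le
      · exact hle u hu
    · rintro a ha _
      obtain rfl : a = b := Subtype.ext ha
      refine ⟨.cons (Or.inr ((SimpleGraph.edge_adj ..).2 ⟨Or.inl ⟨rfl, rfl⟩, hbr.symm⟩)) .nil, ?_⟩
      rw [walkLength_cons, walkLength_nil, hopLength_mk, hd]
      linarith [show (0 : ℝ) ≤ ℓ from Nat.cast_nonneg _]
  · rw [if_neg (hval.not.2 hlt)]
    refine ⟨H, S, le_rfl, ?_, hS, hle, ?_⟩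
    · rw [Program.exec, e 20 (by omega)]
      exact hH
    · rintro a ha _
      obtain rfl : a = b := Subtype.ext ha
      have hreach : H.Reachable (rootTerminal U r) b := (hF _ _).mono hS.le
      obtain ⟨q, hq⟩ := hSP.exists_walk hE (lt_mul_self_of_reachable ν hG hSP hreach)
      refine ⟨q, ?_⟩
      rw [hq]
      exact_mod_cast not_lt.1 hlt

/-- The shortcuts bring all terminals close to the root and are together at most as long as `F`. -/
lemma exec_addShortcuts (hG : G.Connected) (hR : Ready ν G U r p m)
    {F : SimpleGraph (Terminal U r)} (hF : F.Connected)
    (h20 : ∀ u v, m 20 (ν u) (ν v) = weightMatrix (embed F) G.dist (n * n) u v) :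
    ∃ H : SimpleGraph (Terminal U r), F ≤ H ∧
      totalWeight (hopLength G U r) H ≤ 2 * totalWeight (hopLength G U r) F ∧
      (∀ u v, addShortcuts.exec m 20 (ν u) (ν v) = weightMatrix (embed H) G.dist (n * n) u v) ∧
      ∀ a : Terminal U r, ∃ q : H.Walk (rootTerminal U r) a,
        walkLength (hopLength G U r) q ≤ 3 * G.dist r a.1 := by
  let Q : ℕ → (Terminal U r → Prop) → Mem → Prop := fun ℓ done m' =>
    Ready ν G U r p m' ∧ ∃ (H : SimpleGraph (Terminal U r)) (S : Finset (Terminal U r)),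
      (∀ u v, m' 20 (ν u) (ν v) = weightMatrix (embed H) G.dist (n * n) u v) ∧
      IsShortcutGraph G F H S ∧ (∀ u ∈ S, G.dist r u.1 ≤ ℓ) ∧
      ∀ a, done a → ∃ q : H.Walk (rootTerminal U r) a,
        walkLength (hopLength G U r) q ≤ 3 * G.dist r a.1
  have hQ : ∀ {ℓ ℓ' : ℕ} {d d' : Terminal U r → Prop} {m' : Mem}, ℓ ≤ ℓ' → (∀ a, d' a → d a) →
      Q ℓ d m' → Q ℓ' d' m' := fun hℓ hd ⟨h1, H, S, h2, h3, h4, h5⟩ =>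
    ⟨h1, H, S, h2, h3, fun u hu => (h4 u hu).trans hℓ, fun a h => h5 a (hd a h)⟩
  have hQw : ∀ {ℓ : ℕ} {d : Terminal U r → Prop} {m' : Mem} {c k : ℕ},
      c ∉ [0, 2, 3, 6, 11, 12, 20] → Q ℓ d m' → Q ℓ d (m'.write c 0 0 k) := by
    intro ℓ d m' c k hc ⟨h1, H, S, h2, h3⟩
    have w : ∀ a ∈ [0, 2, 3, 6, 11, 12, 20], m'.write c 0 0 k a = m' a := fun a ha =>
      Mem.write_of_ne _ _ _ _ fun h => hc (h ▸ ha)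
    refine ⟨h1.congr (w _ (by simp)) (w _ (by simp)) (w _ (by simp)) (w _ (by simp)) (w _ (by simp))
      (w _ (by simp)), H, S, ?_, h3⟩
    rw [w _ (by simp)]
    exact h2
  have key := Program.exec_forNodes_induct (x := 40) (c := .forNodes 41 considerShortcut)
    hR.num (fun ℓ m' => Q ℓ (fun a => G.dist r a.1 < ℓ) m') ?_ ?_
  · obtain ⟨_, H, S, hH, hS, _, hdone⟩ := key
    refine ⟨H, hS.le, ?_, hH, fun a => hdone a (dist_lt_of_equiv ν (hG _ _))⟩
    have := sum_le_totalWeight (D := fun a : Terminal U r => (G.dist r a.1 : ℝ))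
      hopLength_nonneg hF (r := rootTerminal U r) (by simp) hS.far
    linarith [hS.weight]
  · refine ⟨hR, F, ∅, h20, ⟨le_rfl, by simp, by simp, ?_⟩, by simp,
      fun a h => absurd h (Nat.not_lt_zero _)⟩
    intro u hu v hv huv
    simp only [Finset.notMem_empty, or_false] at hu hv
    exact absurd (hu.trans hv.symm) huv
  intro ℓ _ m' _ hm'
  have hm1 := hQw (c := 40) (k := ℓ) (by simp) hm'
  set m1 := m'.write 40 0 0 ℓ with hm1def
  have key2 := Program.exec_forNodes_induct (x := 41) (c := considerShortcut) hm1.1.num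
    (fun i m' => Q ℓ (fun a => G.dist r a.1 < ℓ ∨ G.dist r a.1 = ℓ ∧ (ν a.1 : ℕ) < i) m') ?_ ?_
  · refine hQ (Nat.le_succ ℓ) (fun a h => ?_) key2
    rcases Nat.lt_succ_iff_lt_or_eq.1 h with h | h
    · exact Or.inl h
    · exact Or.inr ⟨h, (ν a.1).2⟩
  · exact hQ le_rfl (fun a h => h.resolve_right fun h => absurd h.2 (Nat.not_lt_zero _)) hm1
  intro i hi m2 hframe2 hm2
  obtain ⟨hR3, H, S, hH, hS, hle, hdone⟩ := hQw (c := 41) (k := i) (by simp) hm2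
  have h40 : m2.write 41 0 0 i 40 0 0 = ℓ := by
    rw [Mem.write_of_ne _ _ _ _ (by omega), hframe2 40, hm1def, Mem.write_self]
    simp [considerShortcut, shortestPaths, initDistances, relaxThrough, findParents, setEdge,
      Program.mods]
  obtain ⟨H', S', hHH', h1, h2, h3, h4⟩ := exec_considerShortcut hG hR3 hF hH hS
    (v := ν.symm ⟨i, hi⟩) h40 (by rw [Mem.write_self, ν.apply_symm_apply]) hle
  refine ⟨hR3.congr_of_mods (l := considerShortcut.mods)
    (fun a ha => Program.exec_of_notMem_mods ha _) ?_, H', S', h1, h2, h3, ?_⟩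
  · simp [considerShortcut, shortestPaths, initDistances, relaxThrough, findParents, setEdge,
      Program.mods]
  intro a ha
  have hold : (G.dist r a.1 < ℓ ∨ G.dist r a.1 = ℓ ∧ (ν a.1 : ℕ) < i) →
      ∃ q : H'.Walk (rootTerminal U r) a,
        walkLength (hopLength G U r) q ≤ 3 * G.dist r a.1 := by
    intro h
    obtain ⟨q, hq⟩ := hdone a h
    refine ⟨q.mapLe hHH', ?_⟩
    rwa [walkLength, SimpleGraph.Walk.edges_mapLe_eq_edges, ← walkLength]
  rcases ha with ha | ⟨ha, hi'⟩
  · exact hold (Or.inl ha)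
  · rcases Nat.lt_succ_iff_lt_or_eq.1 hi' with hi' | hi'
    · exact hold (Or.inr ⟨ha, hi'⟩)
    · have hai : a.1 = ν.symm ⟨i, hi⟩ := by
        rw [Equiv.eq_symm_apply]
        exact Fin.ext hi'
      rw [ha]
      exact h4 a hai (by rw [← hai]; exact ha)

end Shortcuts

/-! ### The light approximate shortest-path tree -/

section LAST

variable {V : Type u} [DecidableEq V] {n : ℕ} {G : SimpleGraph V} {U : Finset V} {r : V}

lemma dist_le_walkLength (hG : G.Connected) {H : SimpleGraph (Terminal U r)} {a b : Terminal U r}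
    (q : H.Walk a b) : (G.dist a.1 b.1 : ℝ) ≤ walkLength (hopLength G U r) q := by
  induction q with
  | nil => simp [walkLength_nil]
  | @cons a b c hab q ih =>
    rw [walkLength_cons, hopLength_mk]
    have : (G.dist a.1 c.1 : ℝ) ≤ G.dist a.1 b.1 + G.dist b.1 c.1 := by
      exact_mod_cast hG.dist_triangle
    linarith

/-- A shortest path tree of the spanning tree with shortcuts is a `(3, 2)`-LAST. -/
lemma exists_isLAST (ν : V ≃ Fin n) (hG : G.Connected) {F H : SimpleGraph (Terminal U r)}
    (hext : IsExtendable (hopLength G U r) F)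
    (hH : totalWeight (hopLength G U r) H ≤ 2 * totalWeight (hopLength G U r) F)
    (hwalk : ∀ a : Terminal U r, ∃ q : H.Walk (rootTerminal U r) a,
      walkLength (hopLength G U r) q ≤ 3 * G.dist r a.1)
    {D : V → V → ℕ} {q : V → V → V}
    (hS : ShortestPaths (weightMatrix (embed H) G.dist (n * n)) D q) :
    ∃ t : Terminal U r → Terminal U r, (∀ a, (t a).1 = q r a.1) ∧
      (∀ a, a ≠ rootTerminal U r → D r (t a).1 < D r a.1) ∧
      IsLAST ⊤ (hopLength G U r) (rootTerminal U r) 3 2 (parentGraph (rootTerminal U r) t) := by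
  have hn : 0 < n := (ν r).pos
  have hE := encodesGraph_embed (H := H) hG (Nat.mul_pos hn hn)
  have hex : ∀ a : Terminal U r, ∃ c : Terminal U r, c.1 = q r a.1 ∧ (a ≠ rootTerminal U r →
      H.Adj c a ∧ (D r c.1 : ℝ) + hopLength G U r s(c, a) = D r a.1) := by
    intro a
    by_cases ha : a = rootTerminal U r
    · subst ha
      exact ⟨rootTerminal U r, (hS.parent_self r).symm, fun h => absurd rfl h⟩
    · have hne : r ≠ a.1 := fun h => ha (Subtype.ext h.symm)
      obtain ⟨w, _⟩ := hwalk a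
      have hlt : D r a.1 < n * n :=
        lt_mul_self_of_reachable ν hG hS (a := rootTerminal U r) w.reachable
      obtain ⟨c, hc, hadj, hD⟩ := hS.exists_parent hE hne hlt
      exact ⟨c, hc, fun _ => ⟨hadj, hD⟩⟩
  choose t ht hadj using hex
  have hlt : ∀ a, a ≠ rootTerminal U r → D r (t a).1 < D r a.1 := by
    intro a ha
    rw [ht]
    exact hS.parent_lt hE.pos fun h => ha (Subtype.ext h.symm)
  have hδ : ∀ a, a ≠ rootTerminal U r →
      ((D r (t a).1 : ℕ) : ℝ) + hopLength G U r s(t a, a) = (D r a.1 : ℕ) := fun a ha =>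
    (hadj a ha).2
  have hρ : D r (rootTerminal U r).1 = 0 := hS.self r
  refine ⟨t, ht, hlt, le_top,
    parentGraph_isTree (δ := fun a => D r a.1) hlt hδ hρ, ?_, ?_⟩
  · intro v p p' hp
    rw [walkLength_parentGraph (δ := fun a => D r a.1) hlt hδ hρ p hp]
    obtain ⟨w, hw⟩ := hwalk v
    have h1 : (D r v.1 : ℝ) ≤ walkLength (hopLength G U r) w :=
      hS.le_walkLength hE (a := rootTerminal U r) w
    have h2 := dist_le_walkLength hG p'
    have h3 : G.dist v.1 (rootTerminal U r).1 = G.dist r v.1 := SimpleGraph.dist_comm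
    rw [h3] at h2
    linarith
  · intro M _ hM
    have hle : parentGraph (rootTerminal U r) t ≤ H := by
      intro a b hab
      rcases (parentGraph_adj.1 hab).1 with ⟨hb, rfl⟩ | ⟨ha, rfl⟩
      · exact (hadj b hb).1
      · exact (hadj a ha).1.symm
    have h1 := totalWeight_mono hopLength_nonneg hle (w := hopLength G U r)
    have h2 := hext.weight_le hopLength_nonneg hM.connected
    linarith

end LAST

/-! ### The union of the shortest paths -/

section MarkPaths

variable {V : Type u} [DecidableEq V] {n : ℕ} {G : SimpleGraph V} {U : Finset V} {r : V}
  {ν : V ≃ Fin n} {p : V → V → V} {m : Mem}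

/-- The pairs of consecutive nodes on the ways from terminals `a` to `t a` along predecessors. -/
def trail (p : V → V → V) (n : ℕ) (t : Terminal U r → Terminal U r) (a : Terminal U r) :
    Set (Sym2 V) :=
  {e | ∃ j < n, e = s((p (t a).1)^[j] a.1, (p (t a).1)^[j + 1] a.1)}

lemma trail_succ (t : Terminal U r → Terminal U r) (a : Terminal U r) (k : ℕ) :
    trail p (k + 1) t a = trail p k t a ∪ {s((p (t a).1)^[k] a.1, (p (t a).1)^[k + 1] a.1)} := by
  ext e
  simp only [trail, Set.mem_ofPred_eq, Set.mem_union, Set.mem_singleton_iff]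
  constructor
  · rintro ⟨j, hj, h⟩
    rcases Nat.lt_succ_iff_lt_or_eq.1 hj with hj | rfl
    · exact Or.inl ⟨j, hj, h⟩
    · exact Or.inr h
  · rintro (⟨j, hj, h⟩ | h)
    · exact ⟨j, by omega, h⟩
    · exact ⟨k, by omega, h⟩

/-- A step of the walk from `x` to its parent `y`. The walk stays in `y` once it gets there; as
`p y y = y`, the edge added by then is a loop, which a simple graph ignores. -/
lemma exec_markStep (hR : Ready ν G U r p m) (hp : ∀ t, p t t = t)
    (hne : ∀ t x, x ≠ t → x ≠ p t x) {x y : V} {c : V} (h40 : m 40 0 0 = ν x)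
    (h22 : m 22 (ν r) (ν x) = ν y) (h43 : m 43 0 0 = ν c) {E : Set (Sym2 V)}
    (h30 : ∀ u v, m 30 (ν u) (ν v) =
      weightMatrix (SimpleGraph.fromEdgeSet E) (fun _ _ => 1) (n * n) u v) :
    markStep.exec m 43 0 0 = ν (p y c) ∧ ∀ u v, markStep.exec m 30 (ν u) (ν v) =
      weightMatrix (SimpleGraph.fromEdgeSet (E ∪ {s(c, p y c)})) (fun _ _ => 1) (n * n) u v := by
  have hsup : SimpleGraph.fromEdgeSet (E ∪ {s(c, p y c)}) =
      SimpleGraph.fromEdgeSet E ⊔ SimpleGraph.edge c (p y c) :=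
    SimpleGraph.fromEdgeSet_union _ _
  have hval : (neq (var 43) (.read 22 (var 3) (var 40))).value m = 0 ↔ c = y := by
    rw [value_neq_eq_zero]
    simp only [Expr.value, value_var, h40, h43, hR.root, h22]
    rw [Fin.val_inj, ν.apply_eq_iff_eq]
  rw [markStep, Program.exec]
  by_cases hcy : c = y
  · subst hcy
    rw [if_neg (not_not.2 (hval.2 rfl)), Program.exec, hsup, hp]
    refine ⟨h43, fun u v => ?_⟩
    rw [h30, SimpleGraph.edge_self_eq_bot, sup_bot_eq]
  · rw [if_pos (hval.not.2 hcy)]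
    have w : ∀ (m' : Mem) i j z a, a ≠ 30 → m'.write 30 i j z a = m' a := fun m' i j z a ha =>
      Mem.write_of_ne _ _ _ _ ha
    have w' : ∀ (m' : Mem) z, m'.write 43 0 0 z 30 = m' 30 := fun m' z =>
      Mem.write_of_ne _ _ _ _ (by omega)
    simp only [Program.exec, setEdge, Expr.value, value_var, w _ _ _ _ 43 (by omega),
      w _ _ _ _ 40 (by omega), w _ _ _ _ 3 (by omega), w _ _ _ _ 22 (by omega),
      w _ _ _ _ 12 (by omega), w', h40, h43, h22, hR.root, hR.parent]
    refine ⟨Mem.write_self .., fun u v => ?_⟩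
    rw [hsup]
    exact write_weightMatrix ν (m := m) (a := 30) (fun _ _ => rfl) h30 (hne y c hcy) u v

/-- `markPaths` forms the union of the trails from the terminals to their parents. -/
lemma exec_markPaths (hR : Ready ν G U r p m) (hp : ∀ t, p t t = t)
    (hne : ∀ t x, x ≠ t → x ≠ p t x) {t : Terminal U r → Terminal U r}
    (h22 : ∀ a : Terminal U r, m 22 (ν r) (ν a.1) = ν (t a).1)
    (h30 : ∀ u v, m 30 (ν u) (ν v) = weightMatrix ⊥ (fun _ _ => 1) (n * n) u v) (u v : V) :
    markPaths.exec m 30 (ν u) (ν v) =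
      weightMatrix (SimpleGraph.fromEdgeSet (⋃ a, trail p n t a)) (fun _ _ => 1) (n * n) u v := by
  let E : ℕ → Set (Sym2 V) := fun i => ⋃ a : Terminal U r, ⋃ _ : (ν a.1 : ℕ) < i, trail p n t a
  have key := Program.exec_forNodes_induct (x := 40)
    (c := .cond (isTerminal (var 40))
      (.seq (.assign 43 (.lit 0) (.lit 0) (var 40)) (.forNodes 41 markStep)) .skip) hR.num
    (fun i m' => ∀ u v, m' 30 (ν u) (ν v) =
      weightMatrix (SimpleGraph.fromEdgeSet (E i)) (fun _ _ => 1) (n * n) u v) ?_ ?_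
  · have hE : E n = ⋃ a, trail p n t a := by
      simp only [E, Fin.is_lt, Set.iUnion_true]
    rw [← hE]
    exact key u v
  · have hE : E 0 = ∅ := by simp [E]
    rw [hE, SimpleGraph.fromEdgeSet_empty]
    exact h30
  intro i hi m' hframe hm'
  obtain ⟨x, rfl⟩ : ∃ x : V, (ν x : ℕ) = i := ⟨ν.symm ⟨i, hi⟩, by simp⟩
  have hmods : ∀ a ∈ [0, 2, 3, 6, 11, 12, 22], a ∉ (Program.forNodes 40
      (.cond (isTerminal (var 40))
      (.seq (.assign 43 (.lit 0) (.lit 0) (var 40)) (.forNodes 41 markStep)) .skip)).mods := by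
    simp [markStep, setEdge, Program.mods]
  have hR' : Ready ν G U r p m' := hR.congr_of_mods hframe fun a ha =>
    hmods a (by simp at ha ⊢; tauto)
  set m1 := m'.write 40 0 0 (ν x) with hm1
  have w1 : ∀ a, a ≠ 40 → m1 a = m' a := fun a ha => Mem.write_of_ne _ _ _ _ ha
  have hR1 : Ready ν G U r p m1 := hR'.congr (w1 _ (by omega)) (w1 _ (by omega)) (w1 _ (by omega))
    (w1 _ (by omega)) (w1 _ (by omega)) (w1 _ (by omega))
  have h40 : m1 40 0 0 = ν x := Mem.write_self ..
  have hterm := hR1.isTerminal_iff (e := var 40) h40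
  rw [Program.exec]
  by_cases hx : x ∈ insert r U
  swap
  · rw [if_neg (hterm.not.2 hx), Program.exec]
    have hE : E (ν x + 1) = E (ν x) := by
      refine Set.iUnion_congr fun a => ?_
      have : (ν a.1 : ℕ) ≠ ν x := fun h =>
        hx (ν.injective (Fin.ext h) ▸ a.2)
      have h' : (ν a.1 : ℕ) < ν x + 1 ↔ (ν a.1 : ℕ) < ν x := by omega
      rw [h']
    rw [hE, w1 _ (by omega)]
    exact hm'
  · rw [if_pos (hterm.2 hx), Program.exec]
    let a : Terminal U r := ⟨x, hx⟩
    set m2 := (Program.assign 43 (.lit 0) (.lit 0) (var 40)).exec m1 with hm2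
    have hm2' : m2 = m1.write 43 0 0 (ν x) := by
      simp only [hm2, Program.exec, Expr.value, value_var, h40]
    have w2 : ∀ b, b ≠ 43 → m2 b = m1 b := fun b hb => by
      rw [hm2']
      exact Mem.write_of_ne _ _ _ _ hb
    have hR2 : Ready ν G U r p m2 := hR1.congr (w2 _ (by omega)) (w2 _ (by omega))
      (w2 _ (by omega)) (w2 _ (by omega)) (w2 _ (by omega)) (w2 _ (by omega))
    have key2 := Program.exec_forNodes_induct (x := 41) (c := markStep) hR2.num
      (fun k m3 => m3 43 0 0 = ν ((p (t a).1)^[k] x) ∧ ∀ u v, m3 30 (ν u) (ν v) =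
        weightMatrix (SimpleGraph.fromEdgeSet (E (ν x) ∪ trail p k t a)) (fun _ _ => 1) (n * n) u v)
      ?_ ?_
    · have hE : E (ν x + 1) = E (ν x) ∪ trail p n t a := by
        ext e
        simp only [E, Set.mem_iUnion, Set.mem_union, exists_prop]
        constructor
        · rintro ⟨b, hb, he⟩
          rcases Nat.lt_succ_iff_lt_or_eq.1 hb with hb | hb
          · exact Or.inl ⟨b, hb, he⟩
          · obtain rfl : b = a := Subtype.ext (ν.injective (Fin.ext hb))
            exact Or.inr he
        · rintro (⟨b, hb, he⟩ | he)
          · exact ⟨b, by omega, he⟩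
          · exact ⟨a, Nat.lt_succ_self _, he⟩
      rw [hE]
      exact key2.2
    · have h0 : trail p 0 t a = ∅ := by simp [trail]
      have h43 : m2 43 0 0 = ν x := by rw [hm2', Mem.write_self]
      rw [h0, Set.union_empty, w2 30 (by omega), w1 30 (by omega)]
      exact ⟨h43, hm'⟩
    · rintro k _ m3 hframe3 ⟨h43, hK⟩
      have w3 : ∀ b, b ≠ 41 → m3.write 41 0 0 k b = m3 b := fun b hb => Mem.write_of_ne _ _ _ _ hb
      have hmods3 : ∀ b ∈ [0, 2, 3, 6, 11, 12, 22, 40],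
          b ∉ (Program.forNodes 41 markStep).mods := by
        simp [markStep, setEdge, Program.mods]
      have hR3 : Ready ν G U r p m3 := hR2.congr_of_mods hframe3 fun b hb =>
        hmods3 b (by simp at hb ⊢; tauto)
      have hR4 : Ready ν G U r p (m3.write 41 0 0 k) := hR3.congr (w3 _ (by omega))
        (w3 _ (by omega)) (w3 _ (by omega)) (w3 _ (by omega)) (w3 _ (by omega)) (w3 _ (by omega))
      have e40 : m3 40 0 0 = ν x := by
        rw [hframe3 _ (hmods3 _ (by simp)), w2 _ (by omega), h40]
      have e22 : m3 22 (ν r) (ν x) = ν (t a).1 := by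
        rw [hframe3 _ (hmods3 _ (by simp)), w2 _ (by omega), w1 _ (by omega),
          hframe _ (hmods _ (by simp)), h22 a]
      have step := exec_markStep hR4 hp hne (x := x) (y := (t a).1) (c := (p (t a).1)^[k] x)
        (E := E (ν x) ∪ trail p k t a) (by rw [w3 _ (by omega), e40])
        (by rw [w3 _ (by omega), e22]) (by rw [w3 _ (by omega), h43])
        (by rw [w3 _ (by omega)]; exact hK)
      rw [trail_succ, ← Set.union_assoc, Function.iterate_succ_apply']
      exact step

/-- If the paths follow predecessors, then the union of the trails is the union of the paths. -/
lemma exists_pathUnion_eq (ν : V ≃ Fin n) (hG : G.Connected) (hp : ∀ t, p t t = t)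
    (hpd : ∀ t x, x ≠ t → G.Adj x (p t x) ∧ G.dist (p t x) t + 1 = G.dist x t)
    {t : Terminal U r → Terminal U r} (htr : t (rootTerminal U r) = rootTerminal U r) {δ : V → ℕ}
    (hδ : ∀ a, a ≠ rootTerminal U r → δ (t a).1 < δ a.1) :
    ∃ P : ∀ x y : V, G.Walk x y, IsShortestPathChoice G P ∧
      SimpleGraph.fromEdgeSet (⋃ a, trail p n t a) =
        pathUnion P (parentGraph (rootTerminal U r) t) := by
  choose c hc hce using exists_walk_iterate hpd hG
  -- parents precede their children if nodes are ordered by `δ`, with ties broken by their numbers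
  obtain ⟨P, hP, hPc⟩ := exists_symmetric_choice (κ := fun x => toLex (δ x, ν x))
    (fun x y h => ν.injective (congrArg (fun z => (ofLex z).2) h)) c hc
  have hPt : ∀ a, a ≠ rootTerminal U r → P a.1 (t a).1 = c a.1 (t a).1 := by
    intro a ha
    refine hPc _ _ ?_
    rw [Prod.Lex.toLex_le_toLex]
    exact Or.inl (hδ a ha)
  refine ⟨P, hP, ?_⟩
  rw [pathUnion, ← SimpleGraph.edgeSet_inj, SimpleGraph.edgeSet_fromEdgeSet,
    SimpleGraph.edgeSet_fromEdgeSet]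
  ext e
  simp only [Set.mem_sdiff, and_congr_left_iff, Set.mem_iUnion]
  intro hdiag
  constructor
  · rintro ⟨a, j, hj, rfl⟩
    have hloop : ∀ y k, (p y)^[k] y = y := fun y k => Function.iterate_fixed (hp y) k
    have ha : a ≠ rootTerminal U r := by
      rintro rfl
      apply hdiag
      rw [htr, hloop, hloop]
      rfl
    have hjd : j < G.dist a.1 (t a).1 := by
      by_contra h
      -- the trail has arrived by then, and `e` is a loop
      have harrive : (p (t a).1)^[G.dist a.1 (t a).1] a.1 = (t a).1 := by
        have : ∀ k x, G.dist x (t a).1 = k → (p (t a).1)^[k] x = (t a).1 := by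
          intro k
          induction k with
          | zero => exact fun x hx => hG.dist_eq_zero_iff.1 hx
          | succ k ih =>
            intro x hx
            rw [Function.iterate_succ_apply]
            refine ih _ ?_
            have := (hpd (t a).1 x (by rintro rfl; simp at hx)).2
            omega
        exact this _ _ rfl
      have hstay : ∀ k, G.dist a.1 (t a).1 ≤ k → (p (t a).1)^[k] a.1 = (t a).1 := by
        intro k hk
        obtain ⟨i, rfl⟩ := Nat.exists_eq_add_of_le hk
        rw [add_comm, Function.iterate_add_apply, harrive, hloop]
      apply hdiag
      rw [hstay j (by omega), hstay (j + 1) (by omega)]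
      rfl
    refine ⟨a, t a, parentGraph_adj.2 ⟨Or.inr ⟨ha, rfl⟩, ?_⟩, ?_⟩
    · intro h
      exact (hδ a ha).ne (congrArg (fun b : Terminal U r => δ b.1) h.symm)
    · rw [hPt a ha, hce]
      exact ⟨j, hjd, rfl⟩
  · have key : ∀ a, a ≠ rootTerminal U r → e ∈ (P a.1 (t a).1).edges → ∃ a, e ∈ trail p n t a := by
      intro a ha he
      rw [hPt a ha, hce] at he
      obtain ⟨j, hj, rfl⟩ := he
      exact ⟨a, j, hj.trans (dist_lt_of_equiv ν (hG _ _)), rfl⟩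
    rintro ⟨x, y, hxy, he⟩
    rcases (parentGraph_adj.1 hxy).1 with ⟨hy, rfl⟩ | ⟨hx, rfl⟩
    · refine key y hy ?_
      rwa [hP.2, SimpleGraph.Walk.edges_reverse, List.mem_reverse]
    · exact key x hx he

end MarkPaths

/-! ### The output tree -/

section Tree

variable {V : Type u} {n : ℕ}

/-- The predecessors on shortest paths from `r` form a shortest path tree. -/
lemma exists_shortestPathTree (ν : V ≃ Fin n) {K : SimpleGraph V} {U : Finset V} {r : V}
    {D : V → V → ℕ} {q : V → V → V}
    (hS : ShortestPaths (weightMatrix K (fun _ _ => 1) (n * n)) D q)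
    (hU : ∀ u ∈ U, K.Reachable r u) :
    ∃ T : RootedTree V r, T.IsShortestPathTree K U ∧ (∀ v, v ∈ T.nodes ↔ D r v < n * n) ∧
      T.parent = q r := by
  classical
  have : Fintype V := Fintype.ofEquiv (Fin n) ν.symm
  have hcard : Fintype.card V = n := by rw [Fintype.card_congr ν, Fintype.card_fin]
  have hn : 0 < n := (ν r).pos
  have hE : EncodesGraph id K (fun _ => 1) (n * n) (weightMatrix K (fun _ _ => 1) (n * n)) :=
    encodesGraph_weightMatrix (Nat.mul_pos hn hn)
  have hpar : ∀ v, v ≠ r → D r v < n * n → K.Adj (q r v) v ∧ D r (q r v) < D r v := by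
    intro v hv hlt
    obtain ⟨c, hc, hadj, _⟩ := hS.exists_parent (b := v) hE (Ne.symm hv) hlt
    obtain rfl : c = q r v := hc
    exact ⟨hadj, hS.parent_lt hE.pos (Ne.symm hv)⟩
  have hmem : ∀ v, D r v < n * n → D r (q r v) < n * n := by
    intro v hlt
    by_cases hv : v = r
    · rw [hv, hS.parent_self, hS.self]
      exact Nat.mul_pos hn hn
    · exact (hpar v hv hlt).2.trans hlt
  have hiter : ∀ k v, D r v = k → D r v < n * n → (q r)^[k] v = r := by
    intro k
    induction k with
    | zero =>
      intro v hv _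
      change v = r
      by_contra hne
      have := hS.parent_lt hE.pos (Ne.symm hne)
      omega
    | succ k ih =>
      intro v hv hlt
      have hne : v ≠ r := by
        rintro rfl
        rw [hS.self] at hv
        omega
      rw [Function.iterate_succ_apply]
      refine ih _ ?_ (hmem v hlt)
      have h1 := hS.parent r v (Ne.symm hne)
      rw [weightMatrix, if_pos (hpar v hne hlt).1] at h1
      omega
  let T : RootedTree V r :=
    { nodes := Finset.univ.filter fun v => D r v < n * n
      parent := q r
      root_mem := by
        rw [Finset.mem_filter, hS.self]
        exact ⟨Finset.mem_univ r, Nat.mul_pos hn hn⟩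
      parent_root := hS.parent_self r
      parent_mem := fun v hv => Finset.mem_filter.2
        ⟨Finset.mem_univ _, hmem v (Finset.mem_filter.1 hv).2⟩
      reaches_root := fun v hv => ⟨D r v, hiter _ v rfl (Finset.mem_filter.1 hv).2⟩ }
  have hnodes : ∀ v, v ∈ T.nodes ↔ D r v < n * n := fun v => by
    rw [Finset.mem_filter, and_iff_right (Finset.mem_univ v)]
  have hadj : ∀ v ∈ T.nodes, v ≠ r → K.Adj v (T.parent v) := fun v hv hne =>
    (hpar v hne ((hnodes v).1 hv)).1.symm
  refine ⟨T, ⟨⟨?_, hadj⟩, ?_⟩, hnodes, rfl⟩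
  · intro u hu
    rw [hnodes]
    refine hS.lt_of_reachable hE ?_ (hU u hu)
    rw [hcard]
    exact Nat.le_mul_of_pos_left n hn
  · intro v hv
    have hlt := (hnodes v).1 hv
    have hD := (hS.eq_dist_of_lt hE hlt).2
    apply le_antisymm
    · rw [SimpleGraph.dist_comm, ← hD]
      exact T.depth_le (hiter _ v rfl hlt)
    · obtain ⟨w, hw⟩ := T.exists_walk hadj hv
      rw [← hw]
      exact SimpleGraph.dist_le w

lemma exec_writeTree {ν : V ≃ Fin n} {r : V} {m : Mem} (hn : m 0 0 0 = n) (hr : m 3 0 0 = ν r)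
    (v : V) :
    writeTree.exec m 4 (ν v) 0 = (if m 31 (ν r) (ν v) < m 6 0 0 then 1 else 0) ∧
      writeTree.exec m 5 (ν v) 0 = m 32 (ν r) (ν v) := by
  have key := Program.exec_forNodes_induct (x := 40)
    (c := .seq (.assign 4 (var 40) (.lit 0)
        (.sub (.lit 1) (.sub (.lit 1) (.sub (var 6) (.read 31 (var 3) (var 40))))))
      (.assign 5 (var 40) (.lit 0) (.read 32 (var 3) (var 40)))) hn
    (fun i m' => ∀ j < i, m' 4 j 0 = (if m 31 (ν r) j < m 6 0 0 then 1 else 0) ∧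
      m' 5 j 0 = m 32 (ν r) j) (fun j hj => absurd hj (Nat.not_lt_zero j)) ?_
  · exact key (ν v) (ν v).2
  intro i _ m' hframe hm' j hj
  have e : ∀ a, a ≠ 40 → a ≠ 4 → a ≠ 5 → m'.write 40 0 0 i a = m a := fun a h h4 h5 => by
    rw [Mem.write_of_ne _ _ _ _ h, hframe a (by simp [Program.mods, h, h4, h5])]
  have e4 : ∀ a, a ≠ 40 → m'.write 40 0 0 i a = m' a := fun a h => Mem.write_of_ne _ _ _ _ h
  have w : ∀ (m' : Mem) a i j z b, b ≠ a → m'.write a i j z b = m' b := fun m' a i j z b hb =>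
    Mem.write_of_ne _ _ _ _ hb
  simp only [Program.exec, Expr.value, value_var, Mem.write_self,
    e 6 (by omega) (by omega) (by omega),
    e 31 (by omega) (by omega) (by omega), e 3 (by omega) (by omega) (by omega),
    e 32 (by omega) (by omega) (by omega), w _ 4 _ _ _ 3 (by omega), w _ 4 _ _ _ 32 (by omega),
    w _ 4 _ _ _ 40 (by omega), w _ 5 _ _ _ 4 (by omega), hr]
  by_cases hji : j = i
  · subst hji
    rw [Mem.write_self, Mem.write_self]
    refine ⟨?_, rfl⟩
    split_ifs <;> omega
  · rw [Mem.write_apply, Mem.write_apply, if_neg (fun h : j = i ∧ 0 = 0 => hji h.1),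
      if_neg (fun h : j = i ∧ 0 = 0 => hji h.1), w _ 4 _ _ _ 5 (by omega), e4 4 (by omega),
      e4 5 (by omega)]
    exact hm' j (by omega)

end Tree

/-! ### Reading the input -/

section Input

variable {V : Type u} {n : ℕ} (ν : V ≃ Fin n) (G : SimpleGraph V) (U : Finset V) (r : V)

lemma encodeInput_num : encodeInput ν G U r 0 0 0 = n := by
  simp [encodeInput]

lemma encodeInput_adj (x y : V) : encodeInput ν G U r 1 (ν x) (ν y) ≠ 0 ↔ G.Adj x y := by
  have : (∃ a b : V, G.Adj a b ∧ (ν a : ℕ) = ν x ∧ (ν b : ℕ) = ν y) ↔ G.Adj x y := by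
    constructor
    · rintro ⟨a, b, hab, ha, hb⟩
      rwa [← ν.injective (Fin.ext ha), ← ν.injective (Fin.ext hb)]
    · exact fun h => ⟨x, y, h, rfl, rfl⟩
  rw [← this]
  simp [encodeInput]

lemma encodeInput_source (x : V) : encodeInput ν G U r 2 (ν x) 0 ≠ 0 ↔ x ∈ U := by
  have : (∃ a ∈ U, (ν a : ℕ) = ν x) ↔ x ∈ U := by
    constructor
    · rintro ⟨a, ha, h⟩
      rwa [← ν.injective (Fin.ext h)]
    · exact fun h => ⟨x, h, rfl⟩
  rw [← this]
  simp [encodeInput]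

lemma encodeInput_root : encodeInput ν G U r 3 0 0 = ν r := by
  simp [encodeInput]

lemma encodeInput_six : encodeInput ν G U r 6 0 0 = 0 := by
  simp [encodeInput]

variable {ν G U r}

lemma exec_computeInfinity {m : Mem} (hn : m 0 0 0 = n) (h6 : m 6 0 0 = 0) :
    computeInfinity.exec m 6 0 0 = n * n := by
  refine Program.exec_forNodes_induct (x := 40)
    (c := .assign 6 (.lit 0) (.lit 0) (.add (var 6) numNodes)) hn
    (fun k m' => m' 6 0 0 = k * n) (by rw [h6, zero_mul]) ?_
  intro k _ m' hframe hm'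
  have h0 : m'.write 40 0 0 k 0 = m 0 := by
    rw [Mem.write_of_ne _ _ _ _ (by omega), hframe 0 (by simp [Program.mods])]
  have h6' : m'.write 40 0 0 k 6 = m' 6 := Mem.write_of_ne _ _ _ _ (by omega)
  simp only [Program.exec, Expr.value, value_var, value_numNodes, Mem.write_self, h0, h6', hm', hn]
  rw [Nat.succ_mul]

lemma exec_loadGraph {m : Mem} (hn : m 0 0 0 = n)
    (h1 : ∀ x y, m 1 (ν x) (ν y) ≠ 0 ↔ G.Adj x y) (x y : V) :
    loadGraph.exec m 10 (ν x) (ν y) = weightMatrix G (fun _ _ => 1) (m 6 0 0) x y := by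
  have key := Program.exec_fill (i := 40) (j := 41) (a := 10)
    (c := .cond (.read 1 (var 40) (var 41)) (.assign 10 (var 40) (var 41) (.lit 1))
      (.assign 10 (var 40) (var 41) (var 6))) hn (by simp [Program.mods]) (by omega) (by omega)
    (by omega) (by simp [Program.mods])
    (fun x z y => y = if m 1 x z ≠ 0 then 1 else m 6 0 0) ?_ (ν x) (ν x).2 (ν y) (ν y).2
  · refine Eq.trans key ?_
    unfold weightMatrix
    by_cases h : G.Adj x y
    · rw [if_pos h, if_pos ((h1 x y).2 h)]
    · rw [if_neg h, if_neg ((h1 x y).not.2 h)]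
  · intro x _ z _ m' hframe hi hj _
    have e1 : m' 1 = m 1 := hframe _ (by simp [Program.mods])
    have e6 : m' 6 = m 6 := hframe _ (by simp [Program.mods])
    have hval : (Expr.read 1 (var 40) (var 41)).value m' = m 1 x z := by
      simp only [Expr.value, value_var, hi, hj, e1]
    have h40 : (var 40).value m' = x := hi
    have h41 : (var 41).value m' = z := hj
    rw [Program.exec, hval]
    by_cases h : m 1 x z ≠ 0
    · rw [if_pos h, if_pos h, Program.exec, h40, h41]
      exact ⟨Mem.write_self .., fun x' z' h' => by rw [Mem.write_apply, if_neg h']⟩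
    · rw [if_neg h, if_neg h, Program.exec, h40, h41, value_var, e6]
      exact ⟨Mem.write_self .., fun x' z' h' => by rw [Mem.write_apply, if_neg h']⟩

/-- The memory after the preparation: distances of `G` and predecessors on its shortest paths. -/
lemma exists_ready (ν : V ≃ Fin n) (hG : G.Connected) (U : Finset V) (r : V) :
    ∃ p : V → V → V, (∀ t, p t t = t) ∧
      (∀ t x, x ≠ t → G.Adj x (p t x) ∧ G.dist (p t x) t + 1 = G.dist x t) ∧
      Ready ν G U r p ((shortestPaths 9).exec
        (loadGraph.exec (computeInfinity.exec (encodeInput ν G U r)))) := by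
  have : Fintype V := Fintype.ofEquiv (Fin n) ν.symm
  have hcard : Fintype.card V = n := by rw [Fintype.card_congr ν, Fintype.card_fin]
  have hn : 0 < n := (ν r).pos
  have hE : EncodesGraph id G (fun _ => 1) (n * n) (weightMatrix G (fun _ _ => 1) (n * n)) :=
    encodesGraph_weightMatrix (Nat.mul_pos hn hn)
  set m0 := encodeInput ν G U r with hm0
  set m1 := computeInfinity.exec m0 with hm1
  set m2 := loadGraph.exec m1 with hm2
  have e1 : ∀ a, a ≠ 40 → a ≠ 6 → m1 a = m0 a := fun a h h' =>
    Program.exec_of_notMem_mods (by simp [computeInfinity, Program.mods, h, h']) _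
  have e2 : ∀ a, a ≠ 40 → a ≠ 41 → a ≠ 10 → m2 a = m1 a := fun a h h' h'' =>
    Program.exec_of_notMem_mods (by simp [loadGraph, Program.mods, h, h', h'']) _
  have e3 : ∀ a, (a < 11 ∨ 15 < a) → (shortestPaths 9).exec m2 a = m2 a := fun a ha =>
    exec_shortestPaths_of_ne a ha m2
  have h6 : m1 6 0 0 = n * n := exec_computeInfinity (encodeInput_num ..) (encodeInput_six ..)
  have h0 : m1 0 0 0 = n := by rw [e1 0 (by omega) (by omega), hm0, encodeInput_num]
  have hW : ∀ x y, m2 10 (ν x) (ν y) = weightMatrix G (fun _ _ => 1) (n * n) x y := by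
    intro x y
    rw [hm2, exec_loadGraph h0 (fun x y => by
      rw [e1 1 (by omega) (by omega), hm0, encodeInput_adj]), h6]
  have h0' : m2 0 0 0 = n := by rw [e2 0 (by omega) (by omega) (by omega), h0]
  obtain ⟨p, hp, hS⟩ := exec_shortestPaths ν (b := 9) h0' (fun x y => by
    rw [hW]
    exact hE.pos x y)
  have hWeq : (fun x y : V => m2 (9 + 1) (ν x) (ν y)) = weightMatrix G (fun _ _ => 1) (n * n) := by
    funext x y
    exact hW x y
  rw [hWeq] at hS
  have hlt : ∀ x y, (shortestPaths 9).exec m2 (9 + 2) (ν x) (ν y) < n * n := by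
    intro x y
    refine hS.lt_of_reachable hE ?_ (hG x y)
    rw [hcard]
    exact Nat.le_mul_of_pos_left n hn
  have hdist : ∀ x y, (shortestPaths 9).exec m2 (9 + 2) (ν x) (ν y) = G.dist x y := fun x y =>
    (hS.eq_dist_of_lt hE (hlt x y)).2
  refine ⟨p, hS.parent_self, ?_, ?_⟩
  · intro t x hx
    obtain ⟨c, hc, hadj, hD⟩ := hS.exists_parent (b := x) hE (Ne.symm hx) (hlt t x)
    obtain rfl : c = p t x := hc
    refine ⟨hadj.symm, ?_⟩
    simp only [id, hdist] at hD
    rw [SimpleGraph.dist_comm, SimpleGraph.dist_comm (u := x)]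
    exact_mod_cast hD
  · refine ⟨?_, ?_, ?_, ?_, hdist, hp⟩
    · rw [e3 0 (by omega), h0']
    · intro x
      rw [e3 2 (by omega), e2 2 (by omega) (by omega) (by omega), e1 2 (by omega) (by omega), hm0,
        encodeInput_source]
    · rw [e3 3 (by omega), e2 3 (by omega) (by omega) (by omega), e1 3 (by omega) (by omega), hm0,
        encodeInput_root]
    · rw [e3 6 (by omega), e2 6 (by omega) (by omega) (by omega), h6]

variable [DecidableEq V]

/-- The program returns a possible output of the algorithm. -/
theorem exec_treeProgram (ν : V ≃ Fin n) (hG : G.Connected) (U : Finset V) (r : V) :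
    ∃ T : RootedTree V r, IsOutput G U r T ∧
      EncodesTree ν (treeProgram.exec (encodeInput ν G U r)) T := by
  have hn : 0 < n := (ν r).pos
  obtain ⟨p, hp, hpd, hR3⟩ := exists_ready ν hG U r
  obtain ⟨m3, hm3⟩ : ∃ m, m = (shortestPaths 9).exec
    (loadGraph.exec (computeInfinity.exec (encodeInput ν G U r))) := ⟨_, rfl⟩
  rw [← hm3] at hR3
  obtain ⟨m4, hm4⟩ : ∃ m, m = (clearGraph 20).exec m3 := ⟨_, rfl⟩
  obtain ⟨m5, hm5⟩ : ∃ m, m = kruskal.exec m4 := ⟨_, rfl⟩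
  obtain ⟨m6, hm6⟩ : ∃ m, m = addShortcuts.exec m5 := ⟨_, rfl⟩
  obtain ⟨m7, hm7⟩ : ∃ m, m = (shortestPaths 19).exec m6 := ⟨_, rfl⟩
  obtain ⟨m8, hm8⟩ : ∃ m, m = (clearGraph 30).exec m7 := ⟨_, rfl⟩
  obtain ⟨m9, hm9⟩ : ∃ m, m = markPaths.exec m8 := ⟨_, rfl⟩
  obtain ⟨m10, hm10⟩ : ∃ m, m = (shortestPaths 29).exec m9 := ⟨_, rfl⟩
  have hexec : treeProgram.exec (encodeInput ν G U r) = writeTree.exec m10 := by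
    simp only [treeProgram, Program.exec, hm10, hm9, hm8, hm7, hm6, hm5, hm4, hm3]
  have hR4 : Ready ν G U r p m4 := hR3.congr_of_mods (l := (clearGraph 20).mods)
    (fun a ha => by rw [hm4, Program.exec_of_notMem_mods ha]) (by simp [clearGraph, Program.mods])
  have hR5 : Ready ν G U r p m5 := hR4.congr_of_mods (l := kruskal.mods)
    (fun a ha => by rw [hm5, Program.exec_of_notMem_mods ha]) (by
      simp [kruskal, considerEdge, shortestPaths, initDistances, relaxThrough, findParents, setEdge,
        Program.mods])
  have hR6 : Ready ν G U r p m6 := hR5.congr_of_mods (l := addShortcuts.mods)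
    (fun a ha => by rw [hm6, Program.exec_of_notMem_mods ha]) (by
      simp [addShortcuts, considerShortcut, shortestPaths, initDistances, relaxThrough, findParents,
        setEdge, Program.mods])
  have hR7 : Ready ν G U r p m7 := hR6.congr_of_mods (l := (shortestPaths 19).mods)
    (fun a ha => by rw [hm7, Program.exec_of_notMem_mods ha]) (by
      simp [shortestPaths, initDistances, relaxThrough, findParents, Program.mods])
  have hR8 : Ready ν G U r p m8 := hR7.congr_of_mods (l := (clearGraph 30).mods)
    (fun a ha => by rw [hm8, Program.exec_of_notMem_mods ha]) (by simp [clearGraph, Program.mods])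
  have hR9 : Ready ν G U r p m9 := hR8.congr_of_mods (l := markPaths.mods)
    (fun a ha => by rw [hm9, Program.exec_of_notMem_mods ha]) (by
      simp [markPaths, markStep, setEdge, Program.mods])
  have hR10 : Ready ν G U r p m10 := hR9.congr_of_mods (l := (shortestPaths 29).mods)
    (fun a ha => by rw [hm10, Program.exec_of_notMem_mods ha]) (by
      simp [shortestPaths, initDistances, relaxThrough, findParents, Program.mods])
  have hbot : embed (⊥ : SimpleGraph (Terminal U r)) = ⊥ := by
    ext x y
    simp [embed_adj]
  obtain ⟨F, hF, hext, h20F⟩ := exec_kruskal hG hR4 (fun u v => by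
    rw [hm4, exec_clearGraph ν (by omega) (by omega) (by omega) (by omega) hR3.num G.dist,
      hR3.infinity, hbot])
  rw [← hm5] at h20F
  obtain ⟨H, _, hHF, h20H, hwalk⟩ := exec_addShortcuts hG hR5 hF h20F
  rw [← hm6] at h20H
  obtain ⟨q, hq, hSH⟩ := hR6.exists_shortestPaths hG h20H
  obtain ⟨t, ht, hδ, hLAST⟩ := exists_isLAST ν hG hext hHF hwalk hSH
  have htr : t (rootTerminal U r) = rootTerminal U r :=
    Subtype.ext (by rw [ht, hSH.parent_self])
  obtain ⟨P, hP, hK⟩ := exists_pathUnion_eq ν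
    (δ := fun v => (shortestPaths 19).exec m6 21 (ν r) (ν v)) hG hp hpd htr hδ
  have h30 := exec_markPaths hR8 hp (fun t x hx => (hpd t x hx).1.ne) (t := t)
    (fun a => by
      rw [hm8, Program.exec_of_notMem_mods (by simp [clearGraph, Program.mods]), hm7, hq, ht])
    (fun u v => by
      rw [hm8, exec_clearGraph ν (by omega) (by omega) (by omega) (by omega) hR7.num (fun _ _ => 1),
        hR7.infinity])
  rw [hK, ← hm9] at h30
  set K := pathUnion P (parentGraph (rootTerminal U r) t)
  have hEK : EncodesGraph id K (fun _ => 1) (n * n) (weightMatrix K (fun _ _ => 1) (n * n)) :=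
    encodesGraph_weightMatrix (Nat.mul_pos hn hn)
  obtain ⟨q', hq', hSK⟩ := exec_shortestPaths ν (b := 29) hR9.num (fun x y => by
    rw [h30]
    exact hEK.pos x y)
  have hWeq : (fun x y : V => m9 (29 + 1) (ν x) (ν y)) =
      weightMatrix K (fun _ _ => 1) (n * n) := by
    funext x y
    exact h30 x y
  rw [hWeq, ← hm10] at hSK
  rw [← hm10] at hq'
  simp only [Nat.reduceAdd] at hSK hq'
  have hreach : ∀ u ∈ U, K.Reachable r u := by
    intro u hu
    let a : Terminal U r := ⟨u, Finset.mem_insert_of_mem hu⟩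
    obtain ⟨w⟩ := hLAST.isTree.connected (rootTerminal U r) a
    obtain ⟨w', _⟩ := pathUnion_walk hP w
    exact w'.reachable
  obtain ⟨T, hT, hnodes, hparent⟩ := exists_shortestPathTree ν hSK hreach
  refine ⟨T, ⟨_, hLAST, P, hP, hT⟩, ?_⟩
  rw [hexec]
  have hout := exec_writeTree hR10.num hR10.root
  refine ⟨fun v hv => ?_, fun v hv => ?_⟩
  · rw [(hout v).1, (hout v).2, hR10.infinity, if_pos ((hnodes v).1 hv), hparent]
    exact ⟨rfl, hq' r v⟩
  · rw [(hout v).1, hR10.infinity, if_neg ((hnodes v).not.1 hv)]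

end Input

end Aggregation

/-- The LAST-based algorithm is a 7-approximation algorithm: (1) each of its possible outputs is a
routing tree with energy cost at most 7 times that of any routing tree; (2) there is an
implementation that returns such an output on every instance, in a number of steps that is
polynomial in the number of nodes. -/
theorem theorem6 :
    (∀ (V : Type u) [Fintype V] [DecidableEq V] (N : Aggregation.Network V)
      (T : Aggregation.RootedTree V N.sink),
      Aggregation.IsOutput N.graph N.sources N.sink T →
        T.IsRoutingTree N.graph N.sources ∧
        ∀ T' : Aggregation.RootedTree V N.sink, T'.IsRoutingTree N.graph N.sources →
          N.cost T ≤ 7 * N.cost T') ∧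
    ∃ (prog : Aggregation.Program) (p : Polynomial ℕ),
      ∀ (V : Type u) [DecidableEq V] (N : Aggregation.Network V) (n : ℕ)
        (ν : V ≃ Fin n),
        prog.time (Aggregation.encodeInput ν N.graph N.sources N.sink) ≤ p.eval n ∧
        ∃ T : Aggregation.RootedTree V N.sink,
          Aggregation.IsOutput N.graph N.sources N.sink T ∧
          Aggregation.EncodesTree ν
            (prog.exec (Aggregation.encodeInput ν N.graph N.sources N.sink)) T := by
  refine ⟨fun V _ _ N T hT => ⟨hT.bounds.1, fun T' hT' => Aggregation.cost_le_of_isOutput N hT hT'⟩,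
    Aggregation.treeProgram, Aggregation.treeProgram.timeBound, fun V _ N n ν => ⟨?_, ?_⟩⟩
  · have := Aggregation.Program.time_le_timeBound Aggregation.loopsOverNodes_treeProgram
      Aggregation.zero_notMem_mods_treeProgram (Aggregation.encodeInput ν N.graph N.sources N.sink)
    rwa [Aggregation.encodeInput_num] at this
  · exact Aggregation.exec_treeProgram ν N.connected N.sources N.sink
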